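/- Let $d\in\mathbb N$, let $\mathbb T^d=\mathbb R^d/\mathbb Z^d$, and let $h\in C^0[0,\infty)\cap C^3(0,\infty)$. Put $p(\rho)=\rho h'(\rho)-h(\rho)$ and assume * $(\mathrm H_m)$ $p'(\rho)>0$ for $\rho>0$; * $(\mathrm A_1)$ $h(\rho)=\frac{k}{\gamma-1}\rho^\gamma+o(\rho^\gamma)$ as $\rho\to+\infty$, for some $\gamma>1$, $k>0$; * $(\mathrm A_2)$ $|p''(\rho)|\le A\,p'(\rho)/\rho = A\,h''(\rho)$ for all $\rho>0$, for some $A>0$. For the energy density $F(\rho,q)=h(\rho)+\frac{|q|^2}{2\rho}$ consider the quantum hydrodynamics system on $\mathbb T^d$ $$\partial_t\rho+\operatorname{div} m=0,\qquad \partial_t m+\operatorname{div}\Big(\frac{m\otimes m}{\rho}\Big)=\operatorname{div}S,\qquad S=\big(-p(\rho)+\Delta\rho\big)\mathbb I-\frac{\nabla\rho\otimes\nabla\rho}{\rho},$$ where $\operatorname{div}S=-\rho\nabla\big(F_\rho-\operatorname{div}F_q\big)=-\nabla p(\rho)+2\rho\nabla\big(\Delta\sqrt\rho/\sqrt\rho\big)$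 for smooth $\rho>0$. Fix $T>0$. **(H1)** Let $(\rho,m)$ be a dissipative (or conservative) weak solution: $\rho\ge0$; $\rho\in C([0,\infty);L^1(\mathbb T^d))$ and $m\in C([0,\infty);L^1(\mathbb T^d)^d)$; $\rho(t)$ has a weak gradient in $L^1$ for every $t\ge 0$; $\frac{m\otimes m}\rho,\,S\in L^1_{loc}([0,\infty)\times\mathbb T^d)$, with $\Delta\rho\in L^1_{loc}$ in the weak sense; and $$-\iint \rho\psi_t+m\cdot\nabla\psi\,dx\,dt=\int\rho(0)\psi(0)\,dx,\qquad -\iint m\cdot\varphi_t+\frac{m\otimes m}{\rho}:\nabla\varphi-S:\nabla\varphi\,dx\,dt=\int m(0)\cdot\varphi(0)\,dx$$ for all $C^1$ test functions $\psi$, $\varphi$ (scalar, resp. vector valued) compactly supported in $[0,\infty)\times\mathbb T^d$. The energy density $e=\frac{|m|^2}{2\rho}+F(\rho,\nabla\rho)$ is in $C([0,\infty);L^1(\mathbb T^d))$ and $$-\iint e\,\dot\theta\,dx\,dt\le\int e(0)\,\theta(0)\,dx$$ for all non-negative compactly supported $\theta\in W^{1,\infty}[0,\infty)$ (with equality in the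 conservative case). Moreover $\sup_{(0,T)}\int\rho\,dx<\infty$ and $\sup_{(0,T)}\int e\,dx<\infty$. Here $|m|^2/\rho$ and $|\nabla\rho|^2/\rho$ are $0$ at points where $\rho$ and the numerator vanish, and $+\infty$ where only $\rho$ vanishes. **(H2)** Let $(\bar\rho,\bar u)$ be a strong conservative solution on $(0,T)\times\mathbb T^d$: $\bar\rho$, $\bar u$ and the weak derivatives $\partial_t\bar\rho$, $\partial_t\partial_i\bar\rho$, $\partial_i\partial_j\bar\rho$, $\partial_i\partial_j\partial_k\bar\rho$, $\partial_t\bar u_i$, $\partial_j\bar u_i$, $\partial_i\partial_j\bar u_i$ are in $L^\infty((0,T)\times\mathbb T^d)$ (so that $\bar\rho,\nabla\bar\rho,\bar u$ are continuous on $[0,T]\times\mathbb T^d$), the equations $$\partial_t\bar\rho+\operatorname{div}(\bar\rho\bar u)=0,\qquad \bar\rho\big(\partial_t\bar u+(\bar u\cdot\nabla)\bar u\big)=-\bar\rho\,\nabla\big(F_\rho(\bar\rho,\nabla\bar\rho)-\operatorname{div}F_q(\bar\rho,\nabla\bar\rho)\big)$$ hold almost everywhere, and the energy inequality above holds on $[0,T)$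 with equality. Assume that $\bar\rho>0$ on $[0,T]\times\mathbb T^d$. Put $\bar m=\bar\rho\bar u$. With $h(\rho|\bar\rho)=h(\rho)-h(\bar\rho)-h'(\bar\rho)(\rho-\bar\rho)$ let $$\Psi(t)=\int_{\mathbb T^d}\Big(\tfrac12\rho\Big|\frac m\rho-\frac{\bar m}{\bar\rho}\Big|^2+h(\rho|\bar\rho)+\tfrac12\rho\Big|\frac{\nabla\rho}{\rho}-\frac{\nabla\bar\rho}{\bar\rho}\Big|^2\Big)(x,t)\,dx .$$ **Theorem.** The integrand of $\Psi(t)$ is integrable for every $t\in[0,T]$, and $$\Psi(t)\le C\,\Psi(0),\qquad t\in[0,T],$$ where $C>0$ depends only on $d$, the constant $A$ of $(\mathrm A_2)$, $T$, and a bound for $\bar u_i$, $\partial_t\bar u_i$, $\partial_j\bar u_i$ and $\partial_i\partial_j\bar u_i$ in $L^\infty((0,T)\times\mathbb T^d)$. In particular, if $\Psi(0)=0$, then $\sup_{t\in[0,T]}\Psi(t)=0$. Consequently weak–strong uniqueness holds: if $\rho(0)=\bar\rho(0)$ and $m(0)=\bar m(0)$ a.e., then $\rho(t)=\bar\rho(t)$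 and $m(t)=\bar m(t)$ a.e. for every $t\in[0,T]$. No boundedness of $\rho$ is assumed. -/

import Mathlib

open MeasureTheory Set Filter Topology Asymptotics
open scoped ContDiff

/-!
The torus `𝕋ᵈ = ℝᵈ / ℤᵈ` is handled through `ℤᵈ`-periodic functions on `ℝᵈ` and integrals over the
unit cell. A time-dependent field is a function `f : ℝ → ℝᵈ → F`, only used for times `t ≥ 0`.
-/

namespace QHD

/-- Euclidean space `ℝᵈ`. -/
abbrev Sp (d : ℕ) := EuclideanSpace ℝ (Fin d)

/-- The unit cell `[0,1)ᵈ`. -/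
def cell (d : ℕ) : Set (Sp d) := {x | ∀ i, x i ∈ Ico (0 : ℝ) 1}

/-- `ℤᵈ`-periodicity, i.e. `f` is a function on the torus. -/
def Periodic {d : ℕ} {F : Type*} (f : Sp d → F) : Prop :=
  ∀ (i : Fin d) (x : Sp d), f (x + EuclideanSpace.single i (1 : ℝ)) = f x

/-- Classical time derivative, for test functions. -/
noncomputable def dt {d : ℕ} (φ : ℝ → Sp d → ℝ) (t : ℝ) (x : Sp d) : ℝ :=
  deriv (fun s => φ s x) t

/-- Classical partial derivative in `x i`, for test functions. -/
noncomputable def dx {d : ℕ} (i : Fin d) (φ : Sp d → ℝ) (x : Sp d) : ℝ :=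
  fderiv ℝ φ x (EuclideanSpace.single i (1 : ℝ))

/-- `C¹` test functions on `[0,∞) × 𝕋ᵈ`, compactly supported in `[0,∞) × 𝕋ᵈ`. They need not vanish
at time `0`. -/
def IsTest {d : ℕ} (ψ : ℝ → Sp d → ℝ) : Prop :=
  ContDiff ℝ 1 (fun z : ℝ × Sp d => ψ z.1 z.2) ∧ (∀ t, Periodic (ψ t)) ∧
    ∃ R : ℝ, ∀ t, R ≤ t → ∀ x, ψ t x = 0

/-- `C_c^∞(I × 𝕋ᵈ)` for an open time interval `I`. -/
def IsInteriorTest {d : ℕ} (I : Set ℝ) (φ : ℝ → Sp d → ℝ) : Prop :=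
  ContDiff ℝ ∞ (fun z : ℝ × Sp d => φ z.1 z.2) ∧ (∀ t, Periodic (φ t)) ∧
    ∃ a b : ℝ, Icc a b ⊆ I ∧ ∀ t, t ∉ Icc a b → ∀ x, φ t x = 0

/-- `g` is the weak time derivative of `f` in `I × 𝕋ᵈ`. -/
def HasWeakDt {d : ℕ} (I : Set ℝ) (f g : ℝ → Sp d → ℝ) : Prop :=
  ∀ φ : ℝ → Sp d → ℝ, IsInteriorTest I φ →
    ∫ z in I ×ˢ cell d, f z.1 z.2 * dt φ z.1 z.2 = -∫ z in I ×ˢ cell d, g z.1 z.2 * φ z.1 z.2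

/-- `g` is the weak derivative of `f` in direction `x i` in `I × 𝕋ᵈ`. -/
def HasWeakDx {d : ℕ} (I : Set ℝ) (i : Fin d) (f g : ℝ → Sp d → ℝ) : Prop :=
  ∀ φ : ℝ → Sp d → ℝ, IsInteriorTest I φ →
    ∫ z in I ×ˢ cell d, f z.1 z.2 * dx i (φ z.1) z.2 = -∫ z in I ×ˢ cell d, g z.1 z.2 * φ z.1 z.2

/-- `g` is the weak divergence (in `x`) of the vector field `v` in `I × 𝕋ᵈ`. -/
def HasWeakDiv {d : ℕ} (I : Set ℝ) (v : ℝ → Sp d → Sp d) (g : ℝ → Sp d → ℝ) : Prop :=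
  ∀ φ : ℝ → Sp d → ℝ, IsInteriorTest I φ →
    ∫ z in I ×ˢ cell d, ∑ i, v z.1 z.2 i * dx i (φ z.1) z.2
      = -∫ z in I ×ˢ cell d, g z.1 z.2 * φ z.1 z.2

/-- `g` is the weak gradient of `f` on `𝕋ᵈ`. -/
def HasWeakGrad {d : ℕ} (f : Sp d → ℝ) (g : Sp d → Sp d) : Prop :=
  ∀ φ : Sp d → ℝ, ContDiff ℝ ∞ φ → Periodic φ → ∀ i,
    ∫ x in cell d, f x * dx i φ x = -∫ x in cell d, g x i * φ x

/-- `f ∈ C([0,∞); L¹(𝕋ᵈ))`, with `f` measurable on `[0,∞) × 𝕋ᵈ`. -/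
def ContL1 {d : ℕ} {F : Type*} [NormedAddCommGroup F] (f : ℝ → Sp d → F) : Prop :=
  AEStronglyMeasurable (fun z : ℝ × Sp d => f z.1 z.2) (volume.restrict (Ici 0 ×ˢ cell d)) ∧
  (∀ t, 0 ≤ t → IntegrableOn (f t) (cell d)) ∧
  ∀ t, 0 ≤ t → Tendsto (fun s => ∫ x in cell d, ‖f s x - f t x‖) (𝓝[Ici 0] t) (𝓝 0)

/-- `f ∈ L¹_loc([0,∞) × 𝕋ᵈ)`. -/
def LocL1 {d : ℕ} (f : ℝ → Sp d → ℝ) : Prop :=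
  ∀ R : ℝ, IntegrableOn (fun z : ℝ × Sp d => f z.1 z.2) (Icc 0 R ×ˢ cell d)

/-- `f ∈ L^∞((0,T) × 𝕋ᵈ)`. -/
def BddL {d : ℕ} (T : ℝ) (f : ℝ → Sp d → ℝ) : Prop :=
  (∀ t, Periodic (f t)) ∧
    MemLp (fun z : ℝ × Sp d => f z.1 z.2) ⊤ (volume.restrict (Ioo 0 T ×ˢ cell d))

/-- The pressure `p(ρ) = ρ h'(ρ) - h(ρ)`. At `ρ = 0` this is `-h(0)`, which is the limit of `p` at
`0+` when `h` is convex and continuous. -/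
noncomputable def pressure (h : ℝ → ℝ) (r : ℝ) : ℝ := r * deriv h r - h r

/-- Assumptions on the internal energy: monotone pressure, `γ`-growth at infinity, and
`|p''| ≤ A p'/ρ = A h''`. -/
structure InternalEnergy (h : ℝ → ℝ) (γ k A : ℝ) : Prop where
  cont : ContinuousOn h (Ici 0)
  smooth : ContDiffOn ℝ 3 h (Ioi 0)
  monotone : ∀ r, 0 < r → 0 < deriv (pressure h) r
  one_lt_exponent : 1 < γ
  k_pos : 0 < k
  growth : (fun r : ℝ => h r - k / (γ - 1) * r ^ γ) =o[atTop] fun r : ℝ => r ^ γ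
  A_pos : 0 < A
  second : ∀ r, 0 < r → |deriv (deriv (pressure h)) r| ≤ A * (deriv (pressure h) r / r)

/-- The potential energy density `F(ρ,q) = h(ρ) + |q|²/(2ρ)`. -/
noncomputable def potential {d : ℕ} (h : ℝ → ℝ) (r : ℝ) (q : Sp d) : ℝ :=
  h r + ‖q‖ ^ 2 / (2 * r)

/-- The total energy density `|m|²/(2ρ) + F(ρ,q)`. -/
noncomputable def energy {d : ℕ} (h : ℝ → ℝ) (r : ℝ) (q m : Sp d) : ℝ :=
  ‖m‖ ^ 2 / (2 * r) + potential h r q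

/-- The Korteweg stress `S = -s I + (div r) I - H` of the energy `F`, where `s = p(ρ)`,
`r = ρ F_q = q` and `H = q ⊗ F_q = q ⊗ q / ρ`; the argument `l` is `div r = Δρ`. -/
noncomputable def stress {d : ℕ} (h : ℝ → ℝ) (r : ℝ) (q : Sp d) (l : ℝ) (i j : Fin d) : ℝ :=
  (if i = j then -pressure h r + l else 0) - q i * q j / r

/-- `(ρ, m)` is a weak solution on `[0,∞) × 𝕋ᵈ` of
`∂ₜρ + div m = 0`, `∂ₜm + div (m ⊗ m / ρ) = div S`. Here `q` is the weak gradient of `ρ` and `l` its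
weak Laplacian, which enter the stress. The quotients `|m|²/ρ`, `|q|²/ρ` are read, as usual, as `0`
at vacuum if the numerator vanishes and as `+∞` otherwise; being a.e. finite they force the two
vacuum conditions (with `x / 0 = 0` the quotients then have the right value). -/
structure IsWeakSolution {d : ℕ} (h : ℝ → ℝ) (ρ : ℝ → Sp d → ℝ) (q : ℝ → Sp d → Sp d)
    (l : ℝ → Sp d → ℝ) (m : ℝ → Sp d → Sp d) : Prop where
  periodic_ρ : ∀ t, Periodic (ρ t)
  periodic_q : ∀ t, Periodic (q t)
  periodic_l : ∀ t, Periodic (l t)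
  periodic_m : ∀ t, Periodic (m t)
  cont_ρ : ContL1 ρ
  cont_m : ContL1 m
  nonneg : ∀ t, 0 ≤ t → ∀ᵐ x ∂volume.restrict (cell d), 0 ≤ ρ t x
  vacuum_m : ∀ t, 0 ≤ t → ∀ᵐ x ∂volume.restrict (cell d), ρ t x = 0 → m t x = 0
  vacuum_q : ∀ t, 0 ≤ t → ∀ᵐ x ∂volume.restrict (cell d), ρ t x = 0 → q t x = 0
  meas_q : AEStronglyMeasurable (fun z : ℝ × Sp d => q z.1 z.2)
    (volume.restrict (Ici 0 ×ˢ cell d))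
  int_q : ∀ t, 0 ≤ t → IntegrableOn (q t) (cell d)
  grad : ∀ t, 0 ≤ t → HasWeakGrad (ρ t) (q t)
  int_l : LocL1 l
  laplacian : HasWeakDiv (Ioi 0) q l
  int_flux : ∀ i j, LocL1 fun t x => m t x i * m t x j / ρ t x
  int_stress : ∀ i j, LocL1 fun t x => stress h (ρ t x) (q t x) (l t x) i j
  mass : ∀ ψ : ℝ → Sp d → ℝ, IsTest ψ →
    -∫ z in Ici (0 : ℝ) ×ˢ cell d,
        (ρ z.1 z.2 * dt ψ z.1 z.2 + ∑ i, m z.1 z.2 i * dx i (ψ z.1) z.2)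
      = ∫ x in cell d, ρ 0 x * ψ 0 x
  momentum : ∀ φ : Fin d → ℝ → Sp d → ℝ, (∀ i, IsTest (φ i)) →
    -∫ z in Ici (0 : ℝ) ×ˢ cell d,
        ((∑ i, m z.1 z.2 i * dt (φ i) z.1 z.2)
          + (∑ i, ∑ j, m z.1 z.2 i * m z.1 z.2 j / ρ z.1 z.2 * dx j (φ i z.1) z.2)
          - ∑ i, ∑ j, stress h (ρ z.1 z.2) (q z.1 z.2) (l z.1 z.2) i j * dx j (φ i z.1) z.2)
      = ∫ x in cell d, ∑ i, m 0 x i * φ i 0 x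

/-- A dissipative weak solution: the energy density is in `C([0,∞); L¹)` and satisfies the weak
energy inequality. The test functions `θ ∈ W^{1,∞}[0,∞)` are the Lipschitz ones. Conservative weak
solutions, for which equality holds, are dissipative. -/
structure IsDissipativeWeakSolution {d : ℕ} (h : ℝ → ℝ) (ρ : ℝ → Sp d → ℝ)
    (q : ℝ → Sp d → Sp d) (l : ℝ → Sp d → ℝ) (m : ℝ → Sp d → Sp d) : Prop
    extends IsWeakSolution h ρ q l m where
  cont_energy : ContL1 fun t x => energy h (ρ t x) (q t x) (m t x)
  dissipation : ∀ θ : ℝ → ℝ, (∃ K, LipschitzWith K θ) → (∀ t, 0 ≤ t → 0 ≤ θ t) →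
    (∃ R : ℝ, ∀ t, R ≤ t → θ t = 0) →
    -∫ z in Ici (0 : ℝ) ×ˢ cell d, energy h (ρ z.1 z.2) (q z.1 z.2) (m z.1 z.2) * deriv θ z.1
      ≤ ∫ x in cell d, energy h (ρ 0 x) (q 0 x) (m 0 x) * θ 0

/-- The bounds on mass and energy of the weak solution on `(0,T)`. -/
structure FiniteEnergy {d : ℕ} (h : ℝ → ℝ) (T K₁ K₂ : ℝ) (ρ : ℝ → Sp d → ℝ)
    (q m : ℝ → Sp d → Sp d) : Prop where
  mass_le : ∀ t ∈ Ioo 0 T, ∫ x in cell d, ρ t x ≤ K₁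
  energy_le : ∀ t ∈ Ioo 0 T, ∫ x in cell d, energy h (ρ t x) (q t x) (m t x) ≤ K₂

/-- Names for the weak derivatives of a strong solution `(ρ, u)`. -/
structure StrongDerivs (d : ℕ) where
  /-- `∂ₜ ρ` -/
  ρt : ℝ → Sp d → ℝ
  /-- `∇ρ` -/
  ρx : ℝ → Sp d → Sp d
  /-- `∂ₜ ∂ᵢ ρ` -/
  ρtx : Fin d → ℝ → Sp d → ℝ
  /-- `∂ⱼ ∂ᵢ ρ` -/
  ρxx : Fin d → Fin d → ℝ → Sp d → ℝ
  /-- `∂ₖ ∂ⱼ ∂ᵢ ρ` -/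
  ρxxx : Fin d → Fin d → Fin d → ℝ → Sp d → ℝ
  /-- `∂ₜ uᵢ` -/
  ut : Fin d → ℝ → Sp d → ℝ
  /-- `∂ⱼ uᵢ` -/
  ux : Fin d → Fin d → ℝ → Sp d → ℝ
  /-- `∂ⱼ ∂ᵢ uᵢ` (no summation) -/
  uxx : Fin d → Fin d → ℝ → Sp d → ℝ

/-- The variational derivative `F_ρ - div F_q = h'(ρ) - |∇ρ|²/(2ρ²) - div (∇ρ/ρ)`, with
`div (∇ρ/ρ) = ∑ᵢ (∂ᵢ∂ᵢρ/ρ - (∂ᵢρ)²/ρ²)`; it equals `h'(ρ) - 2 Δ√ρ/√ρ`. -/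
noncomputable def chemPotential {d : ℕ} (h : ℝ → ℝ) (ρ : ℝ → Sp d → ℝ) (D : StrongDerivs d)
    (t : ℝ) (x : Sp d) : ℝ :=
  deriv h (ρ t x) - ‖D.ρx t x‖ ^ 2 / (2 * ρ t x ^ 2)
    - ∑ i, (D.ρxx i i t x / ρ t x - D.ρx t x i ^ 2 / ρ t x ^ 2)

/-- `(ρ, u)` is a strong conservative solution on `(0,T) × 𝕋ᵈ` without vacuum, with weak derivatives
`D`, all in `L^∞`. Then `ρ`, `∇ρ` and `u` are Lipschitz in `(t,x)`; they are given by their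
continuous representatives on `[0,T] × 𝕋ᵈ`. -/
structure IsStrongSolution {d : ℕ} (h : ℝ → ℝ) (T : ℝ) (ρ : ℝ → Sp d → ℝ) (u : ℝ → Sp d → Sp d)
    (D : StrongDerivs d) : Prop where
  periodic_ρ : ∀ t, Periodic (ρ t)
  periodic_u : ∀ t, Periodic (u t)
  periodic_ρx : ∀ t, Periodic (D.ρx t)
  cont_ρ : ContinuousOn (fun z : ℝ × Sp d => ρ z.1 z.2) (Icc 0 T ×ˢ univ)
  cont_u : ContinuousOn (fun z : ℝ × Sp d => u z.1 z.2) (Icc 0 T ×ˢ univ)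
  cont_ρx : ContinuousOn (fun z : ℝ × Sp d => D.ρx z.1 z.2) (Icc 0 T ×ˢ univ)
  pos : ∀ t ∈ Icc 0 T, ∀ x, 0 < ρ t x
  weak_ρt : HasWeakDt (Ioo 0 T) ρ D.ρt
  weak_ρx : ∀ i, HasWeakDx (Ioo 0 T) i ρ fun t x => D.ρx t x i
  weak_ρtx : ∀ i, HasWeakDt (Ioo 0 T) (fun t x => D.ρx t x i) (D.ρtx i)
  weak_ρxx : ∀ i j, HasWeakDx (Ioo 0 T) j (fun t x => D.ρx t x i) (D.ρxx i j)
  weak_ρxxx : ∀ i j k, HasWeakDx (Ioo 0 T) k (D.ρxx i j) (D.ρxxx i j k)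
  weak_ut : ∀ i, HasWeakDt (Ioo 0 T) (fun t x => u t x i) (D.ut i)
  weak_ux : ∀ i j, HasWeakDx (Ioo 0 T) j (fun t x => u t x i) (D.ux i j)
  weak_uxx : ∀ i j, HasWeakDx (Ioo 0 T) j (D.ux i i) (D.uxx i j)
  bdd_ρt : BddL T D.ρt
  bdd_ρtx : ∀ i, BddL T (D.ρtx i)
  bdd_ρxx : ∀ i j, BddL T (D.ρxx i j)
  bdd_ρxxx : ∀ i j k, BddL T (D.ρxxx i j k)
  bdd_ut : ∀ i, BddL T (D.ut i)
  bdd_ux : ∀ i j, BddL T (D.ux i j)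
  bdd_uxx : ∀ i j, BddL T (D.uxx i j)
  /-- `∂ₜρ + div (ρu) = 0` -/
  mass : ∀ᵐ z ∂volume.restrict (Ioo 0 T ×ˢ cell d),
    D.ρt z.1 z.2 + ∑ i, (D.ρx z.1 z.2 i * u z.1 z.2 i + ρ z.1 z.2 * D.ux i i z.1 z.2) = 0
  /-- `ρ (∂ₜu + (u · ∇)u) = -ρ ∇(F_ρ - div F_q)`, where `g` is the weak gradient on the right -/
  momentum : ∃ g : Fin d → ℝ → Sp d → ℝ,
    (∀ j, BddL T (g j) ∧ HasWeakDx (Ioo 0 T) j (chemPotential h ρ D) (g j)) ∧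
    ∀ᵐ z ∂volume.restrict (Ioo 0 T ×ˢ cell d), ∀ j,
      ρ z.1 z.2 * (D.ut j z.1 z.2 + ∑ i, u z.1 z.2 i * D.ux j i z.1 z.2)
        = -(ρ z.1 z.2 * g j z.1 z.2)
  /-- the energy equality in weak form -/
  conservation : ∀ θ : ℝ → ℝ, (∃ K, LipschitzWith K θ) → (∀ t, 0 ≤ t → 0 ≤ θ t) →
    (∃ R : ℝ, R < T ∧ ∀ t, R ≤ t → θ t = 0) →
    -∫ z in Ioo 0 T ×ˢ cell d,
        energy h (ρ z.1 z.2) (D.ρx z.1 z.2) (ρ z.1 z.2 • u z.1 z.2) * deriv θ z.1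
      = ∫ x in cell d, energy h (ρ 0 x) (D.ρx 0 x) (ρ 0 x • u 0 x) * θ 0

/-- `|u|`, the first derivatives `∂ₜu`, `∂ⱼuᵢ` and the second derivatives `∂ⱼ∂ᵢuᵢ` are bounded by
`M` a.e. in `(0,T) × 𝕋ᵈ`. -/
def VelocityBound {d : ℕ} (T M : ℝ) (u : ℝ → Sp d → Sp d) (D : StrongDerivs d) : Prop :=
  ∀ᵐ z ∂volume.restrict (Ioo 0 T ×ˢ cell d), ∀ i j,
    |u z.1 z.2 i| ≤ M ∧ |D.ut i z.1 z.2| ≤ M ∧ |D.ux i j z.1 z.2| ≤ M ∧ |D.uxx i j z.1 z.2| ≤ M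

/-- The relative internal energy `h(r|s) = h(r) - h(s) - h'(s)(r - s)`. -/
noncomputable def relInternal (h : ℝ → ℝ) (r s : ℝ) : ℝ := h r - h s - deriv h s * (r - s)

/-- The relative energy density
`½ρ|m/ρ - m̄/ρ̄|² + h(ρ|ρ̄) + ½ρ|q/ρ - q̄/ρ̄|²`. -/
noncomputable def relEnergy {d : ℕ} (h : ℝ → ℝ) (r : ℝ) (q m : Sp d) (s : ℝ) (qb mb : Sp d) : ℝ :=
  1 / 2 * r * ‖r⁻¹ • m - s⁻¹ • mb‖ ^ 2 + relInternal h r s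
    + 1 / 2 * r * ‖r⁻¹ • q - s⁻¹ • qb‖ ^ 2

/-- The relative energy
`Ψ(t) = ∫ ½ρ|m/ρ - m̄/ρ̄|² + h(ρ|ρ̄) + ½ρ|∇ρ/ρ - ∇ρ̄/ρ̄|² dx`. -/
noncomputable def relTotal {d : ℕ} (h : ℝ → ℝ) (ρ : ℝ → Sp d → ℝ) (q m : ℝ → Sp d → Sp d)
    (ρb : ℝ → Sp d → ℝ) (qb mb : ℝ → Sp d → Sp d) (t : ℝ) : ℝ :=
  ∫ x in cell d, relEnergy h (ρ t x) (q t x) (m t x) (ρb t x) (qb t x) (mb t x)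

end QHD

/-! The proof is the relative energy method. With w = ∇ log ρ the capillary energy |∇ρ|²/(2ρ)
becomes ½ρ|w|², of the same form as the kinetic energy, and the variational derivative becomes μ =
h'(ρ) - ½|w|² - div w. After expanding the squares, the relative energy density of a weak state (e,
ρ, m, q = ∇ρ) against a smooth state (r, u), w = ∇ log r, is affine in e, ρ, m, q, with coefficients
that depend on (r, u) alone (`expandedRelEnergy`). Its evolution therefore follows from the weak
equations: the energy inequality is tested with θ(t), momentum with θu, mass with θ(½|u|² - μ), the
relation q = ∇ρ with θ'w + θV, where V is `driftField`, and the weak Laplacian with θ div u.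

By `relEnergy_identity`, two kinds of terms survive. The first are the residuals of the strong
equations, namely that of momentum, that of ∂ₜ log r + u·w + div u = 0, and the gradient of the
latter. The second is `relFlux`, which consists of ∇u contracted with ρ ξ⊗ξ, for ξ = m/ρ - u and for
ξ = q/ρ - w, and of div u times the relative pressure. Assumption (A₂) makes A h ± p convex, so that
|p(ρ|r)| ≤ A h(ρ|r) (`abs_relPressure_le`), and the whole remainder is at most d|M|(2 + A) times the
relative energy density (`abs_relFlux_le`). This bound is pointwise and uniform in ρ ≥ 0, vacuum
included, so no bound on ρ enters.

A strong solution has only bounded weak derivatives and is not itself a smooth comparison state. It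
is mollified in space-time; on compact subintervals of (0,T) all the derivatives needed converge
boundedly and almost everywhere, and the residuals tend to zero in the same sense
(`IsStrongSolution.exists_approximation`). Away from `relFlux`, which is estimated before the limit,
the weak solution enters only through L¹ weights multiplying these coefficients, so dominated
convergence applies (`IsApproximation.integral_relEnergy_le`).

Thus Ψ' ≤ d|M|(2 + A)Ψ in the distributions on (0,T). Since Ψ is continuous on [0,T]
(`continuousOn_relTotal`), Gronwall's inequality holds down to t = 0. Strict convexity of h turns
Ψ(t) = 0 into equality of the solutions, and equal initial data give Ψ(0) = 0 because weak gradients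
are unique. -/

namespace QHD

/-! ### Convexity of the internal energy and control of the relative pressure. -/

section Thermodynamics

variable {h : ℝ → ℝ} {γ k A : ℝ}

namespace InternalEnergy

lemma contDiffOn_deriv (H : InternalEnergy h γ k A) : ContDiffOn ℝ 2 (deriv h) (Ioi 0) := by
  have h3 : ContDiffOn ℝ (2 + 1) h (Ioi 0) := by
    have e : (2 + 1 : WithTop ℕ∞) = 3 := by norm_num
    rw [e]; exact H.smooth
  exact ((contDiffOn_succ_iff_deriv_of_isOpen isOpen_Ioi).1 h3).2.2

lemma contDiffOn_deriv2 (H : InternalEnergy h γ k A) :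
    ContDiffOn ℝ 1 (deriv (deriv h)) (Ioi 0) := by
  have h3 : ContDiffOn ℝ (1 + 1) (deriv h) (Ioi 0) := by
    have e : (1 + 1 : WithTop ℕ∞) = 2 := by norm_num
    rw [e]; exact H.contDiffOn_deriv
  exact ((contDiffOn_succ_iff_deriv_of_isOpen isOpen_Ioi).1 h3).2.2

lemma hasDerivAt (H : InternalEnergy h γ k A) {r : ℝ} (hr : 0 < r) :
    HasDerivAt h (deriv h r) r :=
  ((H.smooth.differentiableOn (by norm_num)).differentiableAt (Ioi_mem_nhds hr)).hasDerivAt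

lemma hasDerivAt_deriv (H : InternalEnergy h γ k A) {r : ℝ} (hr : 0 < r) :
    HasDerivAt (deriv h) (deriv (deriv h) r) r :=
  ((H.contDiffOn_deriv.differentiableOn (by norm_num)).differentiableAt
    (Ioi_mem_nhds hr)).hasDerivAt

lemma hasDerivAt_pressure (H : InternalEnergy h γ k A) {r : ℝ} (hr : 0 < r) :
    HasDerivAt (pressure h) (r * deriv (deriv h) r) r := by
  have := ((hasDerivAt_id r).mul (H.hasDerivAt_deriv hr)).sub (H.hasDerivAt hr)
  refine this.congr_deriv ?_
  simp

lemma deriv_pressure (H : InternalEnergy h γ k A) {r : ℝ} (hr : 0 < r) :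
    deriv (pressure h) r = r * deriv (deriv h) r :=
  (H.hasDerivAt_pressure hr).deriv

lemma contDiffOn_pressure (H : InternalEnergy h γ k A) : ContDiffOn ℝ 2 (pressure h) (Ioi 0) :=
  (contDiffOn_id.mul H.contDiffOn_deriv).sub (H.smooth.of_le (by norm_num))

lemma hasDerivAt_deriv_pressure (H : InternalEnergy h γ k A) {r : ℝ} (hr : 0 < r) :
    HasDerivAt (deriv (pressure h)) (deriv (deriv (pressure h)) r) r := by
  have h2 : ContDiffOn ℝ (1 + 1) (pressure h) (Ioi 0) := by
    have e : (1 + 1 : WithTop ℕ∞) = 2 := by norm_num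
    rw [e]; exact H.contDiffOn_pressure
  have h1 := ((contDiffOn_succ_iff_deriv_of_isOpen isOpen_Ioi).1 h2).2.2
  exact ((h1.differentiableOn (by norm_num)).differentiableAt (Ioi_mem_nhds hr)).hasDerivAt

lemma deriv2_pos (H : InternalEnergy h γ k A) {r : ℝ} (hr : 0 < r) : 0 < deriv (deriv h) r := by
  have := H.monotone r hr
  rw [H.deriv_pressure hr] at this
  exact pos_of_mul_pos_right this hr.le

lemma strictConvexOn (H : InternalEnergy h γ k A) : StrictConvexOn ℝ (Ici 0) h := by
  refine strictConvexOn_of_deriv2_pos (convex_Ici 0) H.cont fun x hx => ?_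
  rw [interior_Ici] at hx
  exact H.deriv2_pos hx

/-- A strictly convex function lies strictly above its tangents. Continuity of h at 0 gives strict
convexity on the closed half-line, so vacuum r = 0 is covered. -/
lemma relInternal_pos (H : InternalEnergy h γ k A) {r s : ℝ} (hr : 0 ≤ r) (hs : 0 < s)
    (hrs : r ≠ s) : 0 < relInternal h r s := by
  have hd := H.hasDerivAt hs
  unfold relInternal
  rcases lt_or_gt_of_ne hrs with hlt | hgt
  · have := H.strictConvexOn.slope_lt_of_hasDerivAt hr hs.le hlt hd
    rw [slope_def_field, div_lt_iff₀ (by linarith)] at this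
    nlinarith
  · have := H.strictConvexOn.lt_slope_of_hasDerivAt hs.le hr hgt hd
    rw [slope_def_field, lt_div_iff₀ (by linarith)] at this
    nlinarith

lemma relInternal_nonneg (H : InternalEnergy h γ k A) {r s : ℝ} (hr : 0 ≤ r) (hs : 0 < s) :
    0 ≤ relInternal h r s := by
  by_cases hrs : r = s
  · subst hrs; simp [relInternal]
  · exact (H.relInternal_pos hr hs hrs).le

/-- `p` is continuous up to `0`, because `r h'(r) → 0`. -/
lemma tendsto_pressure_zero (H : InternalEnergy h γ k A) :
    Tendsto (pressure h) (𝓝[>] 0) (𝓝 (-h 0)) := by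
  have hc : Tendsto h (𝓝[>] 0) (𝓝 (h 0)) :=
    (H.cont 0 self_mem_Ici).mono_left (nhdsWithin_mono _ Ioi_subset_Ici_self)
  have h2 : Tendsto (fun r : ℝ => h (2 * r)) (𝓝[>] 0) (𝓝 (h 0)) := by
    refine hc.comp (tendsto_nhdsWithin_iff.2 ⟨?_, ?_⟩)
    · have : Tendsto (fun r : ℝ => 2 * r) (𝓝 0) (𝓝 (2 * 0)) := tendsto_id.const_mul 2
      rw [mul_zero] at this
      exact this.mono_left nhdsWithin_le_nhds
    · filter_upwards [self_mem_nhdsWithin] with r hr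
      simpa using hr
  -- The tangent at r, compared with h at 0 and at 2r, squeezes r h'(r) between h(r) - h(0) and
  -- h(2r) - h(r).
  have key : Tendsto (fun r : ℝ => r * deriv h r) (𝓝[>] 0) (𝓝 0) := by
    have l1 : Tendsto (fun r : ℝ => h r - h 0) (𝓝[>] 0) (𝓝 0) := by
      simpa using hc.sub_const (h 0)
    have l2 : Tendsto (fun r : ℝ => h (2 * r) - h r) (𝓝[>] 0) (𝓝 0) := by
      simpa using h2.sub hc
    refine tendsto_of_tendsto_of_tendsto_of_le_of_le' l1 l2 ?_ ?_
    · filter_upwards [self_mem_nhdsWithin] with r hr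
      have := H.relInternal_nonneg le_rfl (mem_Ioi.1 hr)
      unfold relInternal at this
      linarith
    · filter_upwards [self_mem_nhdsWithin] with r hr
      have hr : 0 < r := hr
      have := H.relInternal_nonneg (r := 2 * r) (by linarith) hr
      unfold relInternal at this
      linarith
  have h3 := key.sub hc
  rw [zero_sub] at h3
  exact h3

/-- The relative pressure is controlled by the relative internal energy. -/
lemma abs_relPressure_le (H : InternalEnergy h γ k A) {r s : ℝ} (hr : 0 ≤ r) (hs : 0 < s) :
    |pressure h r - pressure h s - s * deriv (deriv h) s * (r - s)| ≤ A * relInternal h r s := by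
  have key : ∀ σ : ℝ, |σ| = 1 → ∀ r, 0 < r →
      0 ≤ A * relInternal h r s
        + σ * (pressure h r - pressure h s - s * deriv (deriv h) s * (r - s)) := by
    intro σ hσ r hr
    -- By |p''| ≤ A h'' both A h + p and A h - p are convex. The tangent inequality at s for these
    -- two functions is the claim.
    have hconv : ConvexOn ℝ (Ioi 0) (fun r => A * h r + σ * pressure h r) := by
      have e1 : ∀ x ∈ Ioi (0 : ℝ), HasDerivAt (fun r => A * h r + σ * pressure h r)
          (A * deriv h x + σ * deriv (pressure h) x) x := fun x hx =>
        ((H.hasDerivAt hx).const_mul A).add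
          (((H.hasDerivAt_pressure hx).congr_deriv (H.deriv_pressure hx).symm).const_mul σ)
      have e2 : ∀ x ∈ Ioi (0 : ℝ), HasDerivAt (fun x => A * deriv h x + σ * deriv (pressure h) x)
          (A * deriv (deriv h) x + σ * deriv (deriv (pressure h)) x) x := fun x hx =>
        ((H.hasDerivAt_deriv hx).const_mul A).add ((H.hasDerivAt_deriv_pressure hx).const_mul σ)
      refine convexOn_of_hasDerivWithinAt2_nonneg (convex_Ioi 0)
        (fun x hx => (e1 x hx).continuousAt.continuousWithinAt)
        (f' := fun x => A * deriv h x + σ * deriv (pressure h) x)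
        (f'' := fun x => A * deriv (deriv h) x + σ * deriv (deriv (pressure h)) x) ?_ ?_ ?_
      · intro x hx; rw [interior_Ioi] at hx ⊢; exact (e1 x hx).hasDerivWithinAt
      · intro x hx; rw [interior_Ioi] at hx ⊢; exact (e2 x hx).hasDerivWithinAt
      · intro x hx
        rw [interior_Ioi] at hx
        have hx : 0 < x := hx
        have h1 := H.second x hx
        rw [H.deriv_pressure hx, mul_div_cancel_left₀ _ hx.ne'] at h1
        have h2 : |σ * deriv (deriv (pressure h)) x| ≤ A * deriv (deriv h) x := by
          rw [abs_mul, hσ, one_mul]; exact h1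
        linarith [(abs_le.1 h2).1]
    have hd : HasDerivAt (fun r => A * h r + σ * pressure h r)
        (A * deriv h s + σ * (s * deriv (deriv h) s)) s :=
      ((H.hasDerivAt hs).const_mul A).add ((H.hasDerivAt_pressure hs).const_mul σ)
    unfold relInternal
    rcases lt_trichotomy r s with hlt | rfl | hgt
    · have := hconv.slope_le_of_hasDerivAt (mem_Ioi.2 hr) (mem_Ioi.2 hs) hlt hd
      rw [slope_def_field, div_le_iff₀ (by linarith)] at this
      nlinarith
    · simp
    · have := hconv.le_slope_of_hasDerivAt (mem_Ioi.2 hs) (mem_Ioi.2 hr) hgt hd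
      rw [slope_def_field, le_div_iff₀ (by linarith)] at this
      nlinarith
  have key0 : ∀ σ : ℝ, |σ| = 1 → 0 ≤ A * relInternal h r s
        + σ * (pressure h r - pressure h s - s * deriv (deriv h) s * (r - s)) := by
    intro σ hσ
    rcases hr.lt_or_eq with hr | rfl
    · exact key σ hσ r hr
    -- At vacuum the inequality is the limit r → 0+. The junk value of `deriv h 0` is multiplied by
    -- 0, so `pressure h 0` is the true limit.
    have hp0 : pressure h 0 = -h 0 := by simp [pressure]
    have hc : Tendsto h (𝓝[>] 0) (𝓝 (h 0)) :=
      (H.cont 0 self_mem_Ici).mono_left (nhdsWithin_mono _ Ioi_subset_Ici_self)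
    have hi : Tendsto (fun r : ℝ => r - s) (𝓝[>] 0) (𝓝 (0 - s)) :=
      (tendsto_id.sub_const s).mono_left nhdsWithin_le_nhds
    have hp := H.tendsto_pressure_zero
    rw [← hp0] at hp
    refine ge_of_tendsto ((((hc.sub_const (h s)).sub (hi.const_mul (deriv h s))).const_mul A).add
      (((hp.sub_const (pressure h s)).sub (hi.const_mul (s * deriv (deriv h) s))).const_mul σ)) ?_
    filter_upwards [self_mem_nhdsWithin] with r hr
    exact key σ hσ r hr
  have h1 := key0 1 (by simp)
  have h2 := key0 (-1) (by simp)
  rw [abs_le]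
  constructor <;> linarith

end InternalEnergy

end Thermodynamics

/-! ### Periodic functions, the tiling of space by the unit cell, and periodization. -/

section Tiling

variable {d : ℕ}

/-- Space-time points. -/
abbrev Pt (d : ℕ) := ℝ × Sp d

instance : (volume : Measure (Pt d)).IsAddHaarMeasure := by
  rw [Measure.volume_eq_prod]; infer_instance

instance : (volume : Measure (Pt d)).IsAddRightInvariant :=
  ⟨fun g => by simp_rw [add_comm _ g]; exact map_add_left_eq_self volume g⟩

/-- The lattice vector with integer coordinates `k`. -/
def latticeVec (k : Fin d → ℤ) : Sp d := WithLp.toLp 2 fun i => (k i : ℝ)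

@[simp] lemma latticeVec_apply (k : Fin d → ℤ) (i : Fin d) : latticeVec k i = k i := rfl

/-- The periods of f form an additive subgroup, which contains the unit vectors and hence the
lattice. -/
lemma Periodic.add_latticeVec {F : Type*} {f : Sp d → F} (hf : Periodic f) (k : Fin d → ℤ)
    (x : Sp d) : f (x + latticeVec k) = f x := by
  let S : AddSubgroup (Sp d) :=
    { carrier := {p | ∀ x, f (x + p) = f x}
      zero_mem' := fun x => by simp
      add_mem' := fun {a b} ha hb x => by rw [← add_assoc, hb, ha]
      neg_mem' := fun {a} ha x => by
        have := ha (x + -a)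
        rw [neg_add_cancel_right] at this
        exact this.symm }
  have hk : latticeVec k = ∑ i, k i • EuclideanSpace.single i (1 : ℝ) := by
    ext j
    simp [latticeVec, Finset.sum_apply, Pi.single_apply]
  have : latticeVec k ∈ S := by
    rw [hk]
    exact S.sum_mem fun i _ => S.zsmul_mem (hf i) _
  exact this x

/-- The closed unit cell. -/
def box (d : ℕ) : Set (Sp d) := {x | ∀ i, x i ∈ Icc (0 : ℝ) 1}

lemma isCompact_box : IsCompact (box d) := by
  have h1 : IsCompact (univ.pi fun _ : Fin d => Icc (0 : ℝ) 1) :=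
    isCompact_univ_pi fun _ => isCompact_Icc
  have h2 := (EuclideanSpace.equiv (Fin d) ℝ).toHomeomorph.isClosedEmbedding.isCompact_preimage h1
  convert h2 using 1
  ext x
  simp only [box, mem_ofPred_eq, mem_preimage, mem_univ_pi]
  rfl

lemma cell_subset_box : cell d ⊆ box d := fun _ hx i => ⟨(hx i).1, (hx i).2.le⟩

lemma measurableSet_cell : MeasurableSet (cell d) := by
  have : cell d = ⋂ i, (fun x : Sp d => x i) ⁻¹' Ico 0 1 := by ext x; simp [cell]
  rw [this]
  exact MeasurableSet.iInter fun i =>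
    (by fun_prop : Measurable fun x : Sp d => x i) measurableSet_Ico

lemma volume_cell_lt_top : volume (cell d) < ⊤ :=
  (measure_mono cell_subset_box).trans_lt isCompact_box.measure_lt_top

instance : IsFiniteMeasure (volume.restrict (cell d)) := ⟨by
  rw [Measure.restrict_apply_univ]; exact volume_cell_lt_top⟩

lemma volume_restrict_prod (I : Set ℝ) : (volume : Measure (Pt d)).restrict (I ×ˢ cell d)
    = (volume.restrict I).prod (volume.restrict (cell d)) := by
  rw [Measure.volume_eq_prod, Measure.prod_restrict]

/-- The vector of integer parts is the only lattice translation bringing x into the half-open cell;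
existence gives covering by the tiles, uniqueness their disjointness. -/
lemma sub_latticeVec_mem_cell (x : Sp d) (k : Fin d → ℤ) :
    x - latticeVec k ∈ cell d ↔ k = fun i => ⌊x i⌋ := by
  constructor
  · intro hx
    ext i
    have := hx i
    simp only [PiLp.sub_apply, latticeVec_apply, mem_Ico] at this
    symm
    rw [Int.floor_eq_iff]
    constructor <;> linarith
  · rintro rfl i
    simp only [PiLp.sub_apply, latticeVec_apply, mem_Ico]
    exact ⟨by linarith [Int.floor_le (x i)], by linarith [Int.lt_floor_add_one (x i)]⟩

/-- The translate of `ℝ × cell` by a lattice vector. -/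
def tile (k : Fin d → ℤ) : Set (Pt d) := {z | z.2 - latticeVec k ∈ cell d}

lemma iUnion_tile : ⋃ k : Fin d → ℤ, tile k = univ := by
  ext z
  simp only [mem_iUnion, mem_univ, iff_true]
  exact ⟨_, (sub_latticeVec_mem_cell z.2 _).2 rfl⟩

lemma disjoint_tile : Pairwise (Function.onFun Disjoint (tile (d := d))) := by
  intro k l hkl
  rw [Function.onFun, Set.disjoint_left]
  intro z hk hl
  exact hkl (((sub_latticeVec_mem_cell z.2 k).1 hk).trans ((sub_latticeVec_mem_cell z.2 l).1 hl).symm)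

lemma measurableSet_tile (k : Fin d → ℤ) : MeasurableSet (tile k) :=
  (by fun_prop : Measurable fun z : Pt d => z.2 - latticeVec k) measurableSet_cell

lemma preimage_tile (k : Fin d → ℤ) :
    (fun z : Pt d => z + (0, latticeVec k)) ⁻¹' tile k = univ ×ˢ cell d := by
  ext z
  simp [tile]

lemma setIntegral_tile (k : Fin d → ℤ) (f : Pt d → ℝ) :
    ∫ z in tile k, f z = ∫ z in univ ×ˢ cell d, f (z.1, z.2 + latticeVec k) := by
  have h1 := (measurePreserving_add_right (volume : Measure (Pt d))
    ((0, latticeVec k) : Pt d)).setIntegral_preimage_emb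
    (MeasurableEquiv.addRight ((0, latticeVec k) : Pt d)).measurableEmbedding f (tile k)
  rw [preimage_tile] at h1
  rw [← h1]
  congr 1
  ext z
  congr 1
  ext <;> simp

/-- Functions of space-time that are periodic in space. -/
def SpacePeriodic (F : Pt d → ℝ) : Prop := ∀ t, Periodic fun x => F (t, x)

lemma SpacePeriodic.add_latticeVec {F : Pt d → ℝ} (hF : SpacePeriodic F) (k : Fin d → ℤ)
    (z : Pt d) : F (z.1, z.2 + latticeVec k) = F z :=
  (hF z.1).add_latticeVec k z.2

/-- A periodic property that holds a.e. on the unit cell holds a.e. -/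
lemma ae_of_ae_cell {I : Set ℝ} {P : Pt d → Prop} (hI : MeasurableSet I)
    (hP : ∀ t i x, P (t, x + EuclideanSpace.single i (1 : ℝ)) ↔ P (t, x))
    (h : ∀ᵐ z ∂volume.restrict (I ×ˢ cell d), P z) : ∀ᵐ z : Pt d, z.1 ∈ I → P z := by
  have hper : ∀ (k : Fin d → ℤ) (z : Pt d), P (z.1, z.2 + latticeVec k) ↔ P z := fun k z =>
    iff_of_eq (Periodic.add_latticeVec (f := fun x => P (z.1, x))
      (fun i x => propext (hP z.1 i x)) k z.2)
  rw [ae_restrict_iff' (hI.prod measurableSet_cell)] at h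
  have h2 : ∀ k : Fin d → ℤ, ∀ᵐ z : Pt d, z ∈ tile k → z.1 ∈ I → P z := by
    intro k
    have := (measurePreserving_add_right (volume : Measure (Pt d))
      (-(0, latticeVec k) : Pt d)).quasiMeasurePreserving.ae h
    filter_upwards [this] with z hz hzk hzI
    have h3 := hz ⟨by simpa using hzI, by simpa [tile, sub_eq_add_neg] using hzk⟩
    rw [← hper k] at h3
    simpa using h3
  have h3 := ae_all_iff.2 h2
  filter_upwards [h3] with z hz
  have : z ∈ ⋃ k : Fin d → ℤ, tile k := by rw [iUnion_tile]; trivial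
  obtain ⟨k, hk⟩ := mem_iUnion.1 this
  exact hz k hk

/-- Measurability of periodic functions is inherited from the unit cell. -/
lemma SpacePeriodic.aestronglyMeasurable {F : Pt d → ℝ} (hF : SpacePeriodic F)
    (h : AEStronglyMeasurable F (volume.restrict (univ ×ˢ cell d))) :
    AEStronglyMeasurable F volume := by
  rw [← Measure.restrict_univ (μ := volume), ← iUnion_tile, aestronglyMeasurable_iUnion_iff]
  intro k
  have hmp := (measurePreserving_sub_right (volume : Measure (Pt d))
    ((0, latticeVec k) : Pt d)).restrict_preimage (MeasurableSet.univ.prod (measurableSet_cell (d := d)))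
  have e : (fun z : Pt d => z - (0, latticeVec k)) ⁻¹' (univ ×ˢ cell d) = tile k := by
    ext z; simp [tile]
  rw [e] at hmp
  refine (h.comp_measurePreserving hmp).congr (ae_of_all _ fun z => ?_)
  have := hF.add_latticeVec k (z - (0, latticeVec k))
  simpa using this.symm

/-! ### Periodization -/

/-- Local finiteness: over a bounded region of space, and for all times at once, only finitely many
lattice translates meet the support. -/
lemma exists_finset_of_hasCompactSupport {φ : Pt d → ℝ} (hφ : HasCompactSupport φ) (R : ℝ) :
    ∃ S : Finset (Fin d → ℤ), ∀ z : Pt d, ‖z.2‖ ≤ R → ∀ k ∉ S, φ (z.1, z.2 + latticeVec k) = 0 := by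
  obtain ⟨N, hN⟩ := hφ.isCompact.isBounded.exists_norm_le
  refine ⟨Fintype.piFinset fun _ => Finset.Icc (-⌈N + R⌉) ⌈N + R⌉, fun z hz k hk => ?_⟩
  by_contra hne
  apply hk
  have hmem := hN _ (subset_tsupport _ hne)
  have h1 : ‖z.2 + latticeVec k‖ ≤ N := (norm_snd_le _).trans hmem
  have h2 : ‖latticeVec k‖ ≤ N + R := by
    have : latticeVec k = (z.2 + latticeVec k) - z.2 := by abel
    rw [this]
    exact (norm_sub_le _ _).trans (by linarith)
  rw [Fintype.mem_piFinset]
  intro i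
  have h3 : |(k i : ℝ)| ≤ N + R := by
    have := PiLp.norm_apply_le (latticeVec k) i
    rw [latticeVec_apply, Real.norm_eq_abs] at this
    linarith
  have h4 := abs_le.1 (h3.trans (Int.le_ceil _))
  rw [Finset.mem_Icc]
  constructor
  · have := h4.1; exact_mod_cast this
  · have := h4.2; exact_mod_cast this

/-- The periodization in space. -/
noncomputable def periodize (φ : Pt d → ℝ) (z : Pt d) : ℝ :=
  ∑' k : Fin d → ℤ, φ (z.1, z.2 + latticeVec k)

lemma spacePeriodic_periodize (φ : Pt d → ℝ) : SpacePeriodic (periodize φ) := by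
  intro t i x
  simp only [periodize]
  rw [← (Equiv.addRight (Pi.single i 1 : Fin d → ℤ)).tsum_eq (fun k => φ (t, x + latticeVec k))]
  congr 1
  ext k
  congr 2
  ext j
  by_cases hj : j = i
  · subst hj; simp; ring
  · simp [hj]

lemma periodize_eq_sum {φ : Pt d → ℝ} {S : Finset (Fin d → ℤ)} {z : Pt d}
    (h : ∀ k ∉ S, φ (z.1, z.2 + latticeVec k) = 0) :
    periodize φ z = ∑ k ∈ S, φ (z.1, z.2 + latticeVec k) :=
  tsum_eq_sum fun k hk => h k hk

/-- Near a point the series is one fixed finite sum, which is why smoothness and derivatives pass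
through it. -/
lemma exists_periodize_eventuallyEq {φ : Pt d → ℝ} (hφ : HasCompactSupport φ) (z : Pt d) :
    ∃ S : Finset (Fin d → ℤ),
      (∀ k ∉ S, ∀ᶠ y in 𝓝 z, φ (y.1, y.2 + latticeVec k) = 0) ∧
      periodize φ =ᶠ[𝓝 z] fun y => ∑ k ∈ S, φ (y.1, y.2 + latticeVec k) := by
  obtain ⟨S, hS⟩ := exists_finset_of_hasCompactSupport hφ (‖z.2‖ + 1)
  have hev : ∀ᶠ y in 𝓝 z, ‖y.2‖ ≤ ‖z.2‖ + 1 := by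
    have : Tendsto (fun y : Pt d => ‖y.2‖) (𝓝 z) (𝓝 ‖z.2‖) :=
      (by fun_prop : Continuous fun y : Pt d => ‖y.2‖).tendsto z
    filter_upwards [this.eventually_lt_const (lt_add_one _)] with y hy using hy.le
  refine ⟨S, fun k hk => ?_, ?_⟩
  · filter_upwards [hev] with y hy using hS y hy k hk
  · filter_upwards [hev] with y hy using periodize_eq_sum (hS y hy)

lemma contDiff_periodize {φ : Pt d → ℝ} {n : WithTop ℕ∞} (hφ : HasCompactSupport φ)
    (h : ContDiff ℝ n φ) : ContDiff ℝ n (periodize φ) := by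
  rw [contDiff_iff_contDiffAt]
  intro z
  obtain ⟨S, -, hS⟩ := exists_periodize_eventuallyEq hφ z
  refine ContDiffAt.congr_of_eventuallyEq ?_ hS
  have : ContDiff ℝ n fun y : Pt d => ∑ k ∈ S, φ (y.1, y.2 + latticeVec k) := by fun_prop
  exact this.contDiffAt

lemma fderiv_periodize {φ : Pt d → ℝ} (hφ : HasCompactSupport φ) (h : Differentiable ℝ φ)
    (z v : Pt d) : fderiv ℝ (periodize φ) z v = periodize (fun y => fderiv ℝ φ y v) z := by
  obtain ⟨S, h0, hS⟩ := exists_periodize_eventuallyEq hφ z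
  have hshift : ∀ (k : Fin d → ℤ) (y : Pt d),
      HasFDerivAt (fun y : Pt d => φ (y.1, y.2 + latticeVec k))
        (fderiv ℝ φ (y.1, y.2 + latticeVec k)) y := by
    intro k y
    have e : (fun y : Pt d => φ (y.1, y.2 + latticeVec k)) = fun y => φ (y + (0, latticeVec k)) := by
      ext y; congr 1; ext <;> simp
    have e2 : ((y.1, y.2 + latticeVec k) : Pt d) = y + (0, latticeVec k) := by ext <;> simp
    rw [e, e2]
    exact (hasFDerivAt_comp_add_right _).2 (h _).hasFDerivAt
  rw [hS.fderiv_eq, (HasFDerivAt.fun_sum fun k _ => hshift k z).fderiv, periodize_eq_sum (S := S)]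
  · simp
  · intro k hk
    have h1 : (fun y : Pt d => φ (y.1, y.2 + latticeVec k)) =ᶠ[𝓝 z] fun _ => 0 := h0 k hk
    have h2 := h1.fderiv_eq (𝕜 := ℝ)
    rw [(hshift k z).fderiv] at h2
    rw [h2]
    simp

/-- Integrals over space-time against compactly supported functions fold to the unit cell. -/
lemma integral_mul_eq_periodize {F φ : Pt d → ℝ} (hF : SpacePeriodic F)
    (hφ : HasCompactSupport φ) (hint : Integrable fun z => F z * φ z) :
    ∫ z, F z * φ z = ∫ z in univ ×ˢ cell d, F z * periodize φ z := by
  obtain ⟨R, hR⟩ := (isCompact_box (d := d)).isBounded.exists_norm_le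
  obtain ⟨S, hS⟩ := exists_finset_of_hasCompactSupport hφ R
  -- The integral is split over the tiles and each piece is shifted back to the unit cell.
  -- Periodicity leaves F unchanged, and the finitely many shifted copies of φ add up to its
  -- periodization.
  have h1 : HasSum (fun k : Fin d → ℤ => ∫ z in tile k, F z * φ z) (∫ z, F z * φ z) := by
    have := hasSum_integral_iUnion (μ := (volume : Measure (Pt d)))
      (f := fun z => F z * φ z) measurableSet_tile disjoint_tile
      (by rw [iUnion_tile]; exact hint.integrableOn)
    rwa [iUnion_tile, setIntegral_univ] at this
  have e : ∀ (k : Fin d → ℤ), ∫ z in tile k, F z * φ z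
      = ∫ z in univ ×ˢ cell d, F z * φ (z.1, z.2 + latticeVec k) := by
    intro k
    rw [setIntegral_tile]
    simp_rw [hF.add_latticeVec]
  have hz : ∀ k ∉ S, ∫ z in tile k, F z * φ z = 0 := by
    intro k hk
    rw [e]
    refine setIntegral_eq_zero_of_forall_eq_zero fun z hz => ?_
    rw [hS z (hR _ (cell_subset_box hz.2)) k hk, mul_zero]
  rw [← h1.tsum_eq, tsum_eq_sum hz]
  simp_rw [e]
  rw [← integral_finsetSum]
  · refine setIntegral_congr_fun (MeasurableSet.univ.prod measurableSet_cell) fun z hz => ?_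
    rw [periodize_eq_sum (hS z (hR _ (cell_subset_box hz.2))), Finset.mul_sum]
  · intro k _
    have h2 := (measurePreserving_add_right (volume : Measure (Pt d))
      ((0, latticeVec k) : Pt d)).integrable_comp_of_integrable hint
    refine (h2.congr (ae_of_all _ fun z => ?_)).integrableOn
    have h3 := hF.add_latticeVec k z
    have e2 : ((z.1, z.2 + latticeVec k) : Pt d) = z + (0, latticeVec k) := by ext <;> simp
    rw [e2] at h3 ⊢
    simp [h3]

end Tiling

/-! ### Weak derivatives on (0,T) × ℝᵈ in place of those on the torus. -/

section Derivatives

variable {d : ℕ}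

/-- The time direction. -/
def eT : Pt d := (1, 0)

/-- The spatial coordinate directions. -/
noncomputable def eX (i : Fin d) : Pt d := (0, EuclideanSpace.single i (1 : ℝ))

/-- Directional derivatives in space-time. -/
noncomputable def pd (v : Pt d) (F : Pt d → ℝ) (z : Pt d) : ℝ := fderiv ℝ F z v

lemma dt_curry {F : Pt d → ℝ} (hF : Differentiable ℝ F) (t : ℝ) (x : Sp d) :
    dt (fun t x => F (t, x)) t x = pd eT F (t, x) := by
  have h1 : HasDerivAt (fun s : ℝ => ((s, x) : Pt d)) eT t :=
    (hasDerivAt_id t).prodMk (hasDerivAt_const t x)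
  exact ((hF (t, x)).hasFDerivAt.comp_hasDerivAt t h1).deriv

lemma dx_curry {F : Pt d → ℝ} (hF : Differentiable ℝ F) (i : Fin d) (t : ℝ) (x : Sp d) :
    dx i (fun x => F (t, x)) x = pd (eX i) F (t, x) := by
  have h1 : HasFDerivAt (fun y : Sp d => ((t, y) : Pt d))
      (ContinuousLinearMap.inr ℝ ℝ (Sp d)) x :=
    (hasFDerivAt_const t x).prodMk (hasFDerivAt_id x)
  unfold dx pd
  have h2 := ((hF (t, x)).hasFDerivAt.comp x h1).fderiv
  have h3 : (F ∘ fun y : Sp d => ((t, y) : Pt d)) = fun y => F (t, y) := rfl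
  rw [h3] at h2
  rw [h2]
  simp [eX]

/-- Extension of a function on `(0,T) × 𝕋ᵈ` by a constant. -/
noncomputable def extendBy (T c : ℝ) (f : ℝ → Sp d → ℝ) (z : Pt d) : ℝ :=
  open Classical in if z.1 ∈ Ioo 0 T then f z.1 z.2 else c

lemma extendBy_of_mem {T c : ℝ} {f : ℝ → Sp d → ℝ} {z : Pt d} (hz : z.1 ∈ Ioo 0 T) :
    extendBy T c f z = f z.1 z.2 := if_pos hz

lemma extendBy_of_notMem {T c : ℝ} {f : ℝ → Sp d → ℝ} {z : Pt d} (hz : z.1 ∉ Ioo 0 T) :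
    extendBy T c f z = c := if_neg hz

lemma spacePeriodic_extendBy {T c : ℝ} {f : ℝ → Sp d → ℝ} (hf : ∀ t, Periodic (f t)) :
    SpacePeriodic (extendBy T c f) := by
  intro t i x
  by_cases ht : t ∈ Ioo 0 T
  · simpa only [extendBy_of_mem (z := (t, _)) ht] using hf t i x
  · simp only [extendBy_of_notMem (z := (t, _)) ht]

/-- Essentially bounded measurable functions on space-time. -/
structure EssBdd (F : Pt d → ℝ) : Prop where
  meas : AEStronglyMeasurable F volume
  bdd : ∃ C, ∀ᵐ z, |F z| ≤ C

lemma EssBdd.locallyIntegrable {F : Pt d → ℝ} (hF : EssBdd F) : LocallyIntegrable F := by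
  obtain ⟨C, hC⟩ := hF.bdd
  exact (locallyIntegrable_const C).mono hF.meas (hC.mono fun z hz => by
    rw [Real.norm_eq_abs, Real.norm_eq_abs]; exact hz.trans (le_abs_self C))

lemma EssBdd.integrable_mul {F φ : Pt d → ℝ} (hF : EssBdd F) (hc : Continuous φ)
    (hφ : HasCompactSupport φ) : Integrable fun z => F z * φ z := by
  have := hF.locallyIntegrable.integrable_smul_right_of_hasCompactSupport hc hφ
  simpa using this

lemma measurableSet_strip (T : ℝ) : MeasurableSet (Ioo 0 T ×ˢ (univ : Set (Sp d))) :=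
  measurableSet_Ioo.prod MeasurableSet.univ

lemma essBdd_extendBy {T c : ℝ} {f : ℝ → Sp d → ℝ} (hf : ∀ t, Periodic (f t))
    (hm : AEStronglyMeasurable (fun z : Pt d => f z.1 z.2) (volume.restrict (Ioo 0 T ×ˢ cell d)))
    (hb : ∃ C, ∀ᵐ z ∂volume.restrict (Ioo 0 T ×ˢ cell d), |f z.1 z.2| ≤ C) :
    EssBdd (extendBy T c f) := by
  constructor
  · refine (spacePeriodic_extendBy hf).aestronglyMeasurable ?_
    classical
    have h1 : AEStronglyMeasurable ((Ioo 0 T ×ˢ cell d).piecewise (fun z : Pt d => f z.1 z.2)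
        fun _ => c) volume :=
      AEStronglyMeasurable.piecewise (measurableSet_Ioo.prod measurableSet_cell) hm
        aestronglyMeasurable_const
    refine h1.restrict.congr ?_
    filter_upwards [ae_restrict_mem (MeasurableSet.univ.prod measurableSet_cell)] with z hz
    by_cases hz1 : z.1 ∈ Ioo 0 T
    · rw [extendBy_of_mem hz1, Set.piecewise_eq_of_mem _ _ _ (mk_mem_prod hz1 hz.2)]
    · rw [extendBy_of_notMem hz1, Set.piecewise_eq_of_notMem _ _ _ fun h => hz1 (mem_prod.1 h).1]
  · obtain ⟨C, hC⟩ := hb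
    refine ⟨max C |c|, ?_⟩
    have := ae_of_ae_cell (P := fun z : Pt d => |f z.1 z.2| ≤ C) measurableSet_Ioo
      (fun t i x => by simp only [hf t i x]) hC
    filter_upwards [this] with z hz
    by_cases hz1 : z.1 ∈ Ioo 0 T
    · rw [extendBy_of_mem hz1]; exact (hz hz1).trans (le_max_left _ _)
    · rw [extendBy_of_notMem hz1]; exact le_max_right _ _

lemma BddL.ae_bdd {T : ℝ} {f : ℝ → Sp d → ℝ} (hf : BddL T f) :
    ∃ C, ∀ᵐ z ∂volume.restrict (Ioo 0 T ×ˢ cell d), |f z.1 z.2| ≤ C := by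
  have h1 := hf.2.2
  rw [eLpNorm_exponent_top] at h1
  refine ⟨(eLpNormEssSup (fun z : Pt d => f z.1 z.2)
    (volume.restrict (Ioo 0 T ×ˢ cell d))).toReal, ?_⟩
  filter_upwards [ae_le_eLpNormEssSup (f := fun z : Pt d => f z.1 z.2)
    (μ := volume.restrict (Ioo 0 T ×ˢ cell d))] with z hz
  have := ENNReal.toReal_mono h1.ne hz
  rwa [toReal_enorm, Real.norm_eq_abs] at this

lemma BddL.essBdd {T : ℝ} {f : ℝ → Sp d → ℝ} (hf : BddL T f) (c : ℝ) :
    EssBdd (extendBy T c f) :=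
  essBdd_extendBy hf.1 hf.2.1 hf.ae_bdd

/-- `G` is the weak derivative of `F` in direction `v` in `(0,T) × ℝᵈ`. -/
def WeakDeriv (T : ℝ) (v : Pt d) (F G : Pt d → ℝ) : Prop :=
  ∀ φ : Pt d → ℝ, ContDiff ℝ ∞ φ → HasCompactSupport φ → tsupport φ ⊆ Ioo 0 T ×ˢ univ →
    ∫ z, F z * pd v φ z = -∫ z, G z * φ z

lemma exists_time_support {T : ℝ} {φ : Pt d → ℝ} (hφ : HasCompactSupport φ)
    (hs : tsupport φ ⊆ Ioo 0 T ×ˢ univ) :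
    ∃ a b : ℝ, Icc a b ⊆ Ioo 0 T ∧ ∀ z : Pt d, z.1 ∉ Icc a b → z ∉ tsupport φ := by
  have hK : IsCompact (Prod.fst '' tsupport φ) := hφ.isCompact.image continuous_fst
  have hKI : Prod.fst '' tsupport φ ⊆ Ioo 0 T := by
    rintro _ ⟨z, hz, rfl⟩; exact (hs hz).1
  rcases (Prod.fst '' tsupport φ).eq_empty_or_nonempty with h0 | hne
  -- If the support is empty, the empty interval `Icc 1 0` serves.
  · refine ⟨1, 0, by simp, fun z _ hz => ?_⟩
    have : z.1 ∈ Prod.fst '' tsupport φ := ⟨z, hz, rfl⟩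
    rw [h0] at this
    exact this
  · obtain ⟨a, ha⟩ := hK.exists_isLeast hne
    obtain ⟨b, hb⟩ := hK.exists_isGreatest hne
    exact ⟨a, b, fun t ht => ⟨(hKI ha.1).1.trans_le ht.1, ht.2.trans_lt (hKI hb.1).2⟩,
      fun z hz hz2 => hz ⟨ha.2 ⟨z, hz2, rfl⟩, hb.2 ⟨z, hz2, rfl⟩⟩⟩

lemma isInteriorTest_periodize {T : ℝ} {φ : Pt d → ℝ} (h : ContDiff ℝ ∞ φ)
    (hφ : HasCompactSupport φ) (hs : tsupport φ ⊆ Ioo 0 T ×ˢ univ) :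
    IsInteriorTest (Ioo 0 T) fun t x => periodize φ (t, x) := by
  refine ⟨contDiff_periodize hφ h, spacePeriodic_periodize φ, ?_⟩
  obtain ⟨a, b, hab, h0⟩ := exists_time_support hφ hs
  refine ⟨a, b, hab, fun t ht x => ?_⟩
  refine (tsum_congr fun k => ?_).trans tsum_zero
  exact image_eq_zero_of_notMem_tsupport (h0 _ ht)

lemma integral_extendBy_mul {T c : ℝ} {f : ℝ → Sp d → ℝ} {ψ : Pt d → ℝ}
    (hψ : ∀ z : Pt d, z.1 ∉ Ioo 0 T → ψ z = 0) :
    ∫ z in univ ×ˢ cell d, extendBy T c f z * ψ z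
      = ∫ z in Ioo 0 T ×ˢ cell d, f z.1 z.2 * ψ z := by
  have hsub : Ioo 0 T ×ˢ cell d ⊆ univ ×ˢ cell d := prod_mono (subset_univ _) subset_rfl
  rw [setIntegral_eq_of_subset_of_forall_sdiff_eq_zero
    (MeasurableSet.univ.prod measurableSet_cell) hsub]
  · refine setIntegral_congr_fun (measurableSet_Ioo.prod measurableSet_cell) fun z hz => ?_
    simp only [extendBy_of_mem hz.1]
  · rintro z ⟨hz1, hz2⟩
    rw [hψ z fun h => hz2 ⟨h, hz1.2⟩, mul_zero]

/-- The periodization of a compactly supported test function is an admissible periodic one, and both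
integrals fold to the unit cell. The constants c, c' used outside (0,T) play no role, because test
functions vanish there. -/
lemma weakDeriv_aux {T c c' : ℝ} {v : Pt d} {f g : ℝ → Sp d → ℝ} (hf : ∀ t, Periodic (f t))
    (hg : ∀ t, Periodic (g t)) (hF : EssBdd (extendBy T c f)) (hG : EssBdd (extendBy T c' g))
    (h : ∀ φ : Pt d → ℝ, ContDiff ℝ ∞ φ → IsInteriorTest (Ioo 0 T) (fun t x => φ (t, x)) →
      ∫ z in Ioo 0 T ×ˢ cell d, f z.1 z.2 * pd v φ z
        = -∫ z in Ioo 0 T ×ˢ cell d, g z.1 z.2 * φ z) :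
    WeakDeriv T v (extendBy T c f) (extendBy T c' g) := by
  intro φ hφ hc hs
  have hd : Differentiable ℝ φ := hφ.differentiable (by simp)
  have hcd : HasCompactSupport (pd v φ) := hc.fderiv_apply ℝ v
  have hcont : Continuous (pd v φ) := (hφ.continuous_fderiv (by simp)).clm_apply continuous_const
  rw [integral_mul_eq_periodize (spacePeriodic_extendBy hf) hcd (hF.integrable_mul hcont hcd),
    integral_mul_eq_periodize (spacePeriodic_extendBy hg) hc (hG.integrable_mul hφ.continuous hc)]
  obtain ⟨a, b, hab, h0⟩ := exists_time_support hc hs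
  have z1 : ∀ z : Pt d, z.1 ∉ Ioo 0 T → periodize φ z = 0 := fun z hz => by
    refine (tsum_congr fun k => ?_).trans tsum_zero
    exact image_eq_zero_of_notMem_tsupport (h0 _ fun hm => hz (hab hm))
  have z2 : ∀ z : Pt d, z.1 ∉ Ioo 0 T → periodize (pd v φ) z = 0 := fun z hz => by
    refine (tsum_congr fun k => ?_).trans tsum_zero
    exact image_eq_zero_of_notMem_tsupport
      fun hm => h0 (z.1, z.2 + latticeVec k) (fun hm => hz (hab hm))
        (tsupport_fderiv_apply_subset ℝ v hm)
  rw [integral_extendBy_mul z1, integral_extendBy_mul z2,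
    ← h _ (contDiff_periodize hc hφ) (isInteriorTest_periodize hφ hc hs)]
  congr 1
  ext z
  rw [pd, fderiv_periodize hc hd]
  rfl

lemma HasWeakDx.weakDeriv {T c c' : ℝ} {i : Fin d} {f g : ℝ → Sp d → ℝ}
    (h : HasWeakDx (Ioo 0 T) i f g) (hf : ∀ t, Periodic (f t))
    (hg : ∀ t, Periodic (g t)) (hF : EssBdd (extendBy T c f)) (hG : EssBdd (extendBy T c' g)) :
    WeakDeriv T (eX i) (extendBy T c f) (extendBy T c' g) := by
  refine weakDeriv_aux hf hg hF hG fun φ hφ hφt => ?_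
  have := h _ hφt
  simpa only [dx_curry (hφ.differentiable (by simp))] using this

lemma HasWeakDt.weakDeriv {T c c' : ℝ} {f g : ℝ → Sp d → ℝ}
    (h : HasWeakDt (Ioo 0 T) f g) (hf : ∀ t, Periodic (f t))
    (hg : ∀ t, Periodic (g t)) (hF : EssBdd (extendBy T c f)) (hG : EssBdd (extendBy T c' g)) :
    WeakDeriv T eT (extendBy T c f) (extendBy T c' g) := by
  refine weakDeriv_aux hf hg hF hG fun φ hφ hφt => ?_
  have := h _ hφt
  simpa only [dt_curry (hφ.differentiable (by simp))] using this

end Derivatives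

/-! ### Mollification in space-time. -/

section Mollification

variable {d : ℕ}

/-- A sequence of bump functions concentrating at the origin. -/
noncomputable def bump (n : ℕ) : ContDiffBump (0 : Pt d) where
  rIn := 1 / (n + 1) / 2
  rOut := 1 / (n + 1)
  rIn_pos := by positivity
  rIn_lt_rOut := by
    have : (0 : ℝ) < 1 / (n + 1) := by positivity
    linarith

lemma tendsto_rOut : Tendsto (fun n => (bump (d := d) n).rOut) atTop (𝓝 0) :=
  tendsto_one_div_add_atTop_nhds_zero_nat

/-- Mollification in space-time. -/
noncomputable def mollify (n : ℕ) (F : Pt d → ℝ) : Pt d → ℝ :=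
  convolution ((bump n).normed volume) F (ContinuousLinearMap.lsmul ℝ ℝ) volume

lemma mollify_apply (n : ℕ) (F : Pt d → ℝ) (z : Pt d) :
    mollify n F z = ∫ y, (bump n).normed volume y * F (z - y) := rfl

lemma contDiff_mollify (n : ℕ) {F : Pt d → ℝ} (hF : EssBdd F) : ContDiff ℝ ∞ (mollify n F) :=
  (bump n).hasCompactSupport_normed.contDiff_convolution_left _ (bump n).contDiff_normed
    hF.locallyIntegrable

lemma spacePeriodic_mollify (n : ℕ) {F : Pt d → ℝ} (hF : SpacePeriodic F) :
    SpacePeriodic (mollify n F) := by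
  intro t i x
  simp only [mollify_apply]
  congr 1
  ext y
  have := hF (t - y.1) i (x - y.2)
  simp only at this
  have e1 : ((t, x + EuclideanSpace.single i 1) : Pt d) - y
      = (t - y.1, x - y.2 + EuclideanSpace.single i 1) := by
    ext <;> simp
    abel
  rw [e1, this]
  rfl

lemma integrable_mollify (n : ℕ) {F : Pt d → ℝ} (hF : EssBdd F) (z : Pt d) :
    Integrable fun y => (bump n).normed volume y * F (z - y) :=
  ((bump n).hasCompactSupport_normed.convolutionExists_left (ContinuousLinearMap.lsmul ℝ ℝ)
    (bump n).continuous_normed hF.locallyIntegrable z)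

/-- Averaging against a nonnegative kernel of mass one turns an almost everywhere bound into one at
every point. In particular mollified densities stay away from vacuum. -/
lemma le_mollify (n : ℕ) {F : Pt d → ℝ} (hF : EssBdd F) {c : ℝ} (h : ∀ᵐ z, c ≤ F z) (z : Pt d) :
    c ≤ mollify n F z := by
  have h1 : ∫ y : Pt d, (bump n).normed volume y * c = c := by
    rw [integral_mul_const, (bump n).integral_normed, one_mul]
  rw [← h1, mollify_apply]
  refine integral_mono_ae ((bump n).integrable_normed.mul_const c) (integrable_mollify n hF z) ?_
  have := (Measure.measurePreserving_sub_left (volume : Measure (Pt d)) z).quasiMeasurePreserving.ae h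
  filter_upwards [this] with y hy
  exact mul_le_mul_of_nonneg_left hy ((bump n).nonneg_normed y)

lemma mollify_neg (n : ℕ) (F : Pt d → ℝ) (z : Pt d) :
    mollify n (fun z => -F z) z = -mollify n F z := by
  simp only [mollify_apply, mul_neg, integral_neg]

lemma EssBdd.neg {F : Pt d → ℝ} (hF : EssBdd F) : EssBdd fun z => -F z :=
  ⟨hF.meas.neg, by simpa only [abs_neg] using hF.bdd⟩

lemma abs_mollify_le (n : ℕ) {F : Pt d → ℝ} (hF : EssBdd F) {c : ℝ} (h : ∀ᵐ z, |F z| ≤ c)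
    (z : Pt d) : |mollify n F z| ≤ c := by
  have h1 := le_mollify n hF (c := -c) (h.mono fun z hz => (abs_le.1 hz).1) z
  have h2 := le_mollify n hF.neg (c := -c) (h.mono fun z hz => by linarith [(abs_le.1 hz).2]) z
  rw [mollify_neg] at h2
  exact abs_le.2 ⟨h1, by linarith⟩

lemma ae_tendsto_mollify {F : Pt d → ℝ} (hF : EssBdd F) :
    ∀ᵐ z, Tendsto (fun n => mollify n F z) atTop (𝓝 (F z)) := by
  -- Lebesgue differentiation needs the ratio of outer to inner radius to stay bounded; here it is
  -- 2.
  refine ContDiffBump.ae_convolution_tendsto_right_of_locallyIntegrable (K := 2) tendsto_rOut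
    (Eventually.of_forall fun n => ?_) hF.locallyIntegrable
  simp only [bump]
  linarith

lemma pd_convolution {η F : Pt d → ℝ} (hηs : ContDiff ℝ ∞ η) (hηc : HasCompactSupport η)
    (hF : LocallyIntegrable F) (v z : Pt d) :
    pd v (convolution η F (ContinuousLinearMap.lsmul ℝ ℝ) volume) z
      = ∫ y, F y * fderiv ℝ η (z - y) v := by
  have e1 : pd v (convolution η F (ContinuousLinearMap.lsmul ℝ ℝ) volume) z
      = ∫ y, fderiv ℝ η y v * F (z - y) := by
    have := hηc.hasFDerivAt_convolution_left (ContinuousLinearMap.lsmul ℝ ℝ) (hηs.of_le (by simp))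
      hF z
    have hex : Integrable fun y => ((ContinuousLinearMap.lsmul ℝ ℝ).precompL (Pt d))
        (fderiv ℝ η y) (F (z - y)) :=
      HasCompactSupport.convolutionExists_left _ (hηc.fderiv (𝕜 := ℝ))
        (hηs.continuous_fderiv (by simp)) hF z
    rw [pd, this.fderiv, convolution, ContinuousLinearMap.integral_apply hex]
    rfl
  rw [e1, ← integral_sub_left_eq_self (fun y => fderiv ℝ η y v * F (z - y)) volume z]
  congr 1
  ext y
  rw [sub_sub_cancel, mul_comm]

lemma hasFDerivAt_comp_sub {η : Pt d → ℝ} (hη : Differentiable ℝ η) (z y : Pt d) :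
    HasFDerivAt (fun y => η (z - y)) (-fderiv ℝ η (z - y)) y := by
  have := (hη (z - y)).hasFDerivAt.comp y ((hasFDerivAt_id y).const_sub z)
  refine this.congr_fderiv ?_
  ext <;> simp

lemma tsupport_bump_sub_subset (n : ℕ) (z : Pt d) :
    tsupport (fun y => (bump n).normed volume (z - y))
      ⊆ Metric.closedBall z (1 / ((n : ℝ) + 1)) := by
  refine closure_minimal (fun y hy => ?_) Metric.isClosed_closedBall
  have hy' : z - y ∈ Function.support ((bump n).normed volume : Pt d → ℝ) := hy
  rw [(bump n).support_normed_eq, mem_ball_zero_iff] at hy'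
  rw [mem_closedBall_iff_norm, norm_sub_rev]
  exact hy'.le

/-- The reflected kernel centred at z is a test function supported in (0,T) as soon as z is more
than the kernel radius 1/(n+1) away from both end times. Mollification then commutes with the weak
derivative. -/
lemma pd_mollify (n : ℕ) {T : ℝ} {v : Pt d} {F G : Pt d → ℝ} (hF : EssBdd F)
    (h : WeakDeriv T v F G) {z : Pt d} (h1 : 1 / ((n : ℝ) + 1) < z.1)
    (h2 : z.1 < T - 1 / ((n : ℝ) + 1)) : pd v (mollify n F) z = mollify n G z := by
  have hηs : ContDiff ℝ ∞ ((bump n).normed volume : Pt d → ℝ) := (bump n).contDiff_normed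
  have hηd : Differentiable ℝ ((bump n).normed volume : Pt d → ℝ) := hηs.differentiable (by simp)
  have hsub := tsupport_bump_sub_subset n z
  have key := h (fun y => (bump n).normed volume (z - y))
    (hηs.comp (contDiff_const.sub contDiff_id))
    (HasCompactSupport.of_support_subset_isCompact (isCompact_closedBall z (1 / ((n : ℝ) + 1)))
      (subset_closure.trans hsub)) (fun y hy => by
        have hy := hsub hy
        rw [mem_closedBall_iff_norm] at hy
        have := (norm_fst_le _).trans hy
        rw [Real.norm_eq_abs, abs_le] at this
        have h3 := this.1
        have h4 := this.2
        rw [Prod.fst_sub] at h3 h4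
        exact ⟨⟨by linarith, by linarith⟩, trivial⟩)
  have e4 : ∀ y, pd v (fun y => (bump n).normed volume (z - y)) y
      = -fderiv ℝ ((bump n).normed volume) (z - y) v := by
    intro y
    rw [pd, (hasFDerivAt_comp_sub hηd z y).fderiv]
    simp
  simp only [e4, mul_neg, integral_neg, neg_inj] at key
  rw [mollify, pd_convolution hηs (bump n).hasCompactSupport_normed hF.locallyIntegrable, key,
    mollify_apply, ← integral_sub_left_eq_self
      (fun y => (bump n).normed volume y * G (z - y)) volume z]
  congr 1
  ext y
  rw [sub_sub_cancel, mul_comm]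

end Mollification

/-! ### Bounded almost everywhere convergence and its algebra. -/

section Convergence

variable {d : ℕ} {T : ℝ} {F F' : ℕ → Pt d → ℝ} {f f' : Pt d → ℝ}

/-- Sequences of functions on space-time that eventually agree on compact subintervals of `(0,T)`. -/
def EvEq (T : ℝ) (F F' : ℕ → Pt d → ℝ) : Prop :=
  ∀ a b, 0 < a → b < T → ∀ᶠ n in atTop, ∀ z : Pt d, z.1 ∈ Icc a b → F n z = F' n z

/-- Bounded almost everywhere convergence on compact subintervals of `(0,T)`. -/
structure BAC (T : ℝ) (F : ℕ → Pt d → ℝ) (f : Pt d → ℝ) : Prop where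
  bdd : ∃ C, ∀ a b, 0 < a → b < T →
    ∀ᶠ n in atTop, ∀ z : Pt d, z.1 ∈ Icc a b → |F n z| ≤ C
  lim : ∀ᵐ z : Pt d, z.1 ∈ Ioo 0 T → Tendsto (fun n => F n z) atTop (𝓝 (f z))

lemma EvEq.symm (h : EvEq T F F') : EvEq T F' F := fun a b ha hb =>
  (h a b ha hb).mono fun _ hn z hz => (hn z hz).symm

lemma EvEq.trans {F'' : ℕ → Pt d → ℝ} (h : EvEq T F F') (h' : EvEq T F' F'') : EvEq T F F'' :=
  fun a b ha hb => ((h a b ha hb).and (h' a b ha hb)).mono fun _ hn z hz =>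
    (hn.1 z hz).trans (hn.2 z hz)

lemma EvEq.pd (h : EvEq T F F') (v : Pt d) :
    EvEq T (fun n => pd v (F n)) (fun n => pd v (F' n)) := by
  intro a b ha hb
  -- Derivatives agree only where the functions agree on a neighbourhood, so the interval is
  -- enlarged inside (0,T).
  filter_upwards [h (a / 2) ((b + T) / 2) (by linarith) (by linarith)] with n hn z hz
  have : F n =ᶠ[𝓝 z] F' n := by
    have h1 : ∀ᶠ y : Pt d in 𝓝 z, y.1 ∈ Ioo (a / 2) ((b + T) / 2) :=
      continuous_fst.continuousAt.eventually (Ioo_mem_nhds (by linarith [hz.1]) (by linarith [hz.2]))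
    filter_upwards [h1] with y hy using hn y ⟨hy.1.le, hy.2.le⟩
  rw [QHD.pd, QHD.pd, this.fderiv_eq]

lemma BAC.congr (h : BAC T F f) (he : EvEq T F F') : BAC T F' f := by
  constructor
  · obtain ⟨C, hC⟩ := h.bdd
    exact ⟨C, fun a b ha hb => ((hC a b ha hb).and (he a b ha hb)).mono fun n hn z hz => by
      rw [← hn.2 z hz]; exact hn.1 z hz⟩
  · filter_upwards [h.lim] with z hz hzt
    exact (hz hzt).congr' ((he z.1 z.1 hzt.1 hzt.2).mono fun n hn => hn z ⟨le_rfl, le_rfl⟩)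

lemma BAC.congr_lim (h : BAC T F f) (he : ∀ᵐ z : Pt d, z.1 ∈ Ioo 0 T → f z = f' z) :
    BAC T F f' :=
  ⟨h.bdd, by filter_upwards [h.lim, he] with z h1 h2 hz using h2 hz ▸ h1 hz⟩

lemma BAC.const (c : ℝ) : BAC T (fun _ (_ : Pt d) => c) fun _ => c :=
  ⟨⟨|c|, fun _ _ _ _ => Eventually.of_forall fun _ _ _ => le_rfl⟩,
    ae_of_all _ fun _ _ => tendsto_const_nhds⟩

lemma BAC.add (h : BAC T F f) (h' : BAC T F' f') :
    BAC T (fun n z => F n z + F' n z) fun z => f z + f' z := by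
  constructor
  · obtain ⟨C, hC⟩ := h.bdd
    obtain ⟨C', hC'⟩ := h'.bdd
    exact ⟨C + C', fun a b ha hb => ((hC a b ha hb).and (hC' a b ha hb)).mono fun n hn z hz =>
      (abs_add_le _ _).trans (add_le_add (hn.1 z hz) (hn.2 z hz))⟩
  · filter_upwards [h.lim, h'.lim] with z h1 h2 hz using (h1 hz).add (h2 hz)

lemma BAC.mul (h : BAC T F f) (h' : BAC T F' f') :
    BAC T (fun n z => F n z * F' n z) fun z => f z * f' z := by
  constructor
  · obtain ⟨C, hC⟩ := h.bdd
    obtain ⟨C', hC'⟩ := h'.bdd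
    refine ⟨C * C', fun a b ha hb => ((hC a b ha hb).and (hC' a b ha hb)).mono
      fun n hn z hz => ?_⟩
    rw [abs_mul]
    exact mul_le_mul (hn.1 z hz) (hn.2 z hz) (abs_nonneg _) ((abs_nonneg _).trans (hn.1 z hz))
  · filter_upwards [h.lim, h'.lim] with z h1 h2 hz using (h1 hz).mul (h2 hz)

lemma BAC.neg (h : BAC T F f) : BAC T (fun n z => -F n z) fun z => -f z := by
  simpa using (BAC.const (T := T) (-1 : ℝ)).mul h

lemma BAC.sub (h : BAC T F f) (h' : BAC T F' f') :
    BAC T (fun n z => F n z - F' n z) fun z => f z - f' z := by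
  simpa [sub_eq_add_neg] using h.add h'.neg

lemma BAC.pow (h : BAC T F f) (k : ℕ) : BAC T (fun n z => F n z ^ k) fun z => f z ^ k := by
  induction k with
  | zero => simpa using BAC.const (T := T) (1 : ℝ)
  | succ k ih => simpa [pow_succ] using ih.mul h

lemma BAC.sum {ι : Type*} (s : Finset ι) {F : ι → ℕ → Pt d → ℝ} {f : ι → Pt d → ℝ}
    (h : ∀ i ∈ s, BAC T (F i) (f i)) : BAC T (fun n z => ∑ i ∈ s, F i n z) fun z => ∑ i ∈ s, f i z := by
  classical
  induction s using Finset.induction_on with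
  | empty => simpa using BAC.const (T := T) (0 : ℝ)
  | insert i s hi ih =>
    simp only [Finset.sum_insert hi]
    exact (h i (Finset.mem_insert_self i s)).add
      (ih fun j hj => h j (Finset.mem_insert_of_mem hj))

/-- The common compact range gives both the bound and the continuity of φ at the limit. It serves
for 1/ρ, h', h'' and p, which are continuous only on ρ > 0. -/
lemma BAC.comp (h : BAC T F f) {c C : ℝ} {φ : ℝ → ℝ} (hφ : ContinuousOn φ (Icc c C))
    (hF : ∀ n z, F n z ∈ Icc c C) : BAC T (fun n z => φ (F n z)) fun z => φ (f z) := by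
  constructor
  · obtain ⟨B, hB⟩ := (isCompact_Icc.image_of_continuousOn hφ).isBounded.exists_norm_le
    exact ⟨B, fun _ _ _ _ => Eventually.of_forall fun n z _ => hB _ ⟨_, hF n z, rfl⟩⟩
  · filter_upwards [h.lim] with z h1 hz
    have hmem : f z ∈ Icc c C :=
      isClosed_Icc.mem_of_tendsto (h1 hz) (Eventually.of_forall fun n => hF n z)
    exact (hφ _ hmem).tendsto.comp
      (tendsto_nhdsWithin_iff.2 ⟨h1 hz, Eventually.of_forall fun n => hF n z⟩)

lemma bac_mollify {F : Pt d → ℝ} (hF : EssBdd F) : BAC T (fun n => mollify n F) F := by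
  obtain ⟨C, hC⟩ := hF.bdd
  exact ⟨⟨C, fun _ _ _ _ => Eventually.of_forall fun n z _ => abs_mollify_le n hF hC z⟩,
    (ae_tendsto_mollify hF).mono fun z hz _ => hz⟩

lemma evEq_pd_mollify {v : Pt d} {f g : Pt d → ℝ} (hf : EssBdd f) (h : WeakDeriv T v f g) :
    EvEq T (fun n => pd v (mollify n f)) (fun n => mollify n g) := by
  intro a b ha hb
  have h0 : Tendsto (fun n : ℕ => 1 / ((n : ℝ) + 1)) atTop (𝓝 0) :=
    tendsto_one_div_add_atTop_nhds_zero_nat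
  filter_upwards [h0.eventually_lt_const ha, h0.eventually_lt_const (sub_pos.2 hb)] with n h1 h2 z hz
  exact pd_mollify n hf h (h1.trans_le hz.1) (by linarith [hz.2])

lemma BAC.aestronglyMeasurable (h : BAC T F f) (hF : ∀ n, Continuous (F n)) :
    AEStronglyMeasurable f (volume.restrict (Ioo 0 T ×ˢ univ)) := by
  refine aestronglyMeasurable_of_tendsto_ae atTop (fun n => (hF n).aestronglyMeasurable)
    ((ae_restrict_iff' (measurableSet_strip T)).2 ?_)
  filter_upwards [h.lim] with z hz hzt using hz hzt.1

/-- The constant in `BAC` does not depend on the compact subinterval; only the index from which it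
is valid does. Hence the limit is bounded on the whole strip. -/
lemma BAC.bdd_lim (h : BAC T F f) : ∃ C, ∀ᵐ z : Pt d, z.1 ∈ Ioo 0 T → |f z| ≤ C := by
  obtain ⟨C, hC⟩ := h.bdd
  refine ⟨C, ?_⟩
  filter_upwards [h.lim] with z hz hzt
  exact le_of_tendsto (hz hzt).abs
    ((hC z.1 z.1 hzt.1 hzt.2).mono fun n hn => hn z ⟨le_rfl, le_rfl⟩)

/-- Passage to the limit in integrals against an integrable weight with time support in `(0,T)`. -/
lemma BAC.tendsto_integral (h : BAC T F f) (hF : ∀ n, Continuous (F n)) {a b : ℝ} (ha : 0 < a)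
    (hb : b < T) {W : Pt d → ℝ} {s : Set (Pt d)}
    (hW : IntegrableOn W s) (hWs : ∀ z, z.1 ∉ Icc a b → W z = 0) :
    Tendsto (fun n => ∫ z in s, W z * F n z) atTop (𝓝 (∫ z in s, W z * f z)) := by
  obtain ⟨C, hC⟩ := h.bdd
  replace hC := hC a b ha hb
  refine tendsto_integral_filter_of_dominated_convergence (fun z => |W z| * C)
    (Eventually.of_forall fun n => hW.1.mul (hF n).aestronglyMeasurable) ?_
    (hW.abs.mul_const C) ?_
  · filter_upwards [hC] with n hn
    refine ae_of_all _ fun z => ?_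
    rw [Real.norm_eq_abs, abs_mul]
    by_cases hz : z.1 ∈ Icc a b
    · exact mul_le_mul_of_nonneg_left (hn z hz) (abs_nonneg _)
    · rw [hWs z hz]; simp
  · refine ae_restrict_of_ae ?_
    filter_upwards [h.lim] with z hz
    by_cases hzt : z.1 ∈ Icc a b
    · exact (hz ⟨ha.trans_le hzt.1, hzt.2.trans_lt hb⟩).const_mul _
    · simp [hWs z hzt]

lemma integral_mul_pd_eq {φ ψ : Pt d → ℝ} (hφ : ContDiff ℝ 1 φ) (hψ : ContDiff ℝ 1 ψ)
    (hc : HasCompactSupport ψ) (v : Pt d) : ∫ z, φ z * pd v ψ z = -∫ z, pd v φ z * ψ z := by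
  have hφ' : Continuous fun z => fderiv ℝ φ z v :=
    (hφ.continuous_fderiv (by simp)).clm_apply continuous_const
  have hψ' : Continuous fun z => fderiv ℝ ψ z v :=
    (hψ.continuous_fderiv (by simp)).clm_apply continuous_const
  exact integral_mul_fderiv_eq_neg_fderiv_mul_of_integrable
    ((hφ'.mul hψ.continuous).integrable_of_hasCompactSupport hc.mul_left)
    ((hφ.continuous.mul hψ').integrable_of_hasCompactSupport (hc.fderiv_apply ℝ v).mul_left)
    ((hφ.continuous.mul hψ.continuous).integrable_of_hasCompactSupport hc.mul_left)
    (fun z _ => hφ.differentiable (by simp) z) (fun z _ => hψ.differentiable (by simp) z)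

/-- The limit of derivatives is the weak derivative of the limit. -/
lemma BAC.pd_unique {v : Pt d} {g G : Pt d → ℝ} (hs : ∀ n, ContDiff ℝ 1 (F n)) (h : BAC T F f)
    (hd : BAC T (fun n => QHD.pd v (F n)) G) (hw : WeakDeriv T v f g) (hg : LocallyIntegrable g) :
    ∀ᵐ z : Pt d, z.1 ∈ Ioo 0 T → G z = g z := by
  have hopen : IsOpen (Ioo 0 T ×ˢ (univ : Set (Sp d))) := isOpen_Ioo.prod isOpen_univ
  have hcont : ∀ n, Continuous (QHD.pd v (F n)) := fun n =>
    ((hs n).continuous_fderiv (by simp)).clm_apply continuous_const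
  have hGloc : LocallyIntegrableOn G (Ioo 0 T ×ˢ univ) := by
    rw [locallyIntegrableOn_iff (hopen.isLocallyClosed)]
    intro K hKs hK
    obtain ⟨C, hC⟩ := hd.bdd_lim
    have hm : AEStronglyMeasurable G (volume.restrict K) :=
      (hd.aestronglyMeasurable hcont).mono_measure (Measure.restrict_mono hKs le_rfl)
    have hfin : IsFiniteMeasure (volume.restrict K) := ⟨by
      rw [Measure.restrict_apply_univ]; exact hK.measure_lt_top⟩
    refine Integrable.of_bound hm C ?_
    rw [ae_restrict_iff' hK.measurableSet]
    filter_upwards [hC] with z hz hzK using hz (hKs hzK).1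
  -- Fundamental lemma of the calculus of variations, applied to G - g. The required identity is
  -- classical integration by parts for `F n`, passed to the limit on both sides.
  have key := hopen.ae_eq_zero_of_integral_contDiff_smul_eq_zero (μ := volume)
    (hGloc.sub (hg.locallyIntegrableOn _)) (fun φ hφ hc hsup => ?_)
  · filter_upwards [key] with z hz hzt using sub_eq_zero.1 (hz ⟨hzt, trivial⟩)
  · obtain ⟨a, b, hab, h0⟩ := exists_time_support hc hsup
    have hφ0 : ∀ z : Pt d, z.1 ∉ Icc a b → φ z = 0 := fun z hz =>
      image_eq_zero_of_notMem_tsupport (h0 z hz)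
    have hdφ0 : ∀ z : Pt d, z.1 ∉ Icc a b → QHD.pd v φ z = 0 := fun z hz =>
      image_eq_zero_of_notMem_tsupport
        fun hm => h0 z hz (tsupport_fderiv_apply_subset ℝ v hm)
    have hdc : Continuous (QHD.pd v φ) := (hφ.continuous_fderiv (by simp)).clm_apply continuous_const
    rcases (Icc a b).eq_empty_or_nonempty with he | ⟨t0, ht0⟩
    · have : ∀ z, φ z = 0 := fun z => hφ0 z (by rw [he]; simp)
      simp [this]
    have ha : 0 < a := (hab (left_mem_Icc.2 (ht0.1.trans ht0.2))).1
    have hb : b < T := (hab (right_mem_Icc.2 (ht0.1.trans ht0.2))).2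
    have l1 := h.tendsto_integral (s := univ) (fun n => (hs n).continuous) ha hb
      (hdc.integrable_of_hasCompactSupport (hc.fderiv_apply ℝ v)).integrableOn hdφ0
    have l2 := hd.tendsto_integral (s := univ) hcont ha hb
      (hφ.continuous.integrable_of_hasCompactSupport hc).integrableOn hφ0
    simp only [Measure.restrict_univ] at l1 l2
    have e : ∀ n, ∫ z, QHD.pd v φ z * F n z = -∫ z, φ z * QHD.pd v (F n) z := by
      intro n
      have := integral_mul_pd_eq (hs n) (hφ.of_le (by simp)) hc v
      simp only [mul_comm] at this ⊢
      exact this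
    simp only [e] at l1
    have h3 := tendsto_nhds_unique l1 l2.neg
    have h4 := hw φ hφ hc hsup
    have i1 : Integrable fun z => φ z * g z := hg.integrable_smul_left_of_hasCompactSupport hφ.continuous hc
    have i2 : Integrable fun z => φ z * G z := by
      have hsub : tsupport φ ⊆ Ioo 0 T ×ˢ univ := hsup
      have h5 := (hGloc.integrableOn_compact_subset hsub hc.isCompact).continuousOn_mul
        hφ.continuous.continuousOn hc.isCompact
      rw [integrableOn_iff_integrable_of_support_subset] at h5
      · exact h5
      · intro z hz
        exact subset_tsupport φ (left_ne_zero_of_mul hz)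
    have h5 : ∫ z, φ z * G z = ∫ z, φ z * g z := by
      simp only [mul_comm (QHD.pd v φ _)] at h3
      rw [h4, neg_inj] at h3
      rw [← h3]
      simp only [mul_comm]
    simp only [Pi.sub_apply, smul_eq_mul, mul_sub]
    rw [integral_sub i2 i1, h5, sub_self]

lemma BAC.essBdd_extendBy {g : ℝ → Sp d → ℝ} (h : BAC T F fun z => g z.1 z.2)
    (hF : ∀ n, Continuous (F n)) (hg : ∀ t, Periodic (g t)) (c : ℝ) :
    EssBdd (extendBy T c g) := by
  have hsub : Ioo 0 T ×ˢ cell d ⊆ Ioo 0 T ×ˢ (univ : Set (Sp d)) :=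
    prod_mono subset_rfl (subset_univ _)
  refine QHD.essBdd_extendBy hg
    ((h.aestronglyMeasurable hF).mono_measure (Measure.restrict_mono hsub le_rfl)) ?_
  obtain ⟨C, hC⟩ := h.bdd_lim
  refine ⟨C, ?_⟩
  rw [ae_restrict_iff' (measurableSet_Ioo.prod measurableSet_cell)]
  filter_upwards [hC] with z hz hzt using hz hzt.1

lemma BAC.of_extendBy {c : ℝ} {g : ℝ → Sp d → ℝ} (h : BAC T F (extendBy T c g)) :
    BAC T F fun z => g z.1 z.2 :=
  h.congr_lim (ae_of_all _ fun _ hz => extendBy_of_mem hz)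

lemma EvEq.pd_mollify {v : Pt d} {g : Pt d → ℝ} (h : EvEq T F fun n => mollify n f)
    (hf : EssBdd f) (hw : WeakDeriv T v f g) : EvEq T (fun n => QHD.pd v (F n)) fun n => mollify n g :=
  (h.pd v).trans (evEq_pd_mollify hf hw)

lemma BAC.of_evEq_mollify {c : ℝ} {g : ℝ → Sp d → ℝ}
    (h : EvEq T F fun n => mollify n (extendBy T c g)) (hg : EssBdd (extendBy T c g)) :
    BAC T F fun z => g z.1 z.2 :=
  ((bac_mollify hg).congr h.symm).of_extendBy

lemma WeakDeriv.congr {v : Pt d} {g : Pt d → ℝ} (h : WeakDeriv T v f g)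
    (he : ∀ z : Pt d, z.1 ∈ Ioo 0 T → f z = f' z) : WeakDeriv T v f' g := by
  intro φ hφ hc hs
  rw [← h φ hφ hc hs]
  congr 1
  ext z
  by_cases hz : z.1 ∈ Ioo 0 T
  · rw [he z hz]
  · have : QHD.pd v φ z = 0 := image_eq_zero_of_notMem_tsupport
      fun hm => hz (hs (tsupport_fderiv_apply_subset ℝ v hm)).1
    rw [this, mul_zero, mul_zero]

lemma weakDeriv_zero {v : Pt d} : WeakDeriv T v (fun _ => 0) fun _ => 0 := by
  intro φ _ _ _
  simp

end Convergence

/-! ### Directional derivatives of smooth functions. -/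

section Calculus

lemma two_le_infty : (2 : WithTop ℕ∞) ≤ ∞ := by
  have : ((2 : ℕ∞) : WithTop ℕ∞) ≤ ((⊤ : ℕ∞) : WithTop ℕ∞) := WithTop.coe_le_coe.2 le_top
  exact this

variable {d : ℕ} {F G : Pt d → ℝ} {v : Pt d}

lemma ContDiff.pd_right {m n : WithTop ℕ∞} (hF : ContDiff ℝ n F) (hmn : m + 1 ≤ n) (v : Pt d) :
    ContDiff ℝ m (pd v F) :=
  (hF.fderiv_right hmn).clm_apply contDiff_const

lemma contDiff_pd (hF : ContDiff ℝ ∞ F) (v : Pt d) : ContDiff ℝ ∞ (pd v F) :=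
  ContDiff.pd_right hF (by simp) v

lemma continuous_pd {n : WithTop ℕ∞} (hF : ContDiff ℝ n F) (hn : n ≠ 0) (v : Pt d) :
    Continuous (pd v F) :=
  (hF.continuous_fderiv hn).clm_apply continuous_const

lemma pd_add {z : Pt d} (hF : DifferentiableAt ℝ F z) (hG : DifferentiableAt ℝ G z) :
    pd v (fun z => F z + G z) z = pd v F z + pd v G z := by
  simp only [pd]; rw [fderiv_fun_add hF hG]; rfl

lemma pd_sub {z : Pt d} (hF : DifferentiableAt ℝ F z) (hG : DifferentiableAt ℝ G z) :
    pd v (fun z => F z - G z) z = pd v F z - pd v G z := by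
  simp only [pd]; rw [fderiv_fun_sub hF hG]; rfl

lemma pd_mul {z : Pt d} (hF : DifferentiableAt ℝ F z) (hG : DifferentiableAt ℝ G z) :
    pd v (fun z => F z * G z) z = F z * pd v G z + pd v F z * G z := by
  simp only [pd]; rw [fderiv_fun_mul hF hG]; simp [mul_comm]

lemma pd_sum {ι : Type*} (s : Finset ι) {F : ι → Pt d → ℝ} {z : Pt d}
    (hF : ∀ i ∈ s, DifferentiableAt ℝ (F i) z) :
    pd v (fun z => ∑ i ∈ s, F i z) z = ∑ i ∈ s, pd v (F i) z := by
  simp only [pd]; rw [fderiv_fun_sum hF]; simp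

lemma pd_comp {z : Pt d} {φ : ℝ → ℝ} {φ' : ℝ} (hφ : HasDerivAt φ φ' (F z))
    (hF : DifferentiableAt ℝ F z) : pd v (fun z => φ (F z)) z = φ' * pd v F z := by
  have := (hφ.comp_hasFDerivAt z hF.hasFDerivAt).fderiv
  have e : φ ∘ F = fun z => φ (F z) := rfl
  rw [e] at this
  simp only [pd, this]
  simp

lemma pd_comm (hF : ContDiff ℝ 2 F) (v v' z : Pt d) : pd v (pd v' F) z = pd v' (pd v F) z := by
  have hd : DifferentiableAt ℝ (fderiv ℝ F) z :=
    (hF.fderiv_right (m := 1) (by norm_num)).differentiable (by norm_num) z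
  have e : ∀ v v', pd v (pd v' F) z = fderiv ℝ (fderiv ℝ F) z v v' := by
    intro v v'
    have := (hd.hasFDerivAt.clm_apply (hasFDerivAt_const v' z)).fderiv
    have h2 : pd v (pd v' F) z = fderiv ℝ (fun y => fderiv ℝ F y v') z v := rfl
    rw [h2, this]
    simp
  rw [e, e]
  exact (hF.contDiffAt.isSymmSndFDerivAt (by simp)) v v'

lemma spacePeriodic_pd (hF : SpacePeriodic F) (v : Pt d) : SpacePeriodic (pd v F) := by
  intro t i x
  have e : F = fun z => F (z + (0, EuclideanSpace.single i 1)) := by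
    ext z
    have := hF z.1 i z.2
    simp only at this
    rw [← this]
    congr 1
    ext <;> simp
  have e2 : ((t, x + EuclideanSpace.single i 1) : Pt d) = (t, x) + (0, EuclideanSpace.single i 1) := by
    ext <;> simp
  simp only [pd]
  conv_rhs => rw [e]
  rw [fderiv_comp_add_right, e2]

end Calculus

/-! ### The strong equations in the variables log r and u. -/

section LogJets

variable {d : ℕ}

/-- The drift `∇ log r`. -/
noncomputable def drift (r : Pt d → ℝ) (i : Fin d) : Pt d → ℝ := pd (eX i) fun z => Real.log (r z)

/-- The divergence of a vector field on space-time. -/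
noncomputable def spaceDiv (U : Fin d → Pt d → ℝ) (z : Pt d) : ℝ := ∑ i, pd (eX i) (U i) z

/-- The variational derivative `h'(r) - |∇ log r|²/2 - Δ log r`. -/
noncomputable def smoothPotential (h : ℝ → ℝ) (r : Pt d → ℝ) (z : Pt d) : ℝ :=
  deriv h (r z) - 1 / 2 * ∑ i, drift r i z ^ 2 - spaceDiv (drift r) z

/-- The residual `∂ₜ log r + u · ∇ log r + div u` of the mass equation. -/
noncomputable def massResidual (r : Pt d → ℝ) (u : Fin d → Pt d → ℝ) (z : Pt d) : ℝ :=
  pd eT (fun z => Real.log (r z)) z + ∑ i, u i z * drift r i z + spaceDiv u z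

/-- The residual `∂ₜu + (u · ∇)u + ∇(F_ρ - div F_q)` of the momentum equation. -/
noncomputable def momentumResidual (h : ℝ → ℝ) (r : Pt d → ℝ) (u : Fin d → Pt d → ℝ) (j : Fin d)
    (z : Pt d) : ℝ :=
  pd eT (u j) z + ∑ i, u i z * pd (eX i) (u j) z + pd (eX j) (smoothPotential h r) z

variable {r : Pt d → ℝ} {u : Fin d → Pt d → ℝ}

lemma contDiff_log (hr : ContDiff ℝ ∞ r) (hpos : ∀ z, 0 < r z) :
    ContDiff ℝ ∞ fun z => Real.log (r z) := hr.log fun z => (hpos z).ne'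

lemma contDiff_drift (hr : ContDiff ℝ ∞ r) (hpos : ∀ z, 0 < r z) (i : Fin d) :
    ContDiff ℝ ∞ (drift r i) := contDiff_pd (contDiff_log hr hpos) _

lemma contDiff_spaceDiv (hu : ∀ i, ContDiff ℝ ∞ (u i)) : ContDiff ℝ ∞ (spaceDiv u) :=
  ContDiff.sum fun i _ => contDiff_pd (hu i) _

lemma pd_log (hr : ContDiff ℝ ∞ r) (hpos : ∀ z, 0 < r z) (v : Pt d) :
    pd v (fun z => Real.log (r z)) = fun z => (r z)⁻¹ * pd v r z := by
  ext z
  exact pd_comp (Real.hasDerivAt_log (hpos z).ne') (hr.differentiable (by simp) z)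

lemma drift_eq (hr : ContDiff ℝ ∞ r) (hpos : ∀ z, 0 < r z) (i : Fin d) (z : Pt d) :
    drift r i z = (r z)⁻¹ * pd (eX i) r z := by rw [drift, pd_log hr hpos]

lemma pd_inv (hr : ContDiff ℝ ∞ r) (hpos : ∀ z, 0 < r z) (v z : Pt d) :
    pd v (fun z => (r z)⁻¹) z = -(r z)⁻¹ ^ 2 * pd v r z := by
  have := pd_comp (v := v) (hasDerivAt_inv (hpos z).ne') (hr.differentiable (by simp) z)
  rw [this, inv_pow]

/-- The right-hand side is polynomial in 1/r and derivatives of r, so bounded almost everywhere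
convergence of these yields that of the derivatives of log r. The same holds one order higher in
`pd_pd_pd_log`. -/
lemma pd_pd_log (hr : ContDiff ℝ ∞ r) (hpos : ∀ z, 0 < r z) (v v' : Pt d) :
    pd v (pd v' fun z => Real.log (r z))
      = fun z => (r z)⁻¹ * pd v (pd v' r) z - (r z)⁻¹ ^ 2 * pd v r z * pd v' r z := by
  ext z
  rw [pd_log hr hpos, pd_mul ((hr.fun_inv fun z => (hpos z).ne').differentiable (by simp) z)
    ((contDiff_pd hr v').differentiable (by simp) z), pd_inv hr hpos]
  ring

lemma pd_pd_pd_log (hr : ContDiff ℝ ∞ r) (hpos : ∀ z, 0 < r z) (v v' v'' z : Pt d) :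
    pd v (pd v' (pd v'' fun z => Real.log (r z))) z
      = (r z)⁻¹ * pd v (pd v' (pd v'' r)) z - (r z)⁻¹ ^ 2 * pd v r z * pd v' (pd v'' r) z
        - (r z)⁻¹ ^ 2 * (pd v (pd v' r) z * pd v'' r z + pd v' r z * pd v (pd v'' r) z)
        + 2 * (r z)⁻¹ ^ 3 * pd v r z * pd v' r z * pd v'' r z := by
  have hi : DifferentiableAt ℝ (fun z => (r z)⁻¹) z :=
    ((hr.inv fun z => (hpos z).ne').differentiable (by simp) z :)
  have h1 : DifferentiableAt ℝ (pd v' r) z := (contDiff_pd hr _).differentiable (by simp) z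
  have h2 : DifferentiableAt ℝ (pd v'' r) z := (contDiff_pd hr _).differentiable (by simp) z
  have h3 : DifferentiableAt ℝ (pd v' (pd v'' r)) z :=
    (contDiff_pd (contDiff_pd hr _) _).differentiable (by simp) z
  have e : (fun z => (r z)⁻¹ * pd v' (pd v'' r) z - (r z)⁻¹ ^ 2 * pd v' r z * pd v'' r z)
      = fun z => (r z)⁻¹ * pd v' (pd v'' r) z - (r z)⁻¹ * ((r z)⁻¹ * (pd v' r z * pd v'' r z)) := by
    ext z; ring
  rw [pd_pd_log hr hpos, e, pd_sub (hi.fun_mul h3) (hi.fun_mul (hi.fun_mul (h1.fun_mul h2))), pd_mul hi h3,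
    pd_mul hi (hi.fun_mul (h1.fun_mul h2)), pd_mul hi (h1.fun_mul h2), pd_mul h1 h2, pd_inv hr hpos]
  ring

lemma contDiff_deriv_comp {h : ℝ → ℝ} {γ k A : ℝ} (H : InternalEnergy h γ k A)
    (hr : ContDiff ℝ ∞ r) (hpos : ∀ z, 0 < r z) : ContDiff ℝ 2 fun z => deriv h (r z) := by
  rw [contDiff_iff_contDiffAt]
  intro z
  exact (H.contDiffOn_deriv.contDiffAt (Ioi_mem_nhds (hpos z))).comp z
    (hr.of_le two_le_infty).contDiffAt

lemma contDiff_pressure_comp {h : ℝ → ℝ} {γ k A : ℝ} (H : InternalEnergy h γ k A)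
    (hr : ContDiff ℝ ∞ r) (hpos : ∀ z, 0 < r z) : ContDiff ℝ 2 fun z => pressure h (r z) := by
  rw [contDiff_iff_contDiffAt]
  intro z
  exact (H.contDiffOn_pressure.contDiffAt (Ioi_mem_nhds (hpos z))).comp z
    (hr.of_le two_le_infty).contDiffAt

lemma contDiff_smoothPotential {h : ℝ → ℝ} {γ k A : ℝ} (H : InternalEnergy h γ k A)
    (hr : ContDiff ℝ ∞ r) (hpos : ∀ z, 0 < r z) : ContDiff ℝ 2 (smoothPotential h r) := by
  have h1 := contDiff_deriv_comp H hr hpos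
  have h2 : ∀ i, ContDiff ℝ 2 (drift r i) := fun i =>
    (contDiff_drift hr hpos i).of_le two_le_infty
  have h3 : ContDiff ℝ 2 (spaceDiv (drift r)) :=
    (contDiff_spaceDiv (contDiff_drift hr hpos)).of_le two_le_infty
  exact (h1.sub (contDiff_const.mul (ContDiff.sum fun i _ => (h2 i).pow 2))).sub h3

lemma contDiff_massResidual (hr : ContDiff ℝ ∞ r) (hpos : ∀ z, 0 < r z)
    (hu : ∀ i, ContDiff ℝ ∞ (u i)) : ContDiff ℝ ∞ (massResidual r u) :=
  ((contDiff_pd (contDiff_log hr hpos) _).add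
    (ContDiff.sum fun i _ => (hu i).mul (contDiff_drift hr hpos i))).add (contDiff_spaceDiv hu)

lemma pd_smoothPotential {h : ℝ → ℝ} {γ k A : ℝ} (H : InternalEnergy h γ k A)
    (hr : ContDiff ℝ ∞ r) (hpos : ∀ z, 0 < r z) (v z : Pt d) :
    pd v (smoothPotential h r) z = deriv (deriv h) (r z) * pd v r z
      - ∑ i, drift r i z * pd v (drift r i) z - ∑ i, pd v (pd (eX i) (drift r i)) z := by
  have hw := fun i => (contDiff_drift hr hpos i).differentiable (by simp) z
  have hdw := fun i : Fin d =>
    (contDiff_pd (contDiff_drift hr hpos i) (eX i)).differentiable (by simp) z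
  have h1 := (contDiff_deriv_comp H hr hpos).differentiable (by norm_num) z
  have e : smoothPotential h r = fun z => deriv h (r z)
      - (∑ i, 1 / 2 * (drift r i z * drift r i z)) - ∑ i, pd (eX i) (drift r i) z := by
    ext z
    simp only [smoothPotential, spaceDiv, Finset.mul_sum]
    simp only [pow_two]
  have h2 : ∀ i ∈ Finset.univ, DifferentiableAt ℝ
      (fun z => 1 / 2 * (drift r i z * drift r i z)) z :=
    fun i _ => ((hw i).fun_mul (hw i)).const_mul _
  rw [e, pd_sub (h1.fun_sub (DifferentiableAt.fun_sum h2)) (DifferentiableAt.fun_sum fun i _ => hdw i),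
    pd_sub h1 (DifferentiableAt.fun_sum h2),
    pd_comp (H.hasDerivAt_deriv (hpos z)) (hr.differentiable (by simp) z),
    pd_sum _ h2, pd_sum _ fun i _ => hdw i]
  congr 2
  refine Finset.sum_congr rfl fun i _ => ?_
  rw [pd_mul (differentiableAt_const _) ((hw i).fun_mul (hw i)), pd_mul (hw i) (hw i)]
  have : pd v (fun _ : Pt d => (1 / 2 : ℝ)) z = 0 := by simp [pd]
  rw [this]
  ring

lemma pd_massResidual (hr : ContDiff ℝ ∞ r) (hpos : ∀ z, 0 < r z)
    (hu : ∀ i, ContDiff ℝ ∞ (u i)) (v z : Pt d) :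
    pd v (massResidual r u) z = pd v (pd eT fun z => Real.log (r z)) z
      + ∑ i, (u i z * pd v (drift r i) z + pd v (u i) z * drift r i z)
      + ∑ i, pd v (pd (eX i) (u i)) z := by
  have hw := fun i => (contDiff_drift hr hpos i).differentiable (by simp) z
  have hu' := fun i => (hu i).differentiable (by simp) z
  have hdu := fun i : Fin d => (contDiff_pd (hu i) (eX i)).differentiable (by simp) z
  have h1 := (contDiff_pd (contDiff_log hr hpos) eT).differentiable (by simp) z
  have h2 : ∀ i ∈ Finset.univ, DifferentiableAt ℝ (fun z => u i z * drift r i z) z :=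
    fun i _ => (hu' i).fun_mul (hw i)
  have e : massResidual r u = fun z => pd eT (fun z => Real.log (r z)) z
      + (∑ i, u i z * drift r i z) + ∑ i, pd (eX i) (u i) z := rfl
  rw [e, pd_add (h1.fun_add (DifferentiableAt.fun_sum h2)) (DifferentiableAt.fun_sum fun i _ => hdu i),
    pd_add h1 (DifferentiableAt.fun_sum h2), pd_sum _ h2, pd_sum _ fun i _ => hdu i]
  congr 2
  exact Finset.sum_congr rfl fun i _ => pd_mul (hu' i) (hw i)

end LogJets

/-! ### Smooth approximation of the strong solution. -/

section Approximation

variable {d : ℕ} {T : ℝ}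

lemma exists_bound_of_continuousOn {f : ℝ → Sp d → ℝ} (hp : ∀ t, Periodic (f t))
    (hc : ContinuousOn (fun z : Pt d => f z.1 z.2) (Icc 0 T ×ˢ univ)) :
    ∃ C, ∀ t ∈ Icc 0 T, ∀ x, |f t x| ≤ C := by
  obtain ⟨C, hC⟩ := ((isCompact_Icc.prod isCompact_box).image_of_continuousOn
    (hc.mono (prod_mono subset_rfl (subset_univ (box d))))).isBounded.exists_norm_le
  refine ⟨C, fun t ht x => ?_⟩
  have h1 := (hp t).add_latticeVec (fun i => ⌊x i⌋) (x - latticeVec fun i => ⌊x i⌋)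
  rw [sub_add_cancel] at h1
  rw [h1]
  exact hC _ ⟨(t, _), ⟨ht, cell_subset_box ((sub_latticeVec_mem_cell x _).2 rfl)⟩, rfl⟩

/-- The reciprocal is continuous and periodic, hence bounded. -/
lemma exists_pos_lower_bound {f : ℝ → Sp d → ℝ} (hp : ∀ t, Periodic (f t))
    (hc : ContinuousOn (fun z : Pt d => f z.1 z.2) (Icc 0 T ×ˢ univ))
    (hpos : ∀ t ∈ Icc 0 T, ∀ x, 0 < f t x) :
    ∃ c, 0 < c ∧ ∀ t ∈ Icc 0 T, ∀ x, c ≤ f t x := by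
  have hci : ContinuousOn (fun z : Pt d => (f z.1 z.2)⁻¹) (Icc 0 T ×ˢ univ) :=
    hc.inv₀ fun z hz => (hpos z.1 hz.1 z.2).ne'
  obtain ⟨C, hC⟩ := exists_bound_of_continuousOn (f := fun t x => (f t x)⁻¹)
    (fun t i x => by simp only [hp t i x]) hci
  refine ⟨(|C| + 1)⁻¹, by positivity, fun t ht x => ?_⟩
  have h1 := hpos t ht x
  rw [inv_le_comm₀ (by positivity) h1]
  have := hC t ht x
  rw [abs_of_pos (inv_pos.2 h1)] at this
  linarith [le_abs_self C]

lemma essBdd_of_continuousOn {f : ℝ → Sp d → ℝ} (hp : ∀ t, Periodic (f t))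
    (hc : ContinuousOn (fun z : Pt d => f z.1 z.2) (Icc 0 T ×ˢ univ)) (c : ℝ) :
    EssBdd (extendBy T c f) := by
  have hm : MeasurableSet (Ioo 0 T ×ˢ cell d) := measurableSet_Ioo.prod measurableSet_cell
  refine essBdd_extendBy hp ((hc.mono (prod_mono Ioo_subset_Icc_self
    (subset_univ _))).aestronglyMeasurable hm) ?_
  obtain ⟨C, hC⟩ := exists_bound_of_continuousOn hp hc
  refine ⟨C, ?_⟩
  filter_upwards [ae_restrict_mem hm] with z hz using hC z.1 (Ioo_subset_Icc_self hz.1) z.2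

/-- Smooth global approximations of a strong solution `(ρ, u)` without vacuum, for which the
residuals of the equations tend to zero. -/
structure IsApproximation (h : ℝ → ℝ) (T M : ℝ) (ρ : ℝ → Sp d → ℝ) (u ρx : ℝ → Sp d → Sp d)
    (R : ℕ → Pt d → ℝ) (U : ℕ → Fin d → Pt d → ℝ) : Prop where
  contDiff_R : ∀ n, ContDiff ℝ ∞ (R n)
  contDiff_U : ∀ n i, ContDiff ℝ ∞ (U n i)
  periodic_R : ∀ n, SpacePeriodic (R n)
  periodic_U : ∀ n i, SpacePeriodic (U n i)
  range_R : ∃ c C, 0 < c ∧ ∀ n z, R n z ∈ Icc c C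
  lim_R : BAC T R fun z => ρ z.1 z.2
  lim_U : ∀ i, BAC T (fun n => U n i) fun z => u z.1 z.2 i
  lim_drift : ∀ i, BAC T (fun n => drift (R n) i) fun z => (ρ z.1 z.2)⁻¹ * ρx z.1 z.2 i
  grad_U : ∀ a b, 0 < a → b < T → ∀ᶠ n in atTop, ∀ z : Pt d, z.1 ∈ Icc a b →
    ∀ i j, |pd (eX j) (U n i) z| ≤ |M|
  lim_massResidual : BAC T (fun n => QHD.massResidual (R n) (U n)) fun _ => 0
  lim_grad_massResidual : ∀ j, BAC T (fun n => pd (eX j) (QHD.massResidual (R n) (U n))) fun _ => 0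
  lim_momentumResidual : ∀ j, BAC T (fun n => QHD.momentumResidual h (R n) (U n) j) fun _ => 0

/-- Inside (0,T) the derivatives of the mollified solution are eventually mollifications of its weak
derivatives, so they converge boundedly and almost everywhere. The residuals are continuous
functions of these jets, so their limits are the residuals of the strong solution, which vanish. -/
lemma IsStrongSolution.exists_approximation {h : ℝ → ℝ} {γ k A M : ℝ} (H : InternalEnergy h γ k A)
    {ρ : ℝ → Sp d → ℝ} {u : ℝ → Sp d → Sp d} {D : StrongDerivs d}
    (S : IsStrongSolution h T ρ u D) (V : VelocityBound T M u D) :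
    ∃ R U, IsApproximation h T M ρ u D.ρx R U := by
  have p_ρx : ∀ i t, Periodic fun x => D.ρx t x i := fun i t j x => by
    simp only [S.periodic_ρx t j x]
  have p_u : ∀ i t, Periodic fun x => u t x i := fun i t j x => by
    simp only [S.periodic_u t j x]
  have c_ρx : ∀ i, ContinuousOn (fun z : Pt d => D.ρx z.1 z.2 i) (Icc 0 T ×ˢ univ) := fun i =>
    (EuclideanSpace.proj (𝕜 := ℝ) i).continuous.comp_continuousOn S.cont_ρx
  have c_u : ∀ i, ContinuousOn (fun z : Pt d => u z.1 z.2 i) (Icc 0 T ×ˢ univ) := fun i =>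
    (EuclideanSpace.proj (𝕜 := ℝ) i).continuous.comp_continuousOn S.cont_u
  -- The density is extended by 1, not by 0, to keep its mollification bounded below by a positive
  -- constant at all times.
  have b_ρ : EssBdd (extendBy T 1 ρ) := essBdd_of_continuousOn S.periodic_ρ S.cont_ρ 1
  have b_ρx := fun i => essBdd_of_continuousOn (p_ρx i) (c_ρx i) 0
  have b_u := fun i => essBdd_of_continuousOn (p_u i) (c_u i) 0
  set R : ℕ → Pt d → ℝ := fun n => mollify n (extendBy T 1 ρ) with hR
  set U : ℕ → Fin d → Pt d → ℝ := fun n i => mollify n (extendBy T 0 fun t x => u t x i) with hU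
  have sR : ∀ n, ContDiff ℝ ∞ (R n) := fun n => contDiff_mollify n b_ρ
  have sU : ∀ n i, ContDiff ℝ ∞ (U n i) := fun n i => contDiff_mollify n (b_u i)
  -- the range of the approximate densities
  obtain ⟨c, C, hc, hrange⟩ : ∃ c C, 0 < c ∧ ∀ n z, R n z ∈ Icc c C := by
    obtain ⟨c, hc, hcb⟩ := exists_pos_lower_bound S.periodic_ρ S.cont_ρ S.pos
    obtain ⟨C, hC⟩ := b_ρ.bdd
    refine ⟨min c 1, C, by positivity, fun n z => ⟨le_mollify n b_ρ (ae_of_all _ fun z => ?_) z,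
      (le_abs_self _).trans (abs_mollify_le n b_ρ hC z)⟩⟩
    by_cases hz : z.1 ∈ Ioo 0 T
    · rw [extendBy_of_mem hz]
      exact (min_le_left _ _).trans (hcb _ (Ioo_subset_Icc_self hz) _)
    · rw [extendBy_of_notMem hz]; exact min_le_right _ _
  have hpos : ∀ n z, 0 < R n z := fun n z => hc.trans_le (hrange n z).1
  -- convergence of the derivatives
  have eR : EvEq T R fun n => mollify n (extendBy T 1 ρ) := fun _ _ _ _ =>
    Eventually.of_forall fun _ _ _ => rfl
  have eU : ∀ i, EvEq T (fun n => U n i) fun n => mollify n (extendBy T 0 fun t x => u t x i) :=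
    fun i _ _ _ _ => Eventually.of_forall fun _ _ _ => rfl
  have eRt := eR.pd_mollify b_ρ (S.weak_ρt.weakDeriv S.periodic_ρ S.bdd_ρt.1 b_ρ (S.bdd_ρt.essBdd 0))
  have eRx := fun i => eR.pd_mollify b_ρ
    ((S.weak_ρx i).weakDeriv S.periodic_ρ (p_ρx i) b_ρ (b_ρx i))
  have eRtx := fun i => (eRx i).pd_mollify (b_ρx i) ((S.weak_ρtx i).weakDeriv (p_ρx i)
    (S.bdd_ρtx i).1 (b_ρx i) ((S.bdd_ρtx i).essBdd 0))
  have eRxx := fun i j => (eRx i).pd_mollify (b_ρx i) ((S.weak_ρxx i j).weakDeriv (p_ρx i)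
    (S.bdd_ρxx i j).1 (b_ρx i) ((S.bdd_ρxx i j).essBdd 0))
  have eRxxx := fun i j k => (eRxx i j).pd_mollify ((S.bdd_ρxx i j).essBdd 0)
    ((S.weak_ρxxx i j k).weakDeriv (S.bdd_ρxx i j).1 (S.bdd_ρxxx i j k).1
      ((S.bdd_ρxx i j).essBdd 0) ((S.bdd_ρxxx i j k).essBdd 0))
  have eUt := fun i => (eU i).pd_mollify (b_u i) ((S.weak_ut i).weakDeriv (p_u i) (S.bdd_ut i).1
    (b_u i) ((S.bdd_ut i).essBdd 0))
  have eUx := fun i j => (eU i).pd_mollify (b_u i) ((S.weak_ux i j).weakDeriv (p_u i)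
    (S.bdd_ux i j).1 (b_u i) ((S.bdd_ux i j).essBdd 0))
  -- Only ∂ⱼ∂ᵢuᵢ is needed among the second derivatives: these are the summands of ∇ div u.
  have eUxx := fun i j => (eUx i i).pd_mollify ((S.bdd_ux i i).essBdd 0)
    ((S.weak_uxx i j).weakDeriv (S.bdd_ux i i).1 (S.bdd_uxx i j).1
      ((S.bdd_ux i i).essBdd 0) ((S.bdd_uxx i j).essBdd 0))
  have lR := BAC.of_evEq_mollify eR b_ρ
  have lRt := BAC.of_evEq_mollify eRt (S.bdd_ρt.essBdd 0)
  have lRx := fun i => BAC.of_evEq_mollify (eRx i) (b_ρx i)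
  have lRtx := fun i => BAC.of_evEq_mollify (eRtx i) ((S.bdd_ρtx i).essBdd 0)
  have lRxx := fun i j => BAC.of_evEq_mollify (eRxx i j) ((S.bdd_ρxx i j).essBdd 0)
  have lRxxx := fun i j k => BAC.of_evEq_mollify (eRxxx i j k) ((S.bdd_ρxxx i j k).essBdd 0)
  have lU := fun i => BAC.of_evEq_mollify (eU i) (b_u i)
  have lUt := fun i => BAC.of_evEq_mollify (eUt i) ((S.bdd_ut i).essBdd 0)
  have lUx := fun i j => BAC.of_evEq_mollify (eUx i j) ((S.bdd_ux i j).essBdd 0)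
  have lUxx := fun i j => BAC.of_evEq_mollify (eUxx i j) ((S.bdd_uxx i j).essBdd 0)
  have hsub : Icc c C ⊆ Ioi 0 := fun x hx => hc.trans_le hx.1
  have lInv : BAC T (fun n z => (R n z)⁻¹) fun z => (ρ z.1 z.2)⁻¹ :=
    lR.comp (continuousOn_inv₀.mono fun x hx => (hsub hx).ne') hrange
  have lh1 : BAC T (fun n z => deriv h (R n z)) fun z => deriv h (ρ z.1 z.2) :=
    lR.comp (H.contDiffOn_deriv.continuousOn.mono hsub) hrange
  have lh2 : BAC T (fun n z => deriv (deriv h) (R n z)) fun z => deriv (deriv h) (ρ z.1 z.2) :=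
    lR.comp (H.contDiffOn_deriv2.continuousOn.mono hsub) hrange
  have lW : ∀ i, BAC T (fun n => drift (R n) i) fun z => (ρ z.1 z.2)⁻¹ * D.ρx z.1 z.2 i := by
    intro i
    have := lInv.mul (lRx i)
    simpa only [← drift_eq (sR _) (hpos _)] using this
  -- The limits are assembled in the shape of the formulas for derivatives of log r and then
  -- rewritten backwards into derivatives of the drift.
  have lWt := fun i : Fin d => (lInv.mul (lRtx i)).sub (((lInv.pow 2).mul lRt).mul (lRx i))
  simp only [← congrFun (pd_pd_log (sR _) (hpos _) _ _)] at lWt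
  have lWx := fun i j : Fin d => (lInv.mul (lRxx i j)).sub (((lInv.pow 2).mul (lRx j)).mul (lRx i))
  simp only [← congrFun (pd_pd_log (sR _) (hpos _) _ _)] at lWx
  have lWxx := fun i j k : Fin d => (((lInv.mul (lRxxx i j k)).sub
    (((lInv.pow 2).mul (lRx k)).mul (lRxx i j))).sub ((lInv.pow 2).mul
      (((lRxx j k).mul (lRx i)).add ((lRx j).mul (lRxx i k))))).add
      (((((BAC.const 2).mul (lInv.pow 3)).mul (lRx k)).mul (lRx j)).mul (lRx i))
  simp only [← pd_pd_pd_log (sR _) (hpos _)] at lWxx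
  have lt := lInv.mul lRt
  simp only [← congrFun (pd_log (sR _) (hpos _) _)] at lt
  -- the mass residual
  have lN : BAC T (fun n => massResidual (R n) (U n)) fun _ => 0 := by
    have := (lt.add (BAC.sum Finset.univ fun i _ => (lU i).mul (lW i))).add
      (BAC.sum Finset.univ fun i _ => lUx i i)
    refine BAC.congr_lim (F := fun n => massResidual (R n) (U n)) this ?_
    have hm := ae_of_ae_cell (P := fun z : Pt d => D.ρt z.1 z.2 + ∑ i, (D.ρx z.1 z.2 i * u z.1 z.2 i
      + ρ z.1 z.2 * D.ux i i z.1 z.2) = 0) measurableSet_Ioo (fun t i x => by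
        simp only [S.bdd_ρt.1 t i x, S.periodic_ρx t i x, S.periodic_u t i x, S.periodic_ρ t i x,
          (S.bdd_ux _ _).1 t i x]) S.mass
    filter_upwards [hm] with z hz hzt
    have hρ := S.pos z.1 (Ioo_subset_Icc_self hzt) z.2
    have hz := hz hzt
    rw [Finset.sum_add_distrib, ← Finset.mul_sum] at hz
    have e : ∑ i, u z.1 z.2 i * ((ρ z.1 z.2)⁻¹ * D.ρx z.1 z.2 i)
        = (ρ z.1 z.2)⁻¹ * ∑ i, D.ρx z.1 z.2 i * u z.1 z.2 i := by
      rw [Finset.mul_sum]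
      exact Finset.sum_congr rfl fun i _ => by ring
    rw [e]
    field_simp
    linarith
  have lNx : ∀ j, BAC T (fun n => pd (eX j) (massResidual (R n) (U n))) fun _ => 0 := by
    intro j
    have := ((lWt j).add (BAC.sum Finset.univ fun i _ =>
      ((lU i).mul (lWx i j)).add ((lUx i j).mul (lW i)))).add
      (BAC.sum Finset.univ fun i _ => lUxx i j)
    have e : ∀ n z, pd (eX j) (massResidual (R n) (U n)) z
        = pd eT (pd (eX j) fun z => Real.log (R n z)) z
          + ∑ i, (U n i z * pd (eX j) (drift (R n) i) z + pd (eX j) (U n i) z * drift (R n) i z)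
          + ∑ i, pd (eX j) (pd (eX i) (U n i)) z := by
      intro n z
      rw [pd_massResidual (sR n) (hpos n) (sU n),
        pd_comm ((contDiff_log (sR n) (hpos n)).of_le two_le_infty)]
    have lG := BAC.congr (F' := fun n => pd (eX j) (massResidual (R n) (U n))) this
      fun _ _ _ _ => Eventually.of_forall fun n z _ => (e n z).symm
    -- The mass equation is not differentiated by hand. The residuals tend to 0 and their gradients
    -- have some limit, which must be the weak gradient of 0.
    exact lG.congr_lim (BAC.pd_unique (fun n => (contDiff_massResidual (sR n) (hpos n) (sU n)).of_le
      (by simp)) lN lG weakDeriv_zero (locallyIntegrable_const 0))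
  -- the momentum residual
  have p_chem : ∀ t, Periodic (chemPotential h ρ D t) := fun t i x => by
    simp only [chemPotential, S.periodic_ρ t i x, S.periodic_ρx t i x, (S.bdd_ρxx _ _).1 t i x]
  have sμ : ∀ n, ContDiff ℝ 2 (smoothPotential h (R n)) := fun n =>
    contDiff_smoothPotential H (sR n) (hpos n)
  have lμ : BAC T (fun n => smoothPotential h (R n)) fun z => chemPotential h ρ D z.1 z.2 := by
    have := (lh1.sub ((BAC.const (1 / 2)).mul (BAC.sum Finset.univ fun i _ => (lW i).pow 2))).sub
      (BAC.sum Finset.univ fun i _ => lWx i i)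
    refine BAC.congr_lim (F := fun n => smoothPotential h (R n)) this ?_
    refine ae_of_all _ fun z hzt => ?_
    have hρ := S.pos z.1 (Ioo_subset_Icc_self hzt) z.2
    rw [chemPotential, EuclideanSpace.real_norm_sq_eq]
    congr 1
    · congr 1
      simp only [mul_pow]
      rw [← Finset.mul_sum]
      field_simp
    · refine Finset.sum_congr rfl fun i _ => ?_
      field_simp
  obtain ⟨g, hg, hmom⟩ := S.momentum
  have lP : ∀ j, BAC T (fun n => momentumResidual h (R n) (U n) j) fun _ => 0 := by
    intro j
    have lG := ((lh2.mul (lRx j)).sub (BAC.sum Finset.univ fun i _ => (lW i).mul (lWx i j))).sub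
      (BAC.sum Finset.univ fun i _ => lWxx i i j)
    replace lG := BAC.congr (F' := fun n => pd (eX j) (smoothPotential h (R n))) lG
      fun _ _ _ _ => Eventually.of_forall fun n z _ =>
        (pd_smoothPotential H (sR n) (hpos n) (eX j) z).symm
    -- Measurability and boundedness of the limiting potential are inherited from the convergence
    -- itself.
    have b_chem := lμ.essBdd_extendBy (fun n => (sμ n).continuous) p_chem 0
    have hwd := ((hg j).2.weakDeriv p_chem (hg j).1.1 b_chem ((hg j).1.essBdd 0)).congr
      (f' := fun z => chemPotential h ρ D z.1 z.2) fun z hz => extendBy_of_mem hz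
    -- Uniqueness of weak derivatives identifies the explicit third-order limit with the weak
    -- gradient g of the momentum equation.
    have lg := lG.congr_lim (BAC.pd_unique (fun n => (sμ n).of_le (by norm_num)) lμ lG hwd
      ((hg j).1.essBdd 0).locallyIntegrable)
    have := ((lUt j).add (BAC.sum Finset.univ fun i _ => (lU i).mul (lUx j i))).add lg.of_extendBy
    refine BAC.congr_lim (F := fun n => momentumResidual h (R n) (U n) j) this ?_
    have hm := ae_of_ae_cell (P := fun z : Pt d => ∀ j,
      ρ z.1 z.2 * (D.ut j z.1 z.2 + ∑ i, u z.1 z.2 i * D.ux j i z.1 z.2)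
        = -(ρ z.1 z.2 * g j z.1 z.2)) measurableSet_Ioo (fun t i x => by
        simp only [S.periodic_ρ t i x, (S.bdd_ut _).1 t i x, S.periodic_u t i x,
          (S.bdd_ux _ _).1 t i x, (hg _).1.1 t i x]) hmom
    filter_upwards [hm] with z hz hzt
    have hρ := S.pos z.1 (Ioo_subset_Icc_self hzt) z.2
    have hz := hz hzt j
    have h0 : ρ z.1 z.2 * (D.ut j z.1 z.2 + ∑ i, u z.1 z.2 i * D.ux j i z.1 z.2 + g j z.1 z.2)
        = 0 := by linarith
    exact (mul_eq_zero.1 h0).resolve_left hρ.ne'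
  -- the velocity gradient
  have hgrad : ∀ a b, 0 < a → b < T → ∀ᶠ n in atTop, ∀ z : Pt d, z.1 ∈ Icc a b →
      ∀ i j, |pd (eX j) (U n i) z| ≤ |M| := by
    intro a b ha hb
    filter_upwards [eventually_all.2 fun i => eventually_all.2 fun j => eUx i j a b ha hb]
      with n hn z hz i j
    rw [hn i j z hz]
    refine abs_mollify_le n ((S.bdd_ux i j).essBdd 0) ?_ z
    have hm := ae_of_ae_cell (P := fun z : Pt d => |D.ux i j z.1 z.2| ≤ M) measurableSet_Ioo
      (fun t k x => by simp only [(S.bdd_ux _ _).1 t k x]) (V.mono fun z hz => (hz i j).2.2.1)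
    filter_upwards [hm] with y hy
    by_cases hyt : y.1 ∈ Ioo 0 T
    · rw [extendBy_of_mem hyt]; exact (hy hyt).trans (le_abs_self M)
    · rw [extendBy_of_notMem hyt]; simp
  exact ⟨R, U, sR, sU, fun n => spacePeriodic_mollify n (spacePeriodic_extendBy S.periodic_ρ),
    fun n i => spacePeriodic_mollify n (spacePeriodic_extendBy (p_u i)), ⟨c, C, hc, hrange⟩,
    lR, lU, lW, hgrad, lN, lNx, lP⟩

end Approximation

/-! ### The pointwise algebra of the relative energy identity. -/

section Algebra

variable {d : ℕ}

/-- The relative energy density, expanded as an affine expression in the quantities of the weak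
solution. -/
noncomputable def expandedRelEnergy (h : ℝ → ℝ) (e ρ : ℝ) (m q : Fin d → ℝ) (r : ℝ)
    (u w : Fin d → ℝ) : ℝ :=
  e - ∑ i, m i * u i - ∑ i, q i * w i
    + ρ * (1 / 2 * ∑ i, u i ^ 2 + 1 / 2 * ∑ i, w i ^ 2 - deriv h r) + pressure h r

/-- The quadratic remainder of the relative energy identity. -/
noncomputable def relFlux (h : ℝ → ℝ) (ρ : ℝ) (m q : Fin d → ℝ) (r : ℝ) (u w : Fin d → ℝ)
    (ux : Fin d → Fin d → ℝ) : ℝ :=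
  (∑ i, ∑ j, (m i * m j / ρ - m i * u j - u i * m j + ρ * u i * u j) * ux i j)
    + (∑ i, ∑ j, (q i * q j / ρ - q i * w j - w i * q j + ρ * w i * w j) * ux i j)
    + (∑ i, ux i i) * (pressure h ρ - pressure h r - r * deriv (deriv h) r * (ρ - r))

lemma sum_sum_swap (f g : Fin d → Fin d → ℝ) (h : ∀ i j, f i j = g j i) :
    ∑ i, ∑ j, f i j = ∑ i, ∑ j, g i j := by
  rw [Finset.sum_comm]
  exact Finset.sum_congr rfl fun i _ => Finset.sum_congr rfl fun j _ => h j i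

lemma sum_ite_stress (c : ℝ) (ux : Fin d → Fin d → ℝ) :
    ∑ i, ∑ j, (if i = j then c else 0) * ux i j = c * ∑ i, ux i i := by
  simp [Finset.mul_sum]

/-- The combination of the weak equations that yields the relative energy identity. Here `a` is
the density, `b` the velocity, `w` the drift of the smooth comparison state. -/
lemma relEnergy_identity (h : ℝ → ℝ) (e ρ l r θ θ' lt : ℝ) (m q u w ut wt K v : Fin d → ℝ)
    (ux wx : Fin d → Fin d → ℝ) (Kt hp hpp : ℝ) (hsymm : ∀ i j, wx i j = wx j i)
    (hhp : hp = deriv h r) (hhpp : hpp = deriv (deriv h) r) :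
    -θ' * expandedRelEnergy h e ρ m q r u w + θ * relFlux h ρ m q r u w ux
      + θ * ((∑ j, m j * (ut j + ∑ i, u i * ux j i
                + (hpp * (r * w j) - ∑ i, w i * wx i j - K j)))
          - ρ * (∑ j, u j * (ut j + ∑ i, u i * ux j i
                + (hpp * (r * w j) - ∑ i, w i * wx i j - K j)))
          + r * hpp * (ρ - r) * (lt + ∑ i, u i * w i + ∑ i, ux i i)
          + (∑ j, q j * (wt j + ∑ i, (u i * wx i j + ux i j * w i) + v j))
          - ρ * (∑ j, w j * (wt j + ∑ i, (u i * wx i j + ux i j * w i) + v j)))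
    = -(e * θ')
      -- momentum
      + ((∑ i, m i * (θ' * u i + θ * ut i)) + (∑ i, ∑ j, m i * m j / ρ * (θ * ux i j))
        - ∑ i, ∑ j, ((if i = j then -pressure h ρ + l else 0) - q i * q j / ρ) * (θ * ux i j))
      -- mass
      - (ρ * (θ' * (1 / 2 * ∑ i, u i ^ 2 + 1 / 2 * ∑ i, w i ^ 2 - hp + ∑ i, wx i i)
            + θ * ((∑ i, u i * ut i) + (∑ i, w i * wt i) - hpp * (r * lt) + Kt))
        + ∑ j, m j * (θ * ((∑ i, u i * ux i j) + (∑ i, w i * wx i j) - hpp * (r * w j) + K j)))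
      -- pressure
      - (θ' * pressure h r + θ * (r * hpp * (r * lt)))
      - θ * ∑ i, (pressure h r * ux i i + r * hpp * (r * w i) * u i)
      -- weak Laplacian
      + ((∑ i, q i * (θ * v i)) + l * (θ * ∑ i, ux i i))
      -- weak gradient
      + (ρ * (θ' * (∑ i, wx i i) + θ * Kt + θ * ((∑ i, ∑ j, ux i j * wx j i) + ∑ i, u i * K i)
            - θ * ((∑ i, ∑ j, wx j i * ux i j) + ∑ i, w i * v i))
        + ∑ j, q j * (θ' * w j + θ * wt j + θ * (∑ i, u i * wx j i) - θ * ∑ i, w i * ux j i)) := by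
  -- The variables lt, K, Kt, v stand for ∂ₜ log r, ∇ div w, ∂ₜ div w and ∇ div u. Among the
  -- relations between the jets, the algebra uses only the symmetry of `wx`.
  subst hhp hhpp
  have hu2 : ∑ i, u i * w i = ∑ i, w i * u i := Finset.sum_congr rfl fun i _ => mul_comm _ _
  -- expansion into elementary contractions
  have f1 : ∑ j, m j * (ut j + ∑ i, u i * ux j i
      + (deriv (deriv h) r * (r * w j) - ∑ i, w i * wx i j - K j))
      = (∑ j, m j * ut j) + (∑ i, ∑ j, m i * u j * ux i j) + deriv (deriv h) r * r * (∑ j, m j * w j)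
        - (∑ j, ∑ i, m j * w i * wx i j) - ∑ j, m j * K j := by
    simp only [mul_add, mul_sub, Finset.sum_add_distrib, Finset.sum_sub_distrib, Finset.mul_sum,
      ← mul_assoc]
    have : ∑ x, m x * deriv (deriv h) r * r * w x = ∑ i, deriv (deriv h) r * r * m i * w i :=
      Finset.sum_congr rfl fun i _ => by ring
    rw [this]; ring
  have f2 : ∑ j, u j * (ut j + ∑ i, u i * ux j i
      + (deriv (deriv h) r * (r * w j) - ∑ i, w i * wx i j - K j))
      = (∑ j, u j * ut j) + (∑ i, ∑ j, u i * u j * ux i j) + deriv (deriv h) r * r * (∑ j, w j * u j)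
        - (∑ j, ∑ i, u j * w i * wx i j) - ∑ j, u j * K j := by
    simp only [mul_add, mul_sub, Finset.sum_add_distrib, Finset.sum_sub_distrib, Finset.mul_sum,
      ← mul_assoc]
    have : ∑ x, u x * deriv (deriv h) r * r * w x = ∑ i, deriv (deriv h) r * r * w i * u i :=
      Finset.sum_congr rfl fun i _ => by ring
    rw [this]; ring
  have f3 : ∀ x : Fin d → ℝ, ∑ j, x j * (wt j + ∑ i, (u i * wx i j + ux i j * w i) + v j)
      = (∑ j, x j * wt j) + (∑ j, ∑ i, x j * u i * wx i j) + (∑ i, ∑ j, w i * x j * ux i j)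
        + ∑ j, x j * v j := by
    intro x
    have : ∑ i, ∑ j, w i * x j * ux i j = ∑ j, ∑ i, x j * (ux i j * w i) := by
      rw [Finset.sum_comm]
      exact Finset.sum_congr rfl fun i _ => Finset.sum_congr rfl fun j _ => by ring
    rw [this]
    simp only [mul_add, Finset.sum_add_distrib, Finset.mul_sum, ← mul_assoc]
    ring
  have f4 : ∑ i, m i * (θ' * u i + θ * ut i) = θ' * (∑ i, m i * u i) + θ * ∑ i, m i * ut i := by
    simp only [Finset.mul_sum, ← Finset.sum_add_distrib]
    exact Finset.sum_congr rfl fun i _ => by ring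
  have f5 : ∑ i, ∑ j, m i * m j / ρ * (θ * ux i j) = θ * ∑ i, ∑ j, m i * m j / ρ * ux i j := by
    simp only [Finset.mul_sum]
    exact Finset.sum_congr rfl fun i _ => Finset.sum_congr rfl fun j _ => by ring
  have f6 : ∑ i, ∑ j, ((if i = j then -pressure h ρ + l else 0) - q i * q j / ρ) * (θ * ux i j)
      = θ * ((-pressure h ρ + l) * (∑ i, ux i i) - ∑ i, ∑ j, q i * q j / ρ * ux i j) := by
    rw [← sum_ite_stress]
    simp only [← Finset.sum_sub_distrib, Finset.mul_sum]
    exact Finset.sum_congr rfl fun i _ => Finset.sum_congr rfl fun j _ => by ring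
  have f7 : ∑ j, m j * (θ * ((∑ i, u i * ux i j) + (∑ i, w i * wx i j)
      - deriv (deriv h) r * (r * w j) + K j))
      = θ * ((∑ i, ∑ j, u i * m j * ux i j) + (∑ j, ∑ i, m j * w i * wx i j)
        - deriv (deriv h) r * r * (∑ j, m j * w j) + ∑ j, m j * K j) := by
    have : ∑ i, ∑ j, u i * m j * ux i j = ∑ j, ∑ i, m j * (u i * ux i j) := by
      rw [Finset.sum_comm]
      exact Finset.sum_congr rfl fun i _ => Finset.sum_congr rfl fun j _ => by ring
    rw [this]
    simp only [mul_assoc (m _), ← Finset.mul_sum]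
    rw [mul_assoc, Finset.mul_sum, Finset.mul_sum, ← Finset.sum_add_distrib,
      ← Finset.sum_sub_distrib, ← Finset.sum_add_distrib, Finset.mul_sum]
    exact Finset.sum_congr rfl fun i _ => by ring
  have f8 : ∑ i, (pressure h r * ux i i + r * deriv (deriv h) r * (r * w i) * u i)
      = pressure h r * (∑ i, ux i i) + r * deriv (deriv h) r * r * ∑ i, w i * u i := by
    simp only [Finset.mul_sum, ← Finset.sum_add_distrib]
    exact Finset.sum_congr rfl fun i _ => by ring
  have f9 : ∑ i, q i * (θ * v i) = θ * ∑ i, q i * v i := by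
    simp only [Finset.mul_sum]
    exact Finset.sum_congr rfl fun i _ => by ring
  have f10 : ∑ j, q j * (θ' * w j + θ * wt j + θ * (∑ i, u i * wx j i) - θ * ∑ i, w i * ux j i)
      = θ' * (∑ j, q j * w j) + θ * (∑ j, q j * wt j) + θ * (∑ j, ∑ i, q j * u i * wx i j)
        - θ * ∑ i, ∑ j, q i * w j * ux i j := by
    simp only [mul_assoc (q _), ← Finset.mul_sum, hsymm]
    rw [Finset.mul_sum, Finset.mul_sum, Finset.mul_sum, Finset.mul_sum]
    rw [← Finset.sum_add_distrib, ← Finset.sum_add_distrib, ← Finset.sum_sub_distrib]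
    exact Finset.sum_congr rfl fun i _ => by ring
  have f11 : ∀ (a b : Fin d → ℝ), ∑ i, ∑ j, (a i * a j / ρ - a i * b j - b i * a j + ρ * b i * b j) * ux i j
      = (∑ i, ∑ j, a i * a j / ρ * ux i j) - (∑ i, ∑ j, a i * b j * ux i j)
        - (∑ i, ∑ j, b i * a j * ux i j) + ρ * ∑ i, ∑ j, b i * b j * ux i j := by
    intro a b
    simp only [Finset.mul_sum, ← Finset.sum_add_distrib, ← Finset.sum_sub_distrib]
    exact Finset.sum_congr rfl fun i _ => Finset.sum_congr rfl fun j _ => by ring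
  have g1 : ∑ i, ∑ j, wx j i * ux i j = ∑ i, ∑ j, ux i j * wx j i :=
    Finset.sum_congr rfl fun i _ => Finset.sum_congr rfl fun j _ => mul_comm _ _
  -- This is where w must be curl-free: (u·∇)w and the contraction of ∇w with u on the other index
  -- coincide. The same symmetry enters `f10`.
  have g2 : ∑ j, ∑ i, w j * u i * wx i j = ∑ j, ∑ i, u j * w i * wx i j :=
    sum_sum_swap _ _ fun i j => by rw [hsymm j i]; ring
  unfold expandedRelEnergy relFlux
  -- Once every contraction occurs in one normal form, it can be treated as an atom and the identity
  -- is one of commutative rings.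
  rw [f1, f2, f3, f3, f4, f5, f6, f7, f8, f9, f10, f11, f11, g1, g2, hu2]
  ring

end Algebra

/-! ### Pointwise control of the remainder by the relative energy density. -/

section Bounds

variable {d : ℕ} {h : ℝ → ℝ} {γ k A : ℝ}

/-- Completion of the square. At vacuum the hypothesis on a makes both sides 0 under the convention
x / 0 = 0. -/
lemma sum_rel_sq {ρ : ℝ} {a b : Fin d → ℝ} (hv : ρ = 0 → ∀ i, a i = 0) :
    (∑ i, a i ^ 2) / (2 * ρ) - ∑ i, a i * b i + ρ * (1 / 2 * ∑ i, b i ^ 2)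
      = 1 / 2 * ρ * ∑ i, (ρ⁻¹ * a i - b i) ^ 2 := by
  by_cases hρ : ρ = 0
  · simp [hρ, hv hρ]
  · simp only [Finset.mul_sum, Finset.sum_div, ← Finset.sum_sub_distrib, ← Finset.sum_add_distrib]
    refine Finset.sum_congr rfl fun i _ => ?_
    field_simp
    ring

/-- The expanded form is the relative energy density. -/
lemma expandedRelEnergy_eq {ρ r : ℝ} {m q : Sp d} {u w : Fin d → ℝ} (hm : ρ = 0 → m = 0)
    (hq : ρ = 0 → q = 0) :
    expandedRelEnergy h (energy h ρ q m) ρ m q r u w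
      = 1 / 2 * ρ * (∑ i, (ρ⁻¹ * m i - u i) ^ 2) + relInternal h ρ r
        + 1 / 2 * ρ * ∑ i, (ρ⁻¹ * q i - w i) ^ 2 := by
  rw [← sum_rel_sq fun h0 i => by rw [hm h0]; rfl, ← sum_rel_sq fun h0 i => by rw [hq h0]; rfl]
  simp only [expandedRelEnergy, energy, potential, relInternal, pressure,
    EuclideanSpace.real_norm_sq_eq]
  ring

lemma relEnergy_eq_sum {ρ r : ℝ} {m q qb u : Sp d} (hr : r ≠ 0) :
    relEnergy h ρ q m r qb (r • u)
      = 1 / 2 * ρ * (∑ i, (ρ⁻¹ * m i - u i) ^ 2) + relInternal h ρ r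
        + 1 / 2 * ρ * ∑ i, (ρ⁻¹ * q i - r⁻¹ * qb i) ^ 2 := by
  rw [relEnergy, EuclideanSpace.real_norm_sq_eq, EuclideanSpace.real_norm_sq_eq, smul_smul,
    inv_mul_cancel₀ hr, one_smul]
  rfl

lemma relEnergy_eq_expanded {ρ r : ℝ} {m q qb u : Sp d} (hr : r ≠ 0) (hm : ρ = 0 → m = 0)
    (hq : ρ = 0 → q = 0) :
    relEnergy h ρ q m r qb (r • u)
      = expandedRelEnergy h (energy h ρ q m) ρ m q r u fun i => r⁻¹ * qb i := by
  rw [relEnergy_eq_sum hr, expandedRelEnergy_eq hm hq]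

/-- The coefficient is ρ ξᵢξⱼ with ξ = a/ρ - b, and (∑|ξᵢ|)² ≤ d|ξ|² by Cauchy–Schwarz. The factor 2
offsets the ½ in the energy density. -/
lemma abs_sum_quadratic_le {ρ M : ℝ} (hρ : 0 ≤ ρ) {a b : Fin d → ℝ} (hv : ρ = 0 → ∀ i, a i = 0)
    {ux : Fin d → Fin d → ℝ} (hux : ∀ i j, |ux i j| ≤ M) (hM : 0 ≤ M) :
    |∑ i, ∑ j, (a i * a j / ρ - a i * b j - b i * a j + ρ * b i * b j) * ux i j|
      ≤ 2 * d * M * (1 / 2 * ρ * ∑ i, (ρ⁻¹ * a i - b i) ^ 2) := by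
  have e : ∀ i j, a i * a j / ρ - a i * b j - b i * a j + ρ * b i * b j
      = ρ * ((ρ⁻¹ * a i - b i) * (ρ⁻¹ * a j - b j)) := by
    intro i j
    by_cases h0 : ρ = 0
    · simp [h0, hv h0]
    · field_simp
      ring
  have h1 : |∑ i, ∑ j, (a i * a j / ρ - a i * b j - b i * a j + ρ * b i * b j) * ux i j|
      ≤ ∑ i, ∑ j, ρ * (|ρ⁻¹ * a i - b i| * |ρ⁻¹ * a j - b j|) * M := by
    refine (Finset.abs_sum_le_sum_abs _ _).trans (Finset.sum_le_sum fun i _ => ?_)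
    refine (Finset.abs_sum_le_sum_abs _ _).trans (Finset.sum_le_sum fun j _ => ?_)
    rw [e, abs_mul, abs_mul, abs_mul, abs_of_nonneg hρ]
    exact mul_le_mul_of_nonneg_left (hux i j) (by positivity)
  have h2 : ∑ i, ∑ j, ρ * (|ρ⁻¹ * a i - b i| * |ρ⁻¹ * a j - b j|) * M
      = ρ * M * (∑ i, |ρ⁻¹ * a i - b i|) ^ 2 := by
    rw [pow_two, Finset.sum_mul_sum, Finset.mul_sum]
    refine Finset.sum_congr rfl fun i _ => ?_
    rw [Finset.mul_sum]
    exact Finset.sum_congr rfl fun j _ => by ring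
  have h3 : (∑ i, |ρ⁻¹ * a i - b i|) ^ 2 ≤ d * ∑ i, (ρ⁻¹ * a i - b i) ^ 2 := by
    have := sq_sum_le_card_mul_sum_sq (s := Finset.univ) (f := fun i : Fin d => |ρ⁻¹ * a i - b i|)
    simpa using this
  rw [h2] at h1
  have h4 := mul_le_mul_of_nonneg_left h3 (mul_nonneg hρ hM)
  calc _ ≤ _ := h1
    _ ≤ _ := h4
    _ = _ := by ring

/-- The remainder of the relative energy identity is controlled by the relative energy. -/
lemma abs_relFlux_le (H : InternalEnergy h γ k A) {ρ r M : ℝ} {m q : Sp d} {u w : Fin d → ℝ}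
    {ux : Fin d → Fin d → ℝ} (hρ : 0 ≤ ρ) (hr : 0 < r) (hm : ρ = 0 → m = 0)
    (hq : ρ = 0 → q = 0) (hux : ∀ i j, |ux i j| ≤ M) (hM : 0 ≤ M) :
    |relFlux h ρ m q r u w ux|
      ≤ d * M * (2 + A) * expandedRelEnergy h (energy h ρ q m) ρ m q r u w := by
  have hA := H.A_pos
  have h1 := abs_sum_quadratic_le (b := u) hρ (fun h0 i => by rw [hm h0]; rfl : ρ = 0 → ∀ i, m i = 0)
    hux hM
  have h2 := abs_sum_quadratic_le (b := w) hρ (fun h0 i => by rw [hq h0]; rfl : ρ = 0 → ∀ i, q i = 0)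
    hux hM
  have h3 := H.abs_relPressure_le hρ hr
  have h4 := H.relInternal_nonneg hρ hr
  have h5 : |∑ i, ux i i| ≤ d * M := by
    refine (Finset.abs_sum_le_sum_abs _ _).trans ((Finset.sum_le_sum fun i _ => hux i i).trans ?_)
    simp
  have h6 : |(∑ i, ux i i) * (pressure h ρ - pressure h r - r * deriv (deriv h) r * (ρ - r))|
      ≤ d * M * (A * relInternal h ρ r) := by
    rw [abs_mul]
    exact mul_le_mul h5 h3 (abs_nonneg _) (by positivity)
  rw [expandedRelEnergy_eq hm hq, relFlux]
  have k1 : 0 ≤ 1 / 2 * ρ * ∑ i, (ρ⁻¹ * m i - u i) ^ 2 :=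
    mul_nonneg (by positivity) (Finset.sum_nonneg fun i _ => sq_nonneg _)
  have k2 : 0 ≤ 1 / 2 * ρ * ∑ i, (ρ⁻¹ * q i - w i) ^ 2 :=
    mul_nonneg (by positivity) (Finset.sum_nonneg fun i _ => sq_nonneg _)
  have hdM : 0 ≤ d * M := by positivity
  refine (abs_add_le _ _).trans ((add_le_add (abs_add_le _ _) le_rfl).trans ?_)
  -- The two quadratic parts contribute the factor 2dM and the pressure part dMA. All parts of the
  -- energy are nonnegative, so dM(2 + A) serves for each.
  nlinarith [mul_nonneg (mul_nonneg hdM hA.le) k1, mul_nonneg (mul_nonneg hdM hA.le) k2,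
    mul_nonneg hdM h4]

end Bounds

/-! ### Integrals of derivatives over the torus, and cutoffs in time. -/

section TorusIntegrals

open scoped Pointwise

variable {d : ℕ}

lemma cell_eq_fundamentalDomain :
    cell d = ZSpan.fundamentalDomain (EuclideanSpace.basisFun (Fin d) ℝ).toBasis := by
  ext x
  simp [cell, ZSpan.mem_fundamentalDomain]

lemma Periodic.add_mem_span {f : Sp d → ℝ} (hf : Periodic f) {p : Sp d}
    (hp : p ∈ Submodule.span ℤ (range (EuclideanSpace.basisFun (Fin d) ℝ).toBasis)) (x : Sp d) :
    f (x + p) = f x := by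
  induction hp using Submodule.span_induction generalizing x with
  | mem y hy =>
    obtain ⟨i, rfl⟩ := hy
    simpa using hf i x
  | zero => simp
  | add y z _ _ hy hz => rw [← add_assoc, hz, hy]
  | smul n y _ hy =>
    induction n using Int.induction_on generalizing x with
    | zero => simp
    | succ n ih => rw [add_smul, one_smul, ← add_assoc, hy, ih]
    | pred n ih =>
      have := hy (x + (-(n : ℤ) - 1) • y)
      rw [← this, add_assoc, sub_smul, one_smul, sub_add_cancel, ih]

/-- A translate of the unit cell is again a fundamental domain of ℤᵈ, and invariant functions have
the same integral over all fundamental domains. -/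
lemma Periodic.setIntegral_add {f : Sp d → ℝ} (hf : Periodic f) (s : Sp d) :
    ∫ x in cell d, f (x + s) = ∫ x in cell d, f x := by
  have hfd : IsAddFundamentalDomain
      (Submodule.span ℤ (range (EuclideanSpace.basisFun (Fin d) ℝ).toBasis)).toAddSubgroup
      (cell d) volume := by
    rw [cell_eq_fundamentalDomain]
    exact ZSpan.isAddFundamentalDomain' _ _
  have hcount : Countable
      (Submodule.span ℤ (range (EuclideanSpace.basisFun (Fin d) ℝ).toBasis)).toAddSubgroup :=
    inferInstanceAs (Countable
      (Submodule.span ℤ (range (EuclideanSpace.basisFun (Fin d) ℝ).toBasis)))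
  have h1 := (hfd.vadd_of_comm s).setIntegral_eq hfd (f := f) fun g x => by
    have := hf.add_mem_span g.2 x
    rw [add_comm] at this
    exact this
  have h2 := (measurePreserving_add_right volume s).setIntegral_preimage_emb
    (MeasurableEquiv.addRight s).measurableEmbedding f (s +ᵥ cell d)
  rw [← h1, ← h2]
  congr 2
  ext x
  rw [mem_preimage, mem_vadd_set_iff_neg_vadd_mem, vadd_eq_add, neg_add_eq_sub, add_sub_cancel_right]

lemma integrableOn_cell_of_continuous {f : Sp d → ℝ} (hf : Continuous f) :
    IntegrableOn f (cell d) :=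
  (hf.continuousOn.integrableOn_compact isCompact_box).mono_set cell_subset_box

/-- By translation invariance the integral may be averaged over shifts s ∈ [0,1] in direction i.
After Fubini the inner integral is g(x + eᵢ) - g(x) = 0, and no boundary of the cell has to be
handled. -/
lemma Periodic.setIntegral_dx {g : Sp d → ℝ} (hg : Periodic g) (hs : ContDiff ℝ 1 g) (i : Fin d) :
    ∫ x in cell d, dx i g x = 0 := by
  set e : Sp d := EuclideanSpace.single i (1 : ℝ) with he
  have hcont : Continuous (dx i g) := (hs.continuous_fderiv (by simp)).clm_apply continuous_const
  have hper : Periodic (dx i g) := by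
    intro j x
    have e1 : g = fun y => g (y + EuclideanSpace.single j 1) := by ext y; exact (hg j y).symm
    simp only [dx]
    conv_rhs => rw [e1]
    rw [fderiv_comp_add_right]
  have hder : ∀ x (s : ℝ), HasDerivAt (fun s : ℝ => g (x + s • e)) (dx i g (x + s • e)) s := by
    intro x s
    have h1 : HasDerivAt (fun s : ℝ => x + s • e) e s := by
      simpa using ((hasDerivAt_id s).smul_const e).const_add x
    exact ((hs.differentiable (by simp) _).hasFDerivAt.comp_hasDerivAt s h1)
  have hftc : ∀ x, ∫ s in Ioc (0 : ℝ) 1, dx i g (x + s • e) = 0 := by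
    intro x
    rw [← intervalIntegral.integral_of_le zero_le_one,
      intervalIntegral.integral_eq_sub_of_hasDerivAt (fun s _ => hder x s)
        (Continuous.intervalIntegrable (by fun_prop) _ _)]
    simp [he, hg i x]
  have hint : Integrable (Function.uncurry fun (x : Sp d) (s : ℝ) => dx i g (x + s • e))
      ((volume.restrict (cell d)).prod (volume.restrict (Ioc 0 1))) := by
    rw [Measure.prod_restrict, ← Measure.volume_eq_prod]
    have h1 : Continuous (Function.uncurry fun (x : Sp d) (s : ℝ) => dx i g (x + s • e)) := by
      unfold Function.uncurry; fun_prop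
    exact (h1.continuousOn.integrableOn_compact (isCompact_box.prod isCompact_Icc)).mono_set
      (prod_mono cell_subset_box Ioc_subset_Icc_self)
  have h1 := integral_integral_swap hint
  simp only [hftc, integral_zero, hper.setIntegral_add] at h1
  simpa using h1.symm

/-- `C¹` periodic functions on space-time with compact time support in `[a,b]`. -/
structure IsCutoff (a b : ℝ) (Φ : Pt d → ℝ) : Prop where
  contDiff : ContDiff ℝ 1 Φ
  periodic : SpacePeriodic Φ
  support : ∀ z : Pt d, z.1 ∉ Icc a b → Φ z = 0

variable {a b : ℝ} {Φ : Pt d → ℝ}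

lemma pd_eq_zero_of_notMem (hs : ∀ z : Pt d, z.1 ∉ Icc a b → Φ z = 0) (v : Pt d)
    {z : Pt d} (hz : z.1 ∉ Icc a b) : pd v Φ z = 0 := by
  have : Φ =ᶠ[𝓝 z] fun _ => 0 := by
    have h1 : ∀ᶠ y : Pt d in 𝓝 z, y.1 ∈ (Icc a b)ᶜ :=
      continuous_fst.continuousAt.eventually (isClosed_Icc.isOpen_compl.mem_nhds hz)
    filter_upwards [h1] with y hy using hs y hy
  rw [pd, this.fderiv_eq]
  simp

lemma integrableOn_cutoff_mul {W : Pt d → ℝ} {R : ℝ} (hW : IntegrableOn W (Icc 0 R ×ˢ cell d))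
    (hb : b ≤ R) {c : Pt d → ℝ} (hc : Continuous c) (hs : ∀ z : Pt d, z.1 ∉ Icc a b → c z = 0) :
    IntegrableOn (fun z => W z * c z) (Ici 0 ×ˢ cell d) := by
  have hm : MeasurableSet (Icc 0 R ×ˢ cell d) := measurableSet_Icc.prod measurableSet_cell
  have h1 : IntegrableOn (fun z => W z * c z) (Icc 0 R ×ˢ cell d) := by
    obtain ⟨C, hC⟩ := ((isCompact_Icc (a := (0 : ℝ)) (b := R)).prod
      (isCompact_box (d := d))).exists_bound_of_continuousOn hc.continuousOn
    refine Integrable.mul_bdd (c := C) hW hc.aestronglyMeasurable ?_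
    filter_upwards [ae_restrict_mem hm] with z hz using hC z ⟨hz.1, cell_subset_box hz.2⟩
  refine h1.of_forall_sdiff_eq_zero (measurableSet_Ici.prod measurableSet_cell) fun z hz => ?_
  rw [hs z fun h2 => hz.2 ⟨⟨hz.1.1, h2.2.trans hb⟩, hz.1.2⟩, mul_zero]

lemma integrableOn_cutoff {c : Pt d → ℝ} (hc : Continuous c)
    (hs : ∀ z : Pt d, z.1 ∉ Icc a b → c z = 0) : IntegrableOn c (Ici 0 ×ˢ cell d) := by
  have h1 : IntegrableOn (fun _ : Pt d => (1 : ℝ)) (Icc 0 b ×ˢ cell d) :=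
    (continuousOn_const.integrableOn_compact
      ((isCompact_Icc (a := (0 : ℝ)) (b := b)).prod (isCompact_box (d := d)))).mono_set
      (prod_mono subset_rfl cell_subset_box)
  simpa using integrableOn_cutoff_mul h1 le_rfl hc hs

lemma IsCutoff.isTest (hΦ : IsCutoff a b Φ) : IsTest fun t x => Φ (t, x) :=
  ⟨hΦ.contDiff, hΦ.periodic, b + 1, fun t ht x => hΦ.support _ fun h => by linarith [h.2]⟩

lemma IsCutoff.isInteriorTest (hΦ : IsCutoff a b Φ) (hs : ContDiff ℝ ∞ Φ) (ha : 0 < a) :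
    IsInteriorTest (Ioi 0) fun t x => Φ (t, x) :=
  ⟨hs, hΦ.periodic, a, b, fun _ ht => ha.trans_le ht.1, fun t ht x => hΦ.support (t, x) ht⟩

lemma IsCutoff.differentiable (hΦ : IsCutoff a b Φ) : Differentiable ℝ Φ :=
  hΦ.contDiff.differentiable (by simp)

lemma IsCutoff.integrableOn_pd (hΦ : IsCutoff a b Φ) (v : Pt d) :
    IntegrableOn (pd v Φ) (Ici 0 ×ˢ cell d) :=
  integrableOn_cutoff (continuous_pd hΦ.contDiff (by simp) v)
    fun _ => pd_eq_zero_of_notMem hΦ.support v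

lemma IsCutoff.integral_pd_eX (hΦ : IsCutoff a b Φ) (i : Fin d) :
    ∫ z in Ici 0 ×ˢ cell d, pd (eX i) Φ z = 0 := by
  have h1 := hΦ.integrableOn_pd (eX i)
  rw [Measure.volume_eq_prod] at h1 ⊢
  rw [setIntegral_prod _ h1]
  refine (setIntegral_congr_fun measurableSet_Ici fun t _ => ?_).trans (integral_zero _ _)
  simp only [← dx_curry hΦ.differentiable]
  have : ContDiff ℝ 1 fun x => Φ (t, x) := hΦ.contDiff.comp (contDiff_const.prodMk contDiff_id)
  exact Periodic.setIntegral_dx (hΦ.periodic t) this i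

lemma IsCutoff.integral_pd_eT (hΦ : IsCutoff a b Φ) (ha : 0 < a) :
    ∫ z in Ici 0 ×ˢ cell d, pd eT Φ z = 0 := by
  have h1 := hΦ.integrableOn_pd eT
  rw [volume_restrict_prod]
  rw [IntegrableOn, volume_restrict_prod] at h1
  rw [integral_prod_symm _ h1]
  refine (integral_congr_ae (ae_of_all _ fun x => ?_)).trans (integral_zero _ _)
  simp only [← dt_curry hΦ.differentiable, dt]
  have hd : ContDiff ℝ 1 fun t => Φ (t, x) := hΦ.contDiff.comp (contDiff_id.prodMk contDiff_const)
  have h0 : ∀ t ∉ Icc a b, Φ (t, x) = 0 := fun t ht => hΦ.support (t, x) ht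
  have hc : HasCompactSupport fun t => Φ (t, x) := HasCompactSupport.intro isCompact_Icc h0
  -- Since a > 0, the half-line can be replaced by the whole line, and no boundary term appears at
  -- time 0.
  rw [setIntegral_eq_integral_of_forall_compl_eq_zero]
  · exact integral_eq_zero_of_hasDerivAt_of_integrable
      (fun t => (hd.differentiable (by simp) t).hasDerivAt)
      ((hd.continuous_deriv (by simp)).integrable_of_hasCompactSupport hc.deriv)
      (hd.continuous.integrable_of_hasCompactSupport hc)
  · intro t ht
    have : (fun t => Φ (t, x)) =ᶠ[𝓝 t] fun _ => 0 := by
      have ht' : t < a := (not_le.1 ht).trans ha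
      filter_upwards [Iio_mem_nhds ht'] with s hs using h0 s fun h => absurd h.1 (not_le.2 hs)
    rw [this.deriv_eq]
    simp

end TorusIntegrals

/-! ### Integrability of the weak solution and its equations tested with cutoffs. -/

section WeakSolutions

variable {d : ℕ}

/-- Slicewise validity passes to the product only for measurable properties. A null measurable one
is first shrunk to a measurable set of the same measure class, which loses only a null part of
almost every slice. -/
lemma ae_prod_of_ae_ae {α β : Type*} [MeasurableSpace α] [MeasurableSpace β] {μ : Measure α}
    {ν : Measure β} [SFinite ν] [SFinite μ] {p : α × β → Prop}
    (hp : NullMeasurableSet {z | p z} (μ.prod ν)) (h : ∀ᵐ x ∂μ, ∀ᵐ y ∂ν, p (x, y)) :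
    ∀ᵐ z ∂μ.prod ν, p z := by
  obtain ⟨t, hts, htm, hte⟩ := hp.exists_measurable_subset_ae_eq
  have h1 : ∀ᵐ z ∂μ.prod ν, z ∈ {z | p z} → z ∈ t := hte.symm.le
  have h2 : ∀ᵐ z ∂μ.prod ν, z ∈ t := by
    refine (Measure.ae_prod_iff_ae_ae (p := fun z => z ∈ t) htm).2 ?_
    filter_upwards [h, Measure.ae_ae_of_ae_prod h1] with x hx hx1
    filter_upwards [hx, hx1] with y hy hy1 using hy1 hy
  exact h2.mono fun z hz => hts hz

section ContL1

variable {F : Type*} [NormedAddCommGroup F] {f : ℝ → Sp d → F}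

lemma ContL1.continuousOn_norm (hf : ContL1 f) :
    ContinuousOn (fun t => ∫ x in cell d, ‖f t x‖) (Ici 0) := by
  intro t ht
  have h1 := hf.2.2 t ht
  rw [ContinuousWithinAt, tendsto_iff_norm_sub_tendsto_zero]
  refine squeeze_zero' (Eventually.of_forall fun _ => norm_nonneg _) ?_ h1
  filter_upwards [self_mem_nhdsWithin] with s hs
  rw [← integral_sub (hf.2.1 s hs).norm (hf.2.1 t ht).norm]
  refine (norm_integral_le_integral_norm _).trans ?_
  refine integral_mono ((hf.2.1 s hs).norm.sub (hf.2.1 t ht).norm).norm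
    ((hf.2.1 s hs).sub (hf.2.1 t ht)).norm fun x => ?_
  exact abs_norm_sub_norm_le _ _

/-- By Fubini–Tonelli: the slice norms depend continuously on time, hence are integrable over [0,R].
-/
lemma ContL1.integrableOn (hf : ContL1 f) (R : ℝ) :
    IntegrableOn (fun z : Pt d => f z.1 z.2) (Icc 0 R ×ˢ cell d) := by
  have hm : AEStronglyMeasurable (fun z : Pt d => f z.1 z.2)
      ((volume.restrict (Icc 0 R)).prod (volume.restrict (cell d))) := by
    rw [← volume_restrict_prod]
    exact hf.1.mono_measure (Measure.restrict_mono (prod_mono Icc_subset_Ici_self subset_rfl) le_rfl)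
  rw [IntegrableOn, volume_restrict_prod, integrable_prod_iff hm]
  constructor
  · filter_upwards [ae_restrict_mem measurableSet_Icc] with t ht using hf.2.1 t ht.1
  · exact (hf.continuousOn_norm.mono Icc_subset_Ici_self).integrableOn_compact isCompact_Icc

lemma ContL1.component {f : ℝ → Sp d → Sp d} (hf : ContL1 f) (i : Fin d) :
    ContL1 fun t x => f t x i := by
  refine ⟨(EuclideanSpace.proj (𝕜 := ℝ) i).continuous.comp_aestronglyMeasurable hf.1,
    fun t ht => (EuclideanSpace.proj (𝕜 := ℝ) i).integrable_comp (hf.2.1 t ht), fun t ht => ?_⟩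
  refine squeeze_zero' (Eventually.of_forall fun _ => integral_nonneg fun _ => norm_nonneg _) ?_
    (hf.2.2 t ht)
  filter_upwards [self_mem_nhdsWithin] with s hs
  have hd := (hf.2.1 s hs).sub (hf.2.1 t ht)
  refine integral_mono ((EuclideanSpace.proj (𝕜 := ℝ) i).integrable_comp hd).norm hd.norm
    fun x => ?_
  exact PiLp.norm_apply_le (f s x - f t x) i

end ContL1

lemma ae_Ici_cell {p : Pt d → Prop}
    (hp : NullMeasurableSet {z | p z} (volume.restrict (Ici 0 ×ˢ cell d)))
    (h : ∀ t, 0 ≤ t → ∀ᵐ x ∂volume.restrict (cell d), p (t, x)) :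
    ∀ᵐ z ∂volume.restrict (Ici 0 ×ˢ cell d), p z := by
  rw [volume_restrict_prod] at hp ⊢
  refine ae_prod_of_ae_ae hp ?_
  filter_upwards [ae_restrict_mem measurableSet_Ici] with t ht using h t ht

variable {h : ℝ → ℝ} {γ k A : ℝ} {ρ : ℝ → Sp d → ℝ} {q : ℝ → Sp d → Sp d}
  {l : ℝ → Sp d → ℝ} {m : ℝ → Sp d → Sp d}

namespace IsWeakSolution

lemma ae_nonneg (S : IsWeakSolution h ρ q l m) :
    ∀ᵐ z ∂volume.restrict (Ici 0 ×ˢ cell d), 0 ≤ ρ z.1 z.2 :=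
  ae_Ici_cell (nullMeasurableSet_le aemeasurable_const S.cont_ρ.1.aemeasurable) S.nonneg

lemma ae_vacuum_m (S : IsWeakSolution h ρ q l m) :
    ∀ᵐ z ∂volume.restrict (Ici 0 ×ˢ cell d), ρ z.1 z.2 = 0 → m z.1 z.2 = 0 := by
  refine ae_Ici_cell (p := fun z => ρ z.1 z.2 = 0 → m z.1 z.2 = 0) ?_ S.vacuum_m
  simp only [imp_iff_not_or]
  exact (nullMeasurableSet_eq_fun S.cont_ρ.1.aemeasurable aemeasurable_const).compl.union
    (nullMeasurableSet_eq_fun S.cont_m.1.aemeasurable aemeasurable_const)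

lemma ae_vacuum_q (S : IsWeakSolution h ρ q l m) :
    ∀ᵐ z ∂volume.restrict (Ici 0 ×ˢ cell d), ρ z.1 z.2 = 0 → q z.1 z.2 = 0 := by
  refine ae_Ici_cell (p := fun z => ρ z.1 z.2 = 0 → q z.1 z.2 = 0) ?_ S.vacuum_q
  simp only [imp_iff_not_or]
  exact (nullMeasurableSet_eq_fun S.cont_ρ.1.aemeasurable aemeasurable_const).compl.union
    (nullMeasurableSet_eq_fun S.meas_q.aemeasurable aemeasurable_const)

end IsWeakSolution

/-- Since h may be negative, the energy density alone need not dominate the capillary term.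
Subtracting the tangent of h at 1, an affine minorant of h, repairs this. -/
lemma InternalEnergy.sq_div_le_energy (H : InternalEnergy h γ k A) {r : ℝ} {q m : Sp d}
    (hr : 0 ≤ r) :
    ‖q‖ ^ 2 / (2 * r) ≤ energy h r q m - h 1 - deriv h 1 * (r - 1) := by
  have h1 := H.relInternal_nonneg hr one_pos
  have h2 : 0 ≤ ‖m‖ ^ 2 / (2 * r) := by positivity
  unfold relInternal at h1
  unfold energy potential
  linarith

/-- Young's inequality |q| ≤ r/2 + |q|²/(2r), with the vacuum condition at r = 0. -/
lemma InternalEnergy.norm_le_energy (H : InternalEnergy h γ k A) {r : ℝ} {q m : Sp d}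
    (hr : 0 ≤ r) (hq : r = 0 → q = 0) :
    ‖q‖ ≤ r / 2 + (energy h r q m - h 1 - deriv h 1 * (r - 1)) := by
  have h1 := H.sq_div_le_energy (q := q) (m := m) hr
  rcases hr.eq_or_lt with h0 | h0
  · have h2 : 0 ≤ ‖q‖ ^ 2 / (2 * r) := by positivity
    rw [hq h0.symm, norm_zero] at *
    linarith
  · have h2 : ‖q‖ ≤ r / 2 + ‖q‖ ^ 2 / (2 * r) := by
      have : r / 2 + ‖q‖ ^ 2 / (2 * r) - ‖q‖ = (r - ‖q‖) ^ 2 / (2 * r) := by field_simp; ring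
      have h3 : 0 ≤ (r - ‖q‖) ^ 2 / (2 * r) := by positivity
      linarith
    linarith

namespace IsDissipativeWeakSolution

/-- Integrability of each slice of q says nothing about integrability in time. That comes from
domination by density and energy, both continuous in time with values in L¹. -/
lemma integrableOn_q (S : IsDissipativeWeakSolution h ρ q l m) (H : InternalEnergy h γ k A)
    (R : ℝ) : IntegrableOn (fun z : Pt d => q z.1 z.2) (Icc 0 R ×ˢ cell d) := by
  have hsub : Icc 0 R ×ˢ cell d ⊆ Ici 0 ×ˢ cell d := prod_mono Icc_subset_Ici_self subset_rfl
  have iρ := S.cont_ρ.integrableOn R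
  have ie := S.cont_energy.integrableOn R
  have ic : ∀ c : ℝ, IntegrableOn (fun _ : Pt d => c) (Icc 0 R ×ˢ cell d) := fun c =>
    (continuousOn_const.integrableOn_compact
      ((isCompact_Icc (a := (0 : ℝ)) (b := R)).prod (isCompact_box (d := d)))).mono_set
      (prod_mono subset_rfl cell_subset_box)
  have hb : IntegrableOn (fun z : Pt d => ρ z.1 z.2 / 2
      + (energy h (ρ z.1 z.2) (q z.1 z.2) (m z.1 z.2) - h 1 - deriv h 1 * (ρ z.1 z.2 - 1)))
      (Icc 0 R ×ˢ cell d) :=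
    (iρ.div_const 2).add ((ie.sub (ic _)).sub ((iρ.sub (ic 1)).const_mul _))
  refine Integrable.mono' hb (S.meas_q.mono_measure (Measure.restrict_mono hsub le_rfl)) ?_
  filter_upwards [ae_restrict_of_ae_restrict_of_subset hsub S.ae_nonneg,
    ae_restrict_of_ae_restrict_of_subset hsub S.ae_vacuum_q] with z h1 h2
  exact H.norm_le_energy h1 h2

end IsDissipativeWeakSolution

section Testing

variable {a b : ℝ} {Φ : Pt d → ℝ}

lemma IsWeakSolution.integral_mass (S : IsWeakSolution h ρ q l m) (ha : 0 < a)
    (hΦ : IsCutoff a b Φ) :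
    ∫ z in Ici 0 ×ˢ cell d, (ρ z.1 z.2 * pd eT Φ z + ∑ i, m z.1 z.2 i * pd (eX i) Φ z) = 0 := by
  have h1 := S.mass _ hΦ.isTest
  simp only [dt_curry hΦ.differentiable, dx_curry hΦ.differentiable, Prod.mk.eta] at h1
  -- The cutoff lives in positive times, so the initial datum drops out.
  have h0 : ∀ x, Φ (0, x) = 0 := fun x => hΦ.support _ fun hx => absurd hx.1 (not_le.2 ha)
  simp only [h0, mul_zero, integral_zero, neg_eq_zero] at h1
  exact h1

lemma IsWeakSolution.integral_momentum (S : IsWeakSolution h ρ q l m) (ha : 0 < a)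
    {Φ : Fin d → Pt d → ℝ} (hΦ : ∀ i, IsCutoff a b (Φ i)) :
    ∫ z in Ici 0 ×ˢ cell d, ((∑ i, m z.1 z.2 i * pd eT (Φ i) z)
      + (∑ i, ∑ j, m z.1 z.2 i * m z.1 z.2 j / ρ z.1 z.2 * pd (eX j) (Φ i) z)
      - ∑ i, ∑ j, stress h (ρ z.1 z.2) (q z.1 z.2) (l z.1 z.2) i j * pd (eX j) (Φ i) z) = 0 := by
  have h1 := S.momentum (fun i t x => Φ i (t, x)) fun i => (hΦ i).isTest
  simp only [dt_curry (hΦ _).differentiable, dx_curry (hΦ _).differentiable, Prod.mk.eta] at h1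
  have h0 : ∀ i x, Φ i (0, x) = 0 := fun i x => (hΦ i).support _ fun hx => absurd hx.1 (not_le.2 ha)
  simp only [h0, mul_zero, Finset.sum_const_zero, integral_zero, neg_eq_zero] at h1
  exact h1

lemma Ioi_prod_ae_eq : (Ioi (0 : ℝ) ×ˢ cell d : Set (Pt d)) =ᵐ[volume] Ici 0 ×ˢ cell d := by
  rw [Measure.volume_eq_prod]
  exact Measure.set_prod_ae_eq Ioi_ae_eq_Ici (ae_eq_refl _)

lemma IsDissipativeWeakSolution.integral_laplacian (S : IsDissipativeWeakSolution h ρ q l m)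
    (H : InternalEnergy h γ k A) (ha : 0 < a) (hΦ : IsCutoff a b Φ) (hs : ContDiff ℝ ∞ Φ) :
    ∫ z in Ici 0 ×ˢ cell d, ((∑ i, q z.1 z.2 i * pd (eX i) Φ z) + l z.1 z.2 * Φ z) = 0 := by
  have h1 := S.laplacian _ (hΦ.isInteriorTest hs ha)
  simp only [dx_curry hΦ.differentiable, Prod.mk.eta] at h1
  rw [setIntegral_congr_set Ioi_prod_ae_eq, setIntegral_congr_set Ioi_prod_ae_eq] at h1
  rw [integral_add, h1, neg_add_cancel]
  · refine integrable_finsetSum _ fun i _ => ?_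
    exact integrableOn_cutoff_mul
      ((EuclideanSpace.proj (𝕜 := ℝ) i).integrable_comp (S.integrableOn_q H b)) le_rfl
      (continuous_pd hs (by simp) _) fun _ => pd_eq_zero_of_notMem hΦ.support _
  · exact integrableOn_cutoff_mul (S.int_l b) le_rfl hs.continuous hΦ.support

lemma IsDissipativeWeakSolution.integral_grad (S : IsDissipativeWeakSolution h ρ q l m)
    (H : InternalEnergy h γ k A) (hΦ : IsCutoff a b Φ) (hs : ContDiff ℝ ∞ Φ)
    (i : Fin d) :
    ∫ z in Ici 0 ×ˢ cell d, (ρ z.1 z.2 * pd (eX i) Φ z + q z.1 z.2 i * Φ z) = 0 := by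
  have i1 : IntegrableOn (fun z : Pt d => ρ z.1 z.2 * pd (eX i) Φ z) (Ici 0 ×ˢ cell d) :=
    integrableOn_cutoff_mul (S.cont_ρ.integrableOn b) le_rfl
      (continuous_pd hs (by simp) _) fun _ => pd_eq_zero_of_notMem hΦ.support _
  have i2 : IntegrableOn (fun z : Pt d => q z.1 z.2 i * Φ z) (Ici 0 ×ˢ cell d) :=
    integrableOn_cutoff_mul
      ((EuclideanSpace.proj (𝕜 := ℝ) i).integrable_comp (S.integrableOn_q H b)) le_rfl
      hs.continuous hΦ.support
  rw [integral_add i1 i2]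
  rw [IntegrableOn, volume_restrict_prod] at i1 i2
  rw [volume_restrict_prod, integral_prod _ i1, integral_prod _ i2, ← eq_neg_iff_add_eq_zero,
    ← integral_neg]
  refine setIntegral_congr_fun measurableSet_Ici fun t ht => ?_
  have hst : ContDiff ℝ ∞ fun x => Φ (t, x) := hs.comp (contDiff_const.prodMk contDiff_id)
  have := S.grad t ht _ hst (hΦ.periodic t) i
  simpa only [dx_curry hΦ.differentiable] using this

end Testing

end WeakSolutions

/-! ### The relative energy inequality against a smooth state. -/

section RelativeEnergyInequality

variable {d : ℕ} {a b : ℝ} {η : ℝ → ℝ} {F : Pt d → ℝ}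

lemma isCutoff_mul (hη : ContDiff ℝ 1 η) (hs : ∀ t ∉ Icc a b, η t = 0) (hF : ContDiff ℝ 1 F)
    (hp : SpacePeriodic F) : IsCutoff a b fun z : Pt d => η z.1 * F z :=
  ⟨(hη.comp contDiff_fst).mul hF, fun t i x => by have := hp t i x; simp only at this ⊢; rw [this],
    fun z hz => by simp [hs z.1 hz]⟩

lemma hasFDerivAt_comp_fst (hη : ContDiff ℝ 1 η) (z : Pt d) :
    HasFDerivAt (fun z : Pt d => η z.1) (deriv η z.1 • ContinuousLinearMap.fst ℝ ℝ (Sp d)) z :=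
  (hη.differentiable (by simp) z.1).hasDerivAt.comp_hasFDerivAt z hasFDerivAt_fst

lemma pd_eT_mul (hη : ContDiff ℝ 1 η) (hF : ContDiff ℝ 1 F) (z : Pt d) :
    pd eT (fun z : Pt d => η z.1 * F z) z = deriv η z.1 * F z + η z.1 * pd eT F z := by
  have h1 := hasFDerivAt_comp_fst hη z
  rw [pd_mul h1.differentiableAt (hF.differentiable (by simp) z)]
  have : pd eT (fun z : Pt d => η z.1) z = deriv η z.1 := by
    rw [pd, h1.fderiv]; simp [eT]
  rw [this]; ring

lemma pd_eX_mul (hη : ContDiff ℝ 1 η) (hF : ContDiff ℝ 1 F) (i : Fin d) (z : Pt d) :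
    pd (eX i) (fun z : Pt d => η z.1 * F z) z = η z.1 * pd (eX i) F z := by
  have h1 := hasFDerivAt_comp_fst hη z
  rw [pd_mul h1.differentiableAt (hF.differentiable (by simp) z)]
  have : pd (eX i) (fun z : Pt d => η z.1) z = 0 := by
    rw [pd, h1.fderiv]; simp [eX]
  rw [this]; ring

lemma deriv_eq_zero_of_notMem (hs : ∀ t ∉ Icc a b, η t = 0) : ∀ t ∉ Icc a b, deriv η t = 0 := by
  intro t ht
  have : η =ᶠ[𝓝 t] fun _ => 0 := by
    filter_upwards [isClosed_Icc.isOpen_compl.mem_nhds ht] with s h2 using hs s h2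
  rw [this.deriv_eq]
  simp

variable {r : Pt d → ℝ} {u : Fin d → Pt d → ℝ}

/-- The vector field `∂ₜw + (u · ∇)w - Σᵢ wᵢ ∂ᵢu` with `w = ∇ log r`. -/
noncomputable def driftField (r : Pt d → ℝ) (u : Fin d → Pt d → ℝ) (j : Fin d) (z : Pt d) : ℝ :=
  pd eT (drift r j) z + ∑ i, u i z * pd (eX i) (drift r j) z
    - ∑ i, drift r i z * pd (eX i) (u j) z

lemma contDiff_driftField (hr : ContDiff ℝ ∞ r) (hpos : ∀ z, 0 < r z)
    (hu : ∀ i, ContDiff ℝ ∞ (u i)) (j : Fin d) : ContDiff ℝ ∞ (driftField r u j) := by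
  have hw := contDiff_drift hr hpos
  exact ((contDiff_pd (hw j) _).add (ContDiff.sum fun i _ => (hu i).mul (contDiff_pd (hw j) _))).sub
    (ContDiff.sum fun i _ => (hw i).mul (contDiff_pd (hu j) _))

lemma drift_symm (hr : ContDiff ℝ ∞ r) (hpos : ∀ z, 0 < r z) (i j : Fin d) (z : Pt d) :
    pd (eX j) (drift r i) z = pd (eX i) (drift r j) z :=
  pd_comm ((contDiff_log hr hpos).of_le two_le_infty) _ _ _

lemma pd_spaceDiv {W : Fin d → Pt d → ℝ} (hW : ∀ i, ContDiff ℝ ∞ (W i)) (v z : Pt d) :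
    pd v (spaceDiv W) z = ∑ i, pd (eX i) (pd v (W i)) z := by
  have e : spaceDiv W = fun z => ∑ i, pd (eX i) (W i) z := rfl
  rw [e, pd_sum _ fun i _ => (contDiff_pd (hW i) _).differentiable (by simp) z]
  exact Finset.sum_congr rfl fun i _ => pd_comm ((hW i).of_le two_le_infty) _ _ _

/-- Tested against q = ∇ρ, this field trades ρ(∂ₜ div w + u·∇ div w - w·∇ div u) for terms in q. The
two contractions of ∇u with ∇w are equal up to the order of the factors and cancel; they are kept
apart to match `relEnergy_identity`. -/
lemma sum_pd_driftField (hr : ContDiff ℝ ∞ r) (hpos : ∀ z, 0 < r z)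
    (hu : ∀ i, ContDiff ℝ ∞ (u i)) (z : Pt d) :
    ∑ j, pd (eX j) (driftField r u j) z = pd eT (spaceDiv (drift r)) z
      + ((∑ i, ∑ j, pd (eX j) (u i) z * pd (eX i) (drift r j) z)
          + ∑ i, u i z * pd (eX i) (spaceDiv (drift r)) z)
      - ((∑ i, ∑ j, pd (eX i) (drift r j) z * pd (eX j) (u i) z)
          + ∑ i, drift r i z * pd (eX i) (spaceDiv u) z) := by
  have hw := contDiff_drift hr hpos
  have dw := fun i => (hw i).differentiable (by simp) z
  have du := fun i => (hu i).differentiable (by simp) z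
  have dw' := fun i v => (contDiff_pd (hw i) v).differentiable (by simp) z
  have du' := fun i v => (contDiff_pd (hu i) v).differentiable (by simp) z
  have e : ∀ j, pd (eX j) (driftField r u j) z = pd (eX j) (pd eT (drift r j)) z
      + ∑ i, (u i z * pd (eX j) (pd (eX i) (drift r j)) z
        + pd (eX j) (u i) z * pd (eX i) (drift r j) z)
      - ∑ i, (drift r i z * pd (eX j) (pd (eX i) (u j)) z
        + pd (eX j) (drift r i) z * pd (eX i) (u j) z) := by
    intro j
    have e1 : driftField r u j = fun z => pd eT (drift r j) z
      + (∑ i, u i z * pd (eX i) (drift r j) z) - ∑ i, drift r i z * pd (eX i) (u j) z := rfl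
    have h1 : ∀ i ∈ Finset.univ, DifferentiableAt ℝ
        (fun z => u i z * pd (eX i) (drift r j) z) z := fun i _ => (du i).fun_mul (dw' j _)
    have h2 : ∀ i ∈ Finset.univ, DifferentiableAt ℝ
        (fun z => drift r i z * pd (eX i) (u j) z) z := fun i _ => (dw i).fun_mul (du' j _)
    rw [e1, pd_sub ((dw' j _).fun_add (DifferentiableAt.fun_sum h1)) (DifferentiableAt.fun_sum h2),
      pd_add (dw' j _) (DifferentiableAt.fun_sum h1), pd_sum _ h1, pd_sum _ h2]
    congr 1
    · congr 1
      exact Finset.sum_congr rfl fun i _ => pd_mul (du i) (dw' j _)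
    · exact Finset.sum_congr rfl fun i _ => pd_mul (dw i) (du' j _)
  simp only [e, Finset.sum_add_distrib, Finset.sum_sub_distrib, pd_spaceDiv hw, pd_spaceDiv hu,
    Finset.mul_sum]
  have s1 : ∑ j, ∑ i, u i z * pd (eX j) (pd (eX i) (drift r j)) z
      = ∑ i, ∑ j, u i z * pd (eX j) (pd (eX i) (drift r j)) z := Finset.sum_comm
  have s2 : ∑ j, ∑ i, drift r i z * pd (eX j) (pd (eX i) (u j)) z
      = ∑ i, ∑ j, drift r i z * pd (eX j) (pd (eX i) (u j)) z := Finset.sum_comm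
  have s3 : ∑ j, ∑ i, pd (eX j) (u i) z * pd (eX i) (drift r j) z
      = ∑ i, ∑ j, pd (eX j) (u i) z * pd (eX i) (drift r j) z := Finset.sum_comm
  have s4 : ∑ j, ∑ i, pd (eX j) (drift r i) z * pd (eX i) (u j) z
      = ∑ i, ∑ j, pd (eX i) (drift r j) z * pd (eX j) (u i) z := rfl
  rw [s1, s2, s3, s4]
  ring

variable {h : ℝ → ℝ} {γ k A : ℝ} {ρ : ℝ → Sp d → ℝ} {q : ℝ → Sp d → Sp d}
  {l : ℝ → Sp d → ℝ} {m : ℝ → Sp d → Sp d}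

/-- The contribution of the residuals of an approximate strong solution to the relative energy
inequality. -/
noncomputable def residualTerm (h : ℝ → ℝ) (ρ : ℝ) (m q : Fin d → ℝ) (r : Pt d → ℝ)
    (u : Fin d → Pt d → ℝ) (z : Pt d) : ℝ :=
  (∑ j, m j * momentumResidual h r u j z) - ρ * (∑ j, u j z * momentumResidual h r u j z)
    + r z * deriv (deriv h) (r z) * (ρ - r z) * massResidual r u z
    + (∑ j, q j * pd (eX j) (massResidual r u) z)
    - ρ * ∑ j, drift r j z * pd (eX j) (massResidual r u) z

lemma integral_energy_mul_deriv_nonneg (S : IsDissipativeWeakSolution h ρ q l m)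
    (hη : ContDiff ℝ 1 η) (hs : ∀ t ∉ Icc a b, η t = 0) (hpos : ∀ t, 0 ≤ η t) (ha : 0 < a) :
    0 ≤ ∫ z in Ici 0 ×ˢ cell d,
      energy h (ρ z.1 z.2) (q z.1 z.2) (m z.1 z.2) * deriv η z.1 := by
  have hc : HasCompactSupport η := HasCompactSupport.intro isCompact_Icc hs
  obtain ⟨K, hK⟩ := hη.lipschitzWith_of_hasCompactSupport hc (by simp)
  have h1 := S.dissipation η ⟨K, hK⟩ (fun t _ => hpos t)
    ⟨b + 1, fun t ht => hs t fun h => by linarith [h.2]⟩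
  have h0 : η 0 = 0 := hs 0 fun h => absurd h.1 (not_le.2 ha)
  simp only [h0, mul_zero, integral_zero] at h1
  linarith

/-- The relative energy identity for a smooth comparison state `(r, u)`, in terms of the integrands of
the weak equations. -/
lemma relEnergy_identity_of_contDiff (H : InternalEnergy h γ k A) (hr : ContDiff ℝ ∞ r)
    (hpos : ∀ z, 0 < r z) (hu : ∀ i, ContDiff ℝ ∞ (u i)) (hη : ContDiff ℝ ∞ η) (z : Pt d)
    (e ρ l : ℝ) (m q : Sp d) :
    -deriv η z.1 * expandedRelEnergy h e ρ m q (r z) (fun i => u i z) (fun i => drift r i z)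
      + η z.1 * relFlux h ρ m q (r z) (fun i => u i z) (fun i => drift r i z)
          (fun i j => pd (eX j) (u i) z)
      + η z.1 * residualTerm h ρ m q r u z
    = -(e * deriv η z.1)
      + ((∑ i, m i * pd eT (fun z : Pt d => η z.1 * u i z) z)
        + (∑ i, ∑ j, m i * m j / ρ * pd (eX j) (fun z : Pt d => η z.1 * u i z) z)
        - ∑ i, ∑ j, stress h ρ q l i j * pd (eX j) (fun z : Pt d => η z.1 * u i z) z)
      - (ρ * pd eT (fun z : Pt d => η z.1
            * ((∑ i, 1 / 2 * (u i z * u i z)) - smoothPotential h r z)) z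
          + ∑ i, m i * pd (eX i) (fun z : Pt d => η z.1
            * ((∑ i, 1 / 2 * (u i z * u i z)) - smoothPotential h r z)) z)
      - pd eT (fun z : Pt d => η z.1 * pressure h (r z)) z
      - ∑ i, pd (eX i) (fun z : Pt d => η z.1 * (pressure h (r z) * u i z)) z
      + ((∑ i, q i * pd (eX i) (fun z : Pt d => η z.1 * spaceDiv u z) z)
        + l * (η z.1 * spaceDiv u z))
      + ∑ j, (ρ * pd (eX j) (fun z : Pt d => deriv η z.1 * drift r j z) z
        + q j * (deriv η z.1 * drift r j z))
      + ∑ j, (ρ * pd (eX j) (fun z : Pt d => η z.1 * driftField r u j z) z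
        + q j * (η z.1 * driftField r u j z)) := by
  have hη1 : ContDiff ℝ 1 η := hη.of_le (by simp)
  have hη1' : ContDiff ℝ 1 (deriv η) := ((contDiff_infty_iff_deriv.1 hη).2).of_le (by simp)
  have c1 : ∀ {G : Pt d → ℝ}, ContDiff ℝ ∞ G → ContDiff ℝ 1 G := fun hG => hG.of_le (by simp)
  have hw := contDiff_drift hr hpos
  have sμ := contDiff_smoothPotential H hr hpos
  have sP : ContDiff ℝ 1 fun z => pressure h (r z) :=
    (contDiff_pressure_comp H hr hpos).of_le (by norm_num)
  have sB : ContDiff ℝ 1 fun z => (∑ i, 1 / 2 * (u i z * u i z)) - smoothPotential h r z :=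
    (ContDiff.sum fun i _ => contDiff_const.mul
      ((c1 (hu i)).mul (c1 (hu i)))).sub (sμ.of_le (by norm_num))
  have du := fun i => (hu i).differentiable (by simp) z
  -- All derivatives of r are expressed through log r, the variable of the algebraic identity.
  have hrv : ∀ v, pd v r z = r z * pd v (fun z => Real.log (r z)) z := fun v => by
    rw [pd_log hr hpos, mul_inv_cancel_left₀ (hpos z).ne']
  have hrx : ∀ i, pd (eX i) r z = r z * drift r i z := fun i => hrv _
  have dB : ∀ v, pd v (fun z => (∑ i, 1 / 2 * (u i z * u i z)) - smoothPotential h r z) z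
      = (∑ i, u i z * pd v (u i) z) - pd v (smoothPotential h r) z := by
    intro v
    have h1 : ∀ i ∈ Finset.univ, DifferentiableAt ℝ (fun z => 1 / 2 * (u i z * u i z)) z :=
      fun i _ => ((du i).fun_mul (du i)).const_mul _
    rw [pd_sub (DifferentiableAt.fun_sum h1) (sμ.differentiable (by norm_num) z), pd_sum _ h1]
    congr 1
    refine Finset.sum_congr rfl fun i _ => ?_
    rw [pd_mul (differentiableAt_const _) ((du i).fun_mul (du i)), pd_mul (du i) (du i)]
    have : pd v (fun _ : Pt d => (1 / 2 : ℝ)) z = 0 := by simp [pd]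
    rw [this]
    ring
  have ddiv : ∀ {W : Fin d → Pt d → ℝ}, (∀ i, ContDiff ℝ ∞ (W i)) → ∀ v,
      ∑ i, pd v (pd (eX i) (W i)) z = pd v (spaceDiv W) z := fun hW v => by
    rw [pd_spaceDiv hW]
    exact Finset.sum_congr rfl fun i _ => pd_comm ((hW i).of_le two_le_infty) _ _ _
  have dP : ∀ v, pd v (fun z => pressure h (r z)) z
      = r z * deriv (deriv h) (r z) * pd v r z := fun v =>
    pd_comp (H.hasDerivAt_pressure (hpos z)) (hr.differentiable (by simp) z)
  have dPu : ∀ i, pd (eX i) (fun z => pressure h (r z) * u i z) z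
      = pressure h (r z) * pd (eX i) (u i) z
        + r z * deriv (deriv h) (r z) * (r z * drift r i z) * u i z := fun i => by
    rw [pd_mul (sP.differentiable (by simp) z) (du i), dP, hrx]
  have e1 : ∀ j, momentumResidual h r u j z = pd eT (u j) z + ∑ i, u i z * pd (eX i) (u j) z
      + (deriv (deriv h) (r z) * (r z * drift r j z) - ∑ i, drift r i z * pd (eX j) (drift r i) z
        - pd (eX j) (spaceDiv (drift r)) z) := fun j => by
    rw [momentumResidual, pd_smoothPotential H hr hpos, hrx, ddiv hw]
  have e2 : ∀ j, pd (eX j) (massResidual r u) z = pd eT (drift r j) z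
      + ∑ i, (u i z * pd (eX j) (drift r i) z + pd (eX j) (u i) z * drift r i z)
      + pd (eX j) (spaceDiv u) z := fun j => by
    rw [pd_massResidual hr hpos hu, ddiv hu,
      pd_comm ((contDiff_log hr hpos).of_le two_le_infty)]
    rfl
  have key := relEnergy_identity h e ρ l (r z) (η z.1) (deriv η z.1)
    (pd eT (fun z => Real.log (r z)) z) m q (fun i => u i z) (fun i => drift r i z)
    (fun i => pd eT (u i) z) (fun i => pd eT (drift r i) z)
    (fun j => pd (eX j) (spaceDiv (drift r)) z) (fun j => pd (eX j) (spaceDiv u) z)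
    (fun i j => pd (eX j) (u i) z) (fun i j => pd (eX j) (drift r i) z)
    (pd eT (spaceDiv (drift r)) z) (deriv h (r z)) (deriv (deriv h) (r z))
    (fun i j => drift_symm hr hpos i j z) rfl rfl
  rw [residualTerm, massResidual]
  simp only [e1, e2]
  refine (Eq.trans ?_ key).trans ?_
  · simp only [spaceDiv]
  · have sdu : ContDiff ℝ 1 (spaceDiv u) := c1 (contDiff_spaceDiv hu)
    have sV := fun j => c1 (contDiff_driftField hr hpos hu j)
    simp only [pd_eT_mul hη1 (c1 (hu _)), pd_eX_mul hη1 (c1 (hu _)), pd_eT_mul hη1 sB,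
      pd_eX_mul hη1 sB, pd_eT_mul hη1 sP, pd_eX_mul hη1 (sP.mul (c1 (hu _))),
      pd_eX_mul hη1 sdu, pd_eX_mul hη1' (c1 (hw _)), pd_eX_mul hη1 (sV _), dB, dP, dPu,
      pd_smoothPotential H hr hpos, ddiv hw, hrv, stress]
    -- The two tests of the weak gradient, with η'w and with ηV, are merged into the single block of
    -- the algebraic identity.
    have x1 : ∑ j, (ρ * (deriv η z.1 * pd (eX j) (drift r j) z) + q j * (deriv η z.1 * drift r j z))
        + ∑ j, (ρ * (η z.1 * pd (eX j) (driftField r u j) z) + q j * (η z.1 * driftField r u j z))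
        = ρ * (deriv η z.1 * (∑ i, pd (eX i) (drift r i) z)
            + η z.1 * ∑ j, pd (eX j) (driftField r u j) z)
          + ∑ j, q j * (deriv η z.1 * drift r j z + η z.1 * pd eT (drift r j) z
            + η z.1 * (∑ i, u i z * pd (eX i) (drift r j) z)
            - η z.1 * ∑ i, drift r i z * pd (eX i) (u j) z) := by
      have e : ∀ j, η z.1 * pd eT (drift r j) z + η z.1 * (∑ i, u i z * pd (eX i) (drift r j) z)
          - η z.1 * ∑ i, drift r i z * pd (eX i) (u j) z = η z.1 * driftField r u j z := fun j => by
        rw [driftField]; ring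
      simp only [add_assoc, add_sub_assoc] at e ⊢
      simp only [e]
      rw [Finset.mul_sum, Finset.mul_sum, ← Finset.sum_add_distrib, ← Finset.sum_add_distrib,
        Finset.mul_sum, ← Finset.sum_add_distrib]
      exact Finset.sum_congr rfl fun i _ => by ring
    rw [add_assoc _ (∑ j, _) (∑ j, _), x1, sum_pd_driftField hr hpos hu]
    have x2 : (∑ i, 1 / 2 * (u i z * u i z)) - smoothPotential h r z
        = 1 / 2 * (∑ i, u i z ^ 2) + 1 / 2 * (∑ i, drift r i z ^ 2) - deriv h (r z)
          + ∑ i, pd (eX i) (drift r i) z := by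
      simp only [smoothPotential, spaceDiv, ← Finset.mul_sum, ← pow_two]
      ring
    have x3 : ∑ i, η z.1 * (pressure h (r z) * pd (eX i) (u i) z
        + r z * deriv (deriv h) (r z) * (r z * drift r i z) * u i z)
        = η z.1 * ∑ i, (pressure h (r z) * pd (eX i) (u i) z
        + r z * deriv (deriv h) (r z) * (r z * drift r i z) * u i z) := Finset.mul_sum .. |>.symm
    rw [x2, x3]
    have x4 : ∀ i, pd (eX i) (fun z => Real.log (r z)) z = drift r i z := fun _ => rfl
    have x5 : ∀ a b c e : ℝ, a - (b - c - e) = a + c - b + e := fun a b c e => by ring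
    simp only [x4, x5]
    have x6 : spaceDiv u z = ∑ i, pd (eX i) (u i) z := rfl
    rw [x6]
    ring

/-- The relative energy inequality between a dissipative weak solution and a smooth state. -/
lemma integral_relEnergy_inequality (S : IsDissipativeWeakSolution h ρ q l m)
    (H : InternalEnergy h γ k A) (hr : ContDiff ℝ ∞ r) (hpos : ∀ z, 0 < r z)
    (hu : ∀ i, ContDiff ℝ ∞ (u i)) (pr : SpacePeriodic r) (pu : ∀ i, SpacePeriodic (u i))
    (hη : ContDiff ℝ ∞ η) (hs : ∀ t ∉ Icc a b, η t = 0) (hη0 : ∀ t, 0 ≤ η t) (ha : 0 < a)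
    {M : ℝ} (hM : 0 ≤ M) (hux : ∀ z : Pt d, z.1 ∈ Icc a b → ∀ i j, |pd (eX j) (u i) z| ≤ M)
    {f : Pt d → ℝ}
    (hf : ∀ z, f z = (-deriv η z.1 - d * M * (2 + A) * η z.1)
        * expandedRelEnergy h (energy h (ρ z.1 z.2) (q z.1 z.2) (m z.1 z.2)) (ρ z.1 z.2)
          (m z.1 z.2) (q z.1 z.2) (r z) (fun i => u i z) (fun i => drift r i z)
      + η z.1 * residualTerm h (ρ z.1 z.2) (m z.1 z.2) (q z.1 z.2) r u z)
    (hint : IntegrableOn f (Ici 0 ×ˢ cell d)) : ∫ z in Ici 0 ×ˢ cell d, f z ≤ 0 := by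
  have hη1 : ContDiff ℝ 1 η := hη.of_le (by simp)
  have hη' : ContDiff ℝ ∞ (deriv η) := (contDiff_infty_iff_deriv.1 hη).2
  have hη1' : ContDiff ℝ 1 (deriv η) := hη'.of_le (by simp)
  have hs' := deriv_eq_zero_of_notMem hs
  have hw := contDiff_drift hr hpos
  have c1 : ∀ {G : Pt d → ℝ}, ContDiff ℝ ∞ G → ContDiff ℝ 1 G := fun hG => hG.of_le (by simp)
  have pw : ∀ i, SpacePeriodic (drift r i) := fun i => by
    refine spacePeriodic_pd (fun t j x => ?_) _
    have := pr t j x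
    simp only at this ⊢
    rw [this]
  have pdiv : ∀ {W : Fin d → Pt d → ℝ}, (∀ i, SpacePeriodic (W i)) → SpacePeriodic (spaceDiv W) :=
    fun hW t j x => Finset.sum_congr rfl fun i _ => spacePeriodic_pd (hW i) (eX i) t j x
  have pμ : SpacePeriodic (smoothPotential h r) := fun t j x => by
    have h1 := pr t j x
    have h2 := fun i => pw i t j x
    have h3 := pdiv pw t j x
    simp only at h1 h2 h3
    simp only [smoothPotential, h1, h2, h3]
  have sμ := contDiff_smoothPotential H hr hpos
  have sP := contDiff_pressure_comp H hr hpos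
  have pP : SpacePeriodic fun z => pressure h (r z) := fun t j x => by
    have := pr t j x
    simp only at this ⊢
    rw [this]
  -- the test functions
  set B : Pt d → ℝ := fun z => (∑ i, 1 / 2 * (u i z * u i z)) - smoothPotential h r z with hB
  have sB : ContDiff ℝ 1 B := (ContDiff.sum fun i _ => contDiff_const.mul
    ((c1 (hu i)).mul (c1 (hu i)))).sub (sμ.of_le (by norm_num))
  have pB : SpacePeriodic B := fun t j x => by
    have h1 := fun i => pu i t j x
    have h2 := pμ t j x
    simp only at h1 h2
    simp only [hB, h1, h2]
  have pV : ∀ j, SpacePeriodic (driftField r u j) := fun j t k x => by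
    have h1 := fun i => pu i t k x
    have h2 := fun i => pw i t k x
    have h3 := fun v i => spacePeriodic_pd (pw i) v t k x
    have h4 := fun v i => spacePeriodic_pd (pu i) v t k x
    simp only at h1 h2 h3 h4
    simp only [driftField, h1, h2, h3, h4]
  have sV := contDiff_driftField hr hpos hu
  have t1 := fun i => isCutoff_mul (a := a) (b := b) hη1 hs (c1 (hu i)) (pu i)
  have t2 := isCutoff_mul (a := a) (b := b) hη1 hs sB pB
  have t3 := isCutoff_mul (a := a) (b := b) hη1 hs (sP.of_le (by norm_num)) pP
  have t4 := fun i => isCutoff_mul (a := a) (b := b) (F := fun z => pressure h (r z) * u i z) hη1 hs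
    ((sP.of_le (by norm_num)).mul (c1 (hu i))) (fun t j x => by
      have h1 := pu i t j x
      have h2 := pP t j x
      simp only at h1 h2 ⊢
      rw [h1, h2])
  have t5 := fun j => isCutoff_mul (a := a) (b := b) hη1' hs' (c1 (hw j)) (pw j)
  have t6 := fun j => isCutoff_mul (a := a) (b := b) hη1 hs (c1 (sV j)) (pV j)
  have t7 := isCutoff_mul (a := a) (b := b) hη1 hs (c1 (contDiff_spaceDiv hu)) (pdiv pu)
  have sη : ContDiff ℝ ∞ fun z : Pt d => η z.1 := hη.comp contDiff_fst
  have sη' : ContDiff ℝ ∞ fun z : Pt d => deriv η z.1 := hη'.comp contDiff_fst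
  -- the weak equations
  have E1 := integral_energy_mul_deriv_nonneg S hη1 hs hη0 ha
  have E2 := S.integral_momentum ha t1
  have E3 := S.integral_mass ha t2
  have E4 := t3.integral_pd_eT ha
  have E4' := fun i => (t4 i).integral_pd_eX i
  have E5 := fun j => S.integral_grad H (t5 j) (sη'.mul (hw j)) j
  have E6 := fun j => S.integral_grad H (t6 j) (sη.mul (sV j)) j
  have E7 := S.integral_laplacian H ha t7 (sη.mul (contDiff_spaceDiv hu))
  -- integrability
  have iρ := S.cont_ρ.integrableOn b
  have im := fun i => (S.cont_m.component i).integrableOn b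
  have iq : ∀ i, IntegrableOn (fun z : Pt d => q z.1 z.2 i) (Icc 0 b ×ˢ cell d) := fun i =>
    (EuclideanSpace.proj (𝕜 := ℝ) i).integrable_comp (S.integrableOn_q H b)
  have wt : ∀ {W Φ : Pt d → ℝ}, IntegrableOn W (Icc 0 b ×ˢ cell d) → IsCutoff a b Φ →
      IntegrableOn (fun z => W z * Φ z) (Ici 0 ×ˢ cell d) := fun hW hΦ =>
    integrableOn_cutoff_mul hW le_rfl hΦ.contDiff.continuous hΦ.support
  have wd : ∀ {W Φ : Pt d → ℝ} (v : Pt d), IntegrableOn W (Icc 0 b ×ˢ cell d) → IsCutoff a b Φ →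
      IntegrableOn (fun z => W z * pd v Φ z) (Ici 0 ×ˢ cell d) := fun v hW hΦ =>
    integrableOn_cutoff_mul hW le_rfl (continuous_pd hΦ.contDiff (by simp) v)
      fun _ => pd_eq_zero_of_notMem hΦ.support v
  have I1 : IntegrableOn (fun z => energy h (ρ z.1 z.2) (q z.1 z.2) (m z.1 z.2) * deriv η z.1)
      (Ici 0 ×ˢ cell d) :=
    integrableOn_cutoff_mul (S.cont_energy.integrableOn b) le_rfl sη'.continuous
      fun z hz => hs' z.1 hz
  have I2 := ((integrable_finsetSum Finset.univ fun i _ => wd eT (im i) (t1 i)).add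
    (integrable_finsetSum Finset.univ fun i _ => integrable_finsetSum Finset.univ fun j _ =>
      wd (eX j) (S.int_flux i j b) (t1 i))).sub
    (integrable_finsetSum Finset.univ fun i _ => integrable_finsetSum Finset.univ fun j _ =>
      wd (eX j) (S.int_stress i j b) (t1 i))
  have I3 := (wd eT iρ t2).add (integrable_finsetSum Finset.univ fun i _ => wd (eX i) (im i) t2)
  have I4 := t3.integrableOn_pd eT
  have I4' := integrable_finsetSum Finset.univ fun i _ => (t4 i).integrableOn_pd (eX i)
  have I5 := integrable_finsetSum Finset.univ fun j _ =>
    (wd (eX j) iρ (t5 j)).add (wt (iq j) (t5 j))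
  have I6 := integrable_finsetSum Finset.univ fun j _ =>
    (wd (eX j) iρ (t6 j)).add (wt (iq j) (t6 j))
  have I7 := (integrable_finsetSum Finset.univ fun i _ => wd (eX i) (iq i) t7).add
    (wt (S.int_l b) t7)
  -- Almost everywhere f lies below the sum of the tested integrands. All of these integrate to
  -- zero, except minus the energy term, whose integral is nonpositive.
  refine (integral_mono_ae hint
    (((((((I1.neg.add I2).sub I3).sub I4).sub I4').add I7).add I5).add I6) ?_).trans ?_
  · filter_upwards [S.ae_nonneg, S.ae_vacuum_m, S.ae_vacuum_q] with z z1 z2 z3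
    have key := relEnergy_identity_of_contDiff H hr hpos hu hη z
      (energy h (ρ z.1 z.2) (q z.1 z.2) (m z.1 z.2)) (ρ z.1 z.2) (l z.1 z.2) (m z.1 z.2) (q z.1 z.2)
    refine le_trans ?_ key.le
    rw [hf]
    by_cases hz : z.1 ∈ Icc a b
    -- Only the lower bound of the remainder is used, multiplied by the nonnegative cutoff. Outside
    -- [a,b], where ∇u is not controlled, the cutoff vanishes.
    · have h1 := abs_relFlux_le H (u := fun i => u i z) (w := fun i => drift r i z)
        (ux := fun i j => pd (eX j) (u i) z) z1 (hpos z) z2 z3 (hux z hz) hM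
      have h2 := mul_le_mul_of_nonneg_left (abs_le.1 h1).1 (hη0 z.1)
      linarith
    · rw [hs _ hz]
      linarith
  have z4 : ∫ z in Ici 0 ×ˢ cell d, ∑ i, pd (eX i) (fun z => η z.1 * (pressure h (r z) * u i z)) z
      = 0 := by
    rw [integral_finsetSum _ fun i _ => (t4 i).integrableOn_pd (eX i)]
    exact Finset.sum_eq_zero fun i _ => E4' i
  have z5 : ∀ Φ : Fin d → Pt d → ℝ, (∀ j, IsCutoff a b (Φ j)) →
      (∀ j, ∫ z in Ici 0 ×ˢ cell d, (ρ z.1 z.2 * pd (eX j) (Φ j) z + q z.1 z.2 j * Φ j z) = 0) →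
      ∫ z in Ici 0 ×ˢ cell d, ∑ j, (ρ z.1 z.2 * pd (eX j) (Φ j) z + q z.1 z.2 j * Φ j z) = 0 := by
    intro Φ hΦ hE
    refine (integral_finsetSum _ fun j _ => (wd (eX j) iρ (hΦ j)).add (wt (iq j) (hΦ j))).trans ?_
    exact Finset.sum_eq_zero fun j _ => hE j
  have z1 := integral_add ((((((I1.neg.add I2).sub I3).sub I4).sub I4').add I7).add I5) I6
  have z2 := integral_add (((((I1.neg.add I2).sub I3).sub I4).sub I4').add I7) I5
  have z3 := integral_add ((((I1.neg.add I2).sub I3).sub I4).sub I4') I7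
  have z6 := integral_sub (((I1.neg.add I2).sub I3).sub I4) I4'
  have z7 := integral_sub ((I1.neg.add I2).sub I3) I4
  have z8 := integral_sub (I1.neg.add I2) I3
  have z9 := integral_add I1.neg I2
  have z10 := integral_neg (μ := volume.restrict (Ici 0 ×ˢ cell d))
    (fun z : Pt d => energy h (ρ z.1 z.2) (q z.1 z.2) (m z.1 z.2) * deriv η z.1)
  have w5 := z5 _ t5 E5
  have w6 := z5 _ t6 E6
  simp only [Pi.add_apply, Pi.sub_apply, Pi.neg_apply] at z1 z2 z3 z6 z7 z8 z9 z10 ⊢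
  rw [z1, z2, z3, z6, z7, z8, z9, z10]
  linarith

end RelativeEnergyInequality

/-! ### From smooth states to the strong solution. -/

section PassageToLimit

variable {d : ℕ} {T a b : ℝ} {c : ℝ → ℝ} {G G' : ℕ → Pt d → ℝ} {g g' : Pt d → ℝ}

lemma BAC.integrableOn_mul {F : ℕ → Pt d → ℝ} {f W : Pt d → ℝ} {I : Set ℝ} (h : BAC T F f)
    (hF : ∀ n, Continuous (F n)) (ha : 0 < a) (hb : b < T) (hI : MeasurableSet I)
    (hW : IntegrableOn W (I ×ˢ cell d)) (hWs : ∀ z : Pt d, z.1 ∉ Icc a b → W z = 0) :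
    IntegrableOn (fun z => W z * f z) (I ×ˢ cell d) := by
  have hm : MeasurableSet ((I ∩ Icc a b) ×ˢ cell d) :=
    (hI.inter measurableSet_Icc).prod measurableSet_cell
  have hsub : (I ∩ Icc a b) ×ˢ cell d ⊆ Ioo 0 T ×ˢ univ := fun z hz =>
    ⟨⟨ha.trans_le hz.1.2.1, hz.1.2.2.trans_lt hb⟩, trivial⟩
  have h1 : IntegrableOn (fun z => W z * f z) ((I ∩ Icc a b) ×ˢ cell d) := by
    obtain ⟨C, hC⟩ := h.bdd_lim
    refine Integrable.mul_bdd (c := C) (hW.mono_set (prod_mono inter_subset_left subset_rfl))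
      ((h.aestronglyMeasurable hF).mono_measure (Measure.restrict_mono hsub le_rfl)) ?_
    rw [ae_restrict_iff' hm]
    filter_upwards [hC] with z hz hzm using hz (hsub hzm).1
  refine h1.of_forall_sdiff_eq_zero (hI.prod measurableSet_cell) fun z hz => ?_
  rw [hWs z fun h2 => hz.2 ⟨⟨hz.1.1, h2⟩, hz.1.2⟩, zero_mul]

/-- The integrals of `c(t) Gₙ` over space-time exist and converge to the integral of `c(t) g`. -/
structure ConvInt (c : ℝ → ℝ) (G : ℕ → Pt d → ℝ) (g : Pt d → ℝ) : Prop where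
  int : ∀ n, IntegrableOn (fun z => c z.1 * G n z) (Ici 0 ×ˢ cell d)
  int_lim : IntegrableOn (fun z => c z.1 * g z) (Ici 0 ×ˢ cell d)
  lim : Tendsto (fun n => ∫ z in Ici 0 ×ˢ cell d, c z.1 * G n z) atTop
    (𝓝 (∫ z in Ici 0 ×ˢ cell d, c z.1 * g z))

lemma ConvInt.add (h : ConvInt c G g) (h' : ConvInt c G' g') :
    ConvInt c (fun n z => G n z + G' n z) fun z => g z + g' z := by
  refine ⟨fun n => ?_, ?_, ?_⟩ <;> simp only [mul_add]
  · exact (h.int n).add (h'.int n)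
  · exact h.int_lim.add h'.int_lim
  · rw [integral_add h.int_lim h'.int_lim]
    simp only [fun n => integral_add (h.int n) (h'.int n)]
    exact h.lim.add h'.lim

lemma ConvInt.sub (h : ConvInt c G g) (h' : ConvInt c G' g') :
    ConvInt c (fun n z => G n z - G' n z) fun z => g z - g' z := by
  refine ⟨fun n => ?_, ?_, ?_⟩ <;> simp only [mul_sub]
  · exact (h.int n).sub (h'.int n)
  · exact h.int_lim.sub h'.int_lim
  · rw [integral_sub h.int_lim h'.int_lim]
    simp only [fun n => integral_sub (h.int n) (h'.int n)]
    exact h.lim.sub h'.lim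

lemma ConvInt.sum {ι : Type*} (s : Finset ι) {G : ι → ℕ → Pt d → ℝ} {g : ι → Pt d → ℝ}
    (h : ∀ i, ConvInt c (G i) (g i)) :
    ConvInt c (fun n z => ∑ i ∈ s, G i n z) fun z => ∑ i ∈ s, g i z := by
  classical
  induction s using Finset.induction_on with
  | empty => exact ⟨fun n => by simp, by simp, by simp⟩
  | insert i s hi ih =>
    simp only [Finset.sum_insert hi]
    exact (h i).add ih

/-- The weight X carries the weak solution and is merely integrable; boundedness is required of the
coefficients alone. The time cutoff confines everything to a compact subinterval of (0,T), where the
convergence is bounded. -/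
lemma BAC.convInt {F : ℕ → Pt d → ℝ} {f : Pt d → ℝ} (h : BAC T F f)
    (hF : ∀ n, Continuous (F n)) (ha : 0 < a) (hb : b < T) (hc : Continuous c)
    (hs : ∀ t ∉ Icc a b, c t = 0) {X : Pt d → ℝ} (hX : IntegrableOn X (Icc 0 b ×ˢ cell d)) :
    ConvInt c (fun n z => X z * F n z) fun z => X z * f z := by
  have hcc : Continuous fun z : Pt d => c z.1 := hc.comp continuous_fst
  have hW := integrableOn_cutoff_mul hX le_rfl hcc fun z hz => hs z.1 hz
  have hWs : ∀ z : Pt d, z.1 ∉ Icc a b → X z * c z.1 = 0 := fun z hz => by rw [hs _ hz, mul_zero]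
  have e : ∀ (z : Pt d) (y : ℝ), c z.1 * (X z * y) = X z * c z.1 * y := fun z y => by ring
  refine ⟨fun n => ?_, ?_, ?_⟩ <;> simp only [e]
  · have := integrableOn_cutoff_mul (c := fun z : Pt d => c z.1 * F n z) hX le_rfl
      (hcc.mul (hF n)) fun z hz => by rw [hs z.1 hz, zero_mul]
    simpa only [mul_assoc] using this
  · exact h.integrableOn_mul hF ha hb measurableSet_Ici hW hWs
  · exact h.tendsto_integral hF ha hb hW hWs

variable {h : ℝ → ℝ} {γ k A M : ℝ} {ρ : ℝ → Sp d → ℝ} {q : ℝ → Sp d → Sp d}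
  {l : ℝ → Sp d → ℝ} {m : ℝ → Sp d → Sp d} {ρb : ℝ → Sp d → ℝ} {ub ρx : ℝ → Sp d → Sp d}
  {R : ℕ → Pt d → ℝ} {U : ℕ → Fin d → Pt d → ℝ} {η : ℝ → ℝ}

/-- The relative energy inequality between a dissipative weak solution and a strong solution. -/
lemma IsApproximation.integral_relEnergy_le (P : IsApproximation h T M ρb ub ρx R U)
    (S : IsDissipativeWeakSolution h ρ q l m) (H : InternalEnergy h γ k A)
    (hη : ContDiff ℝ ∞ η) (hs : ∀ t ∉ Icc a b, η t = 0) (hη0 : ∀ t, 0 ≤ η t) (ha : 0 < a)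
    (hb : b < T) :
    IntegrableOn (fun z : Pt d => (-deriv η z.1 - d * |M| * (2 + A) * η z.1)
        * expandedRelEnergy h (energy h (ρ z.1 z.2) (q z.1 z.2) (m z.1 z.2)) (ρ z.1 z.2)
          (m z.1 z.2) (q z.1 z.2) (ρb z.1 z.2) (ub z.1 z.2)
          fun i => (ρb z.1 z.2)⁻¹ * ρx z.1 z.2 i) (Ici 0 ×ˢ cell d) ∧
    ∫ z in Ici 0 ×ˢ cell d, (-deriv η z.1 - d * |M| * (2 + A) * η z.1)
        * expandedRelEnergy h (energy h (ρ z.1 z.2) (q z.1 z.2) (m z.1 z.2)) (ρ z.1 z.2)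
          (m z.1 z.2) (q z.1 z.2) (ρb z.1 z.2) (ub z.1 z.2)
          (fun i => (ρb z.1 z.2)⁻¹ * ρx z.1 z.2 i) ≤ 0 := by
  obtain ⟨c₀, C₀, hc₀, hrange⟩ := P.range_R
  have hpos : ∀ n z, 0 < R n z := fun n z => hc₀.trans_le (hrange n z).1
  have hsub : Icc c₀ C₀ ⊆ Ioi 0 := fun x hx => hc₀.trans_le hx.1
  have cR := fun n => (P.contDiff_R n).continuous
  have cU := fun n i => (P.contDiff_U n i).continuous
  have cW := fun n i => (contDiff_drift (P.contDiff_R n) (hpos n) i).continuous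
  have cN := fun n => contDiff_massResidual (P.contDiff_R n) (hpos n) (P.contDiff_U n)
  have cNx := fun n j => (contDiff_pd (cN n) (eX j)).continuous
  have cP : ∀ n j, Continuous (momentumResidual h (R n) (U n) j) := fun n j =>
    ((contDiff_pd (P.contDiff_U n j) _).continuous.add (continuous_finsetSum _ fun i _ =>
      (cU n i).mul (contDiff_pd (P.contDiff_U n j) _).continuous)).add
      (continuous_pd (contDiff_smoothPotential H (P.contDiff_R n) (hpos n)) (by norm_num) _)
  have ch1 := fun n => (contDiff_deriv_comp H (P.contDiff_R n) (hpos n)).continuous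
  have cp := fun n => (contDiff_pressure_comp H (P.contDiff_R n) (hpos n)).continuous
  have ch2 : ∀ n, Continuous fun z => deriv (deriv h) (R n z) := fun n =>
    H.contDiffOn_deriv2.continuousOn.comp_continuous (cR n) fun z => hpos n z
  have lh1 : BAC T (fun n z => deriv h (R n z)) fun z => deriv h (ρb z.1 z.2) :=
    P.lim_R.comp (H.contDiffOn_deriv.continuousOn.mono hsub) hrange
  have lh2 : BAC T (fun n z => deriv (deriv h) (R n z)) fun z => deriv (deriv h) (ρb z.1 z.2) :=
    P.lim_R.comp (H.contDiffOn_deriv2.continuousOn.mono hsub) hrange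
  have lp : BAC T (fun n z => pressure h (R n z)) fun z => pressure h (ρb z.1 z.2) :=
    P.lim_R.comp (H.contDiffOn_pressure.continuousOn.mono hsub) hrange
  -- the weights
  have iρ := S.cont_ρ.integrableOn b
  have ie := S.cont_energy.integrableOn b
  have im := fun i => (S.cont_m.component i).integrableOn b
  have iq : ∀ i, IntegrableOn (fun z : Pt d => q z.1 z.2 i) (Icc 0 b ×ˢ cell d) := fun i =>
    (EuclideanSpace.proj (𝕜 := ℝ) i).integrable_comp (S.integrableOn_q H b)
  have i1 : IntegrableOn (fun _ : Pt d => (1 : ℝ)) (Icc 0 b ×ˢ cell d) :=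
    (continuousOn_const.integrableOn_compact
      ((isCompact_Icc (a := (0 : ℝ)) (b := b)).prod (isCompact_box (d := d)))).mono_set
      (prod_mono subset_rfl cell_subset_box)
  have hη' : Continuous (deriv η) := hη.continuous_deriv (by simp)
  have hs' := deriv_eq_zero_of_notMem hs
  set κ : ℝ → ℝ := fun t => -deriv η t - d * |M| * (2 + A) * η t with hκ
  have cκ : Continuous κ := hη'.neg.sub (continuous_const.mul hη.continuous)
  have sκ : ∀ t ∉ Icc a b, κ t = 0 := fun t ht => by simp [hκ, hs t ht, hs' t ht]
  -- the relative energy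
  have lE : ConvInt κ (fun n z => expandedRelEnergy h (energy h (ρ z.1 z.2) (q z.1 z.2) (m z.1 z.2))
        (ρ z.1 z.2) (m z.1 z.2) (q z.1 z.2) (R n z) (fun i => U n i z) fun i => drift (R n) i z)
      fun z => expandedRelEnergy h (energy h (ρ z.1 z.2) (q z.1 z.2) (m z.1 z.2)) (ρ z.1 z.2)
        (m z.1 z.2) (q z.1 z.2) (ρb z.1 z.2) (ub z.1 z.2)
        fun i => (ρb z.1 z.2)⁻¹ * ρx z.1 z.2 i := by
    have k1 := (BAC.const 1).convInt (T := T) (fun _ => continuous_const) ha hb cκ sκ ie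
    have k2 := ConvInt.sum Finset.univ fun i => (P.lim_U i).convInt (fun n => cU n i) ha hb cκ sκ (im i)
    have k3 := ConvInt.sum Finset.univ fun i =>
      (P.lim_drift i).convInt (fun n => cW n i) ha hb cκ sκ (iq i)
    have lB := (((BAC.const (1 / 2)).mul (BAC.sum Finset.univ fun i _ => (P.lim_U i).pow 2)).add
      ((BAC.const (1 / 2)).mul (BAC.sum Finset.univ fun i _ => (P.lim_drift i).pow 2))).sub lh1
    have k4 := lB.convInt (fun n => ((continuous_const.mul (continuous_finsetSum _ fun i _ =>
      (cU n i).pow 2)).add (continuous_const.mul (continuous_finsetSum _ fun i _ =>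
      (cW n i).pow 2))).sub (ch1 n)) ha hb cκ sκ iρ
    have k5 := lp.convInt cp ha hb cκ sκ i1
    have := (((k1.sub k2).sub k3).add k4).add k5
    simp only [mul_one, one_mul] at this
    exact this
  -- the residuals
  have cη := hη.continuous
  have lRes : ConvInt η (fun n z => residualTerm h (ρ z.1 z.2) (m z.1 z.2) (q z.1 z.2) (R n) (U n) z)
      fun _ => 0 := by
    have k1 := ConvInt.sum Finset.univ fun j =>
      (P.lim_momentumResidual j).convInt (fun n => cP n j) ha hb cη hs (im j)
    have k2 := (BAC.sum Finset.univ fun j _ => (P.lim_U j).mul (P.lim_momentumResidual j)).convInt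
      (fun n => continuous_finsetSum _ fun j _ => (cU n j).mul (cP n j)) ha hb cη hs iρ
    -- The factor ρ - r of this residual mixes weight and coefficient. It is split into a term with
    -- weight ρ and one with weight 1, recombined below.
    have lhN := (P.lim_R.mul lh2).mul P.lim_massResidual
    have k3 := lhN.convInt (fun n => ((cR n).mul (ch2 n)).mul (cN n).continuous) ha hb cη hs iρ
    have k3' := (lhN.mul P.lim_R).convInt
      (fun n => (((cR n).mul (ch2 n)).mul (cN n).continuous).mul (cR n)) ha hb cη hs i1
    have k4 := ConvInt.sum Finset.univ fun j =>
      (P.lim_grad_massResidual j).convInt (fun n => cNx n j) ha hb cη hs (iq j)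
    have k5 := (BAC.sum Finset.univ fun j _ => (P.lim_drift j).mul (P.lim_grad_massResidual j)).convInt
      (fun n => continuous_finsetSum _ fun j _ => (cW n j).mul (cNx n j)) ha hb cη hs iρ
    have := (((k1.sub k2).add (k3.sub k3')).add k4).sub k5
    simp only [mul_zero, zero_mul, Finset.sum_const_zero, sub_zero, add_zero] at this
    convert this using 3 with n z
    unfold residualTerm
    ring
  have hlim := lE.lim.add lRes.lim
  simp only [mul_zero, integral_zero, add_zero] at hlim
  refine ⟨lE.int_lim, le_of_tendsto hlim ?_⟩
  -- The smooth inequality is available only for large n, once the velocity gradient obeys the bound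
  -- on the support of the cutoff.
  filter_upwards [P.grad_U a b ha hb] with n hn
  rw [← integral_add (lE.int n) (lRes.int n)]
  exact integral_relEnergy_inequality S H (P.contDiff_R n) (hpos n) (P.contDiff_U n)
    (P.periodic_R n) (P.periodic_U n) hη hs hη0 ha (abs_nonneg M) hn (fun z => rfl)
    ((lE.int n).add (lRes.int n))

end PassageToLimit

/-! ### Continuity in time of the terms of the relative energy. -/

section TimeContinuity

variable {d : ℕ} {T : ℝ}

lemma IntegrableOn.mul_continuous {f g : Sp d → ℝ} (hf : IntegrableOn f (cell d))
    (hg : Continuous g) : IntegrableOn (fun x => f x * g x) (cell d) := by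
  obtain ⟨C, hC⟩ := (isCompact_box (d := d)).exists_bound_of_continuousOn hg.continuousOn
  refine Integrable.mul_bdd (c := C) hf hg.aestronglyMeasurable ?_
  filter_upwards [ae_restrict_mem measurableSet_cell] with x hx using hC x (cell_subset_box hx)

lemma abs_setIntegral_mul_le {f g : Sp d → ℝ} (hf : IntegrableOn f (cell d)) {C : ℝ}
    (hg : ∀ x ∈ cell d, |g x| ≤ C) : |∫ x in cell d, f x * g x| ≤ C * ∫ x in cell d, |f x| := by
  have h1 : IntegrableOn (fun x => C * |f x|) (cell d) := hf.abs.const_mul C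
  rw [← integral_const_mul, ← Real.norm_eq_abs]
  refine norm_integral_le_of_norm_le h1 ?_
  filter_upwards [ae_restrict_mem measurableSet_cell] with x hx
  rw [Real.norm_eq_abs, abs_mul, mul_comm]
  exact mul_le_mul_of_nonneg_right (hg x hx) (abs_nonneg _)

lemma continuous_slice {E : Type*} [TopologicalSpace E] {φ : ℝ → Sp d → E}
    (hφ : ContinuousOn (fun z : Pt d => φ z.1 z.2) (Icc 0 T ×ˢ univ)) {t : ℝ} (ht : t ∈ Icc 0 T) :
    Continuous (φ t) :=
  hφ.comp_continuous (f := fun x : Sp d => ((t, x) : Pt d)) (by fun_prop) fun _ => ⟨ht, trivial⟩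

lemma tendsto_slice {φ : ℝ → Sp d → ℝ}
    (hφ : ContinuousOn (fun z : Pt d => φ z.1 z.2) (Icc 0 T ×ˢ univ)) {t : ℝ} (ht : t ∈ Icc 0 T)
    (x : Sp d) : Tendsto (fun s => φ s x) (𝓝[Icc 0 T] t) (𝓝 (φ t x)) :=
  (hφ (t, x) ⟨ht, trivial⟩).tendsto.comp (f := fun s : ℝ => ((s, x) : Pt d))
    (tendsto_nhdsWithin_of_tendsto_nhds_of_eventually_within _
      ((by fun_prop : Continuous fun s : ℝ => ((s, x) : Pt d)).continuousAt.mono_left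
        nhdsWithin_le_nhds)
      (by filter_upwards [self_mem_nhdsWithin] with s hs using ⟨hs, trivial⟩))

lemma eventually_abs_sub_le {φ : ℝ → Sp d → ℝ}
    (hφ : ContinuousOn (fun z : Pt d => φ z.1 z.2) (Icc 0 T ×ˢ univ)) {t : ℝ} (ht : t ∈ Icc 0 T)
    {ε : ℝ} (hε : 0 < ε) :
    ∀ᶠ s in 𝓝[Icc 0 T] t, ∀ x ∈ cell d, |φ s x - φ t x| ≤ ε := by
  have hu := (isCompact_Icc.prod isCompact_box).uniformContinuousOn_of_continuous
    (hφ.mono (prod_mono subset_rfl (subset_univ (box d))))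
  obtain ⟨δ, hδ, h⟩ := Metric.uniformContinuousOn_iff.1 hu ε hε
  filter_upwards [self_mem_nhdsWithin, mem_nhdsWithin_of_mem_nhds (Metric.ball_mem_nhds t hδ)]
    with s hs hst x hx
  refine (h (s, x) ⟨hs, cell_subset_box hx⟩ (t, x) ⟨ht, cell_subset_box hx⟩ ?_).le
  simpa [Prod.dist_eq] using hst

lemma exists_bound_box {φ : ℝ → Sp d → ℝ}
    (hφ : ContinuousOn (fun z : Pt d => φ z.1 z.2) (Icc 0 T ×ˢ univ)) :
    ∃ C, ∀ t ∈ Icc 0 T, ∀ x ∈ cell d, |φ t x| ≤ C := by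
  obtain ⟨C, hC⟩ := (isCompact_Icc.prod isCompact_box).exists_bound_of_continuousOn
    (hφ.mono (prod_mono subset_rfl (subset_univ (box d))))
  exact ⟨C, fun t ht x hx => hC (t, x) ⟨ht, cell_subset_box hx⟩⟩

/-- Split f(s)φ(s) - f(t)φ(t) as (f(s) - f(t))φ(s) + f(t)(φ(s) - φ(t)). The first part is small by
L¹ continuity and boundedness of φ, the second by dominated convergence. -/
lemma ContL1.continuousOn_integral_mul {f φ : ℝ → Sp d → ℝ} (hf : ContL1 f)
    (hφ : ContinuousOn (fun z : Pt d => φ z.1 z.2) (Icc 0 T ×ˢ univ)) :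
    ContinuousOn (fun t => ∫ x in cell d, f t x * φ t x) (Icc 0 T) := by
  intro t ht
  obtain ⟨C, hC⟩ := exists_bound_box hφ
  have hft := hf.2.1 t ht.1
  have h1 : Tendsto (fun s => ∫ x in cell d, f t x * φ s x) (𝓝[Icc 0 T] t)
      (𝓝 (∫ x in cell d, f t x * φ t x)) := by
    refine tendsto_integral_filter_of_dominated_convergence (fun x => |f t x| * C) ?_ ?_
      (hft.abs.mul_const C) (ae_of_all _ fun x => tendsto_const_nhds.mul (tendsto_slice hφ ht x))
    · filter_upwards [self_mem_nhdsWithin] with s hs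
        using hft.1.mul (continuous_slice hφ hs).aestronglyMeasurable
    · filter_upwards [self_mem_nhdsWithin] with s hs
      filter_upwards [ae_restrict_mem measurableSet_cell] with x hx
      rw [Real.norm_eq_abs, abs_mul]
      exact mul_le_mul_of_nonneg_left (hC s hs x hx) (abs_nonneg _)
  have h2 : Tendsto (fun s => ∫ x in cell d, (f s x - f t x) * φ s x) (𝓝[Icc 0 T] t) (𝓝 0) := by
    have h3 := ((hf.2.2 t ht.1).mono_left (nhdsWithin_mono t (fun _ h => h.1 : Icc 0 T ⊆ Ici 0))).const_mul C
    rw [mul_zero] at h3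
    refine squeeze_zero_norm' ?_ h3
    filter_upwards [self_mem_nhdsWithin] with s hs
    exact abs_setIntegral_mul_le ((hf.2.1 s hs.1).sub hft) (hC s hs)
  have h3 := h2.add h1
  rw [zero_add] at h3
  refine h3.congr' ?_
  filter_upwards [self_mem_nhdsWithin] with s hs
  have hc := continuous_slice hφ hs
  have hd : IntegrableOn (fun x => f s x - f t x) (cell d) := (hf.2.1 s hs.1).sub hft
  rw [← integral_add (IntegrableOn.mul_continuous hd hc) (IntegrableOn.mul_continuous hft hc)]
  congr 1
  ext x
  ring

lemma continuousOn_integral_of_continuousOn {φ : ℝ → Sp d → ℝ}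
    (hφ : ContinuousOn (fun z : Pt d => φ z.1 z.2) (Icc 0 T ×ˢ univ)) :
    ContinuousOn (fun t => ∫ x in cell d, φ t x) (Icc 0 T) := by
  have h1 : ContL1 fun (_ : ℝ) (_ : Sp d) => (1 : ℝ) :=
    ⟨aestronglyMeasurable_const, fun _ _ => integrable_const _, fun t _ => by
      simp only [sub_self, norm_zero, integral_zero]
      exact tendsto_const_nhds⟩
  simpa using h1.continuousOn_integral_mul hφ

/-- Uniform approximation of continuous functions on the torus by smooth ones. -/
lemma exists_contDiff_approx {g : Sp d → ℝ} (hp : Periodic g) (hg : Continuous g) {ε : ℝ}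
    (hε : 0 < ε) : ∃ φ, ContDiff ℝ ∞ φ ∧ Periodic φ ∧ ∀ x ∈ cell d, |g x - φ x| ≤ ε := by
  -- Viewed as a time-independent function, g can be smoothed by the space-time mollifier and read
  -- off at time 0.
  have hF : EssBdd fun z : Pt d => g z.2 := by
    refine ⟨(hg.comp continuous_snd).aestronglyMeasurable, ?_⟩
    obtain ⟨C, hC⟩ := exists_bound_of_continuousOn (T := 0) (f := fun _ => g) (fun _ => hp)
      (hg.comp continuous_snd).continuousOn
    exact ⟨C, ae_of_all _ fun z => hC 0 ⟨le_rfl, le_rfl⟩ z.2⟩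
  have hu := isCompact_box.uniformContinuousAt_of_continuousAt g (fun x _ => hg.continuousAt)
    (Metric.dist_mem_uniformity hε)
  obtain ⟨δ, hδ, h⟩ := Metric.mem_uniformity_dist.1 hu
  obtain ⟨n, hn⟩ := (tendsto_rOut.eventually (gt_mem_nhds hδ)).exists
  refine ⟨fun x => mollify n (fun z => g z.2) (0, x),
    (contDiff_mollify n hF).comp (contDiff_const.prodMk contDiff_id),
    spacePeriodic_mollify n (fun _ => hp) 0, fun x hx => ?_⟩
  rw [abs_sub_comm]
  refine ContDiffBump.dist_normed_convolution_le (φ := bump n) (g := fun z : Pt d => g z.2)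
    (x₀ := (0, x)) hF.meas fun y hy => ?_
  have h1 : dist x y.2 < δ := by
    rw [dist_comm]
    exact ((le_max_right _ _).trans_lt (Metric.mem_ball.1 hy)).trans hn
  rw [dist_comm]
  exact (h h1 (cell_subset_box hx)).le

variable {h : ℝ → ℝ} {γ k A : ℝ} {ρ : ℝ → Sp d → ℝ} {q : ℝ → Sp d → Sp d}
  {l : ℝ → Sp d → ℝ} {m : ℝ → Sp d → Sp d}

lemma IsDissipativeWeakSolution.exists_integral_norm_le (S : IsDissipativeWeakSolution h ρ q l m)
    (H : InternalEnergy h γ k A) (T : ℝ) :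
    ∃ K, 0 ≤ K ∧ ∀ t ∈ Icc 0 T, ∫ x in cell d, ‖q t x‖ ≤ K := by
  -- The bound of `norm_le_energy` is affine in ρ and e; 1/2 - h'(1) is the coefficient of ρ and
  -- h'(1) - h(1) the constant. The resulting integral is continuous on the compact interval, hence
  -- bounded.
  have hρ := S.cont_ρ.continuousOn_integral_mul (T := T) (φ := fun _ _ => 1 / 2 - deriv h 1)
    continuousOn_const
  have he := S.cont_energy.continuousOn_integral_mul (T := T) (φ := fun _ _ => 1)
    continuousOn_const
  have h0 := continuousOn_integral_of_continuousOn (d := d) (T := T)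
    (φ := fun _ _ => deriv h 1 - h 1) continuousOn_const
  obtain ⟨K, hK⟩ := isCompact_Icc.exists_bound_of_continuousOn ((he.add hρ).add h0)
  refine ⟨|K|, abs_nonneg K, fun t ht => ?_⟩
  have iρ := (S.cont_ρ.2.1 t ht.1).mul_const (1 / 2 - deriv h 1)
  have ie := (S.cont_energy.2.1 t ht.1).mul_const 1
  have ic : IntegrableOn (fun _ : Sp d => deriv h 1 - h 1) (cell d) := integrable_const _
  have h1 := (le_abs_self _).trans ((hK t ht).trans (le_abs_self K))
  simp only [Pi.add_apply] at h1
  have h2 := integral_add (ie.add iρ) ic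
  simp only [Pi.add_apply] at h2
  rw [← integral_add ie iρ, ← h2] at h1
  refine le_trans (integral_mono_ae (S.int_q t ht.1).norm ((ie.add iρ).add ic) ?_) h1
  filter_upwards [S.nonneg t ht.1, S.vacuum_q t ht.1] with x h2 h3
  have := H.norm_le_energy (m := m t x) h2 h3
  simp only [Pi.add_apply]
  linarith

/-- No L¹ continuity of ∇ρ is assumed. Against a smooth φ, however, ∫ qφ = -∫ ρ ∂φ is continuous,
and the uniform L¹ bound on q allows replacing w near time t by a smooth uniform approximation of
w(t). -/
lemma IsDissipativeWeakSolution.continuousOn_integral_q_mul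
    (S : IsDissipativeWeakSolution h ρ q l m) (H : InternalEnergy h γ k A) (i : Fin d)
    {w : ℝ → Sp d → ℝ} (hp : ∀ t, Periodic (w t))
    (hw : ContinuousOn (fun z : Pt d => w z.1 z.2) (Icc 0 T ×ˢ univ)) :
    ContinuousOn (fun t => ∫ x in cell d, q t x i * w t x) (Icc 0 T) := by
  obtain ⟨K, hK0, hK⟩ := S.exists_integral_norm_le H T
  have iq : ∀ t ∈ Icc 0 T, IntegrableOn (fun x => q t x i) (cell d) := fun t ht =>
    (EuclideanSpace.proj (𝕜 := ℝ) i).integrable_comp (S.int_q t ht.1)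
  have hKi : ∀ t ∈ Icc 0 T, ∫ x in cell d, |q t x i| ≤ K := fun t ht =>
    (integral_mono (iq t ht).abs (S.int_q t ht.1).norm
      fun x => PiLp.norm_apply_le (q t x) i).trans (hK t ht)
  intro t ht
  rw [ContinuousWithinAt, Metric.tendsto_nhds]
  intro ε hε
  -- Replacing w by φ costs at most 2δK at time s and as much at time t, and 4δK < ε; the + 1 covers
  -- K = 0.
  set δ := ε / (4 * (K + 1)) with hδ
  have hδ0 : 0 < δ := by positivity
  obtain ⟨φ, hφ, hφp, happ⟩ := exists_contDiff_approx (hp t) (continuous_slice hw ht) hδ0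
  have hdx : Continuous (dx i φ) :=
    (hφ.continuous_fderiv (by simp)).clm_apply continuous_const
  have hρ := (S.cont_ρ.continuousOn_integral_mul (T := T) (φ := fun _ => dx i φ)
    (hdx.comp continuous_snd).continuousOn t ht).tendsto
  have e1 : ∀ s ∈ Icc 0 T, ∀ g : Sp d → ℝ, Continuous g → (∀ x ∈ cell d, |g x - φ x| ≤ 2 * δ) →
      |(∫ x in cell d, q s x i * g x) + ∫ x in cell d, ρ s x * dx i φ x| ≤ 2 * δ * K := by
    intro s hs g hg hgφ
    rw [S.grad s hs.1 φ hφ hφp i, ← sub_eq_add_neg, ← integral_sub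
      (IntegrableOn.mul_continuous (iq s hs) hg) (IntegrableOn.mul_continuous (iq s hs) hφ.continuous)]
    simp only [← mul_sub]
    exact (abs_setIntegral_mul_le (iq s hs) hgφ).trans
      (mul_le_mul_of_nonneg_left (hKi s hs) (by positivity))
  have e2 := e1 t ht (w t) (continuous_slice hw ht) fun x hx =>
    (happ x hx).trans (by linarith)
  have hKδ : 4 * δ * K < ε := by
    have : 4 * δ * (K + 1) = ε := by rw [hδ]; field_simp
    nlinarith
  filter_upwards [self_mem_nhdsWithin, eventually_abs_sub_le hw ht hδ0,
    Metric.tendsto_nhds.1 hρ (ε - 4 * δ * K) (by linarith)] with s hs h1 h2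
  have e3 := e1 s hs (w s) (continuous_slice hw hs) fun x hx => by
    have := abs_sub_le (w s x) (w t x) (φ x)
    linarith [h1 x hx, happ x hx]
  rw [Real.dist_eq] at h2 ⊢
  rw [abs_lt] at h2 ⊢
  rw [abs_le] at e2 e3
  constructor <;> linarith [e2.1, e2.2, e3.1, e3.2, h2.1, h2.2]

end TimeContinuity

/-! ### Gronwall's inequality for distributional inequalities. -/

section Gronwall

variable {C T : ℝ} {E : ℝ → ℝ}

/-- ζ(x) is the integral of a bump of radius r over [x - t, x - s], a smooth substitute for the
indicator of [s,t] whose derivative is a bump at s minus a bump at t. -/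
lemma exists_contDiff_primitive_bump (r s t : ℝ) (hr : 0 < r) (hst : s ≤ t) :
    ∃ φ ζ : ℝ → ℝ, Continuous φ ∧ HasCompactSupport φ ∧ (∀ x, 0 ≤ φ x) ∧ (∀ x, r ≤ |x| → φ x = 0) ∧
      ∫ x, φ x = 1 ∧ ContDiff ℝ ∞ ζ ∧ (∀ x, 0 ≤ ζ x) ∧ (∀ x ∉ Icc (s - r) (t + r), ζ x = 0) ∧
      ∀ x, HasDerivAt ζ (φ (x - s) - φ (x - t)) x := by
  let f : ContDiffBump (0 : ℝ) := ⟨r / 2, r, by positivity, by linarith⟩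
  have hc : Continuous (f.normed volume) := f.continuous_normed
  have hP : ∀ x, HasDerivAt (fun x => ∫ y in (0 : ℝ)..x, f.normed volume y) (f.normed volume x) x :=
    fun x => (hc.integral_hasStrictDerivAt 0 x).hasDerivAt
  have h0 : ∀ x, r ≤ |x| → f.normed volume x = 0 := by
    intro x hx
    by_contra hne
    have : x ∈ Function.support (f.normed volume) := hne
    rw [f.support_normed_eq, mem_ball_zero_iff] at this
    exact absurd this (not_lt.2 hx)
  have hsP : ContDiff ℝ ∞ fun x => ∫ y in (0 : ℝ)..x, f.normed volume y := by
    refine contDiff_infty_iff_deriv.2 ⟨fun x => (hP x).differentiableAt, ?_⟩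
    rw [funext fun x => (hP x).deriv]
    exact f.contDiff_normed
  have hζ : ∀ x, (∫ y in (0 : ℝ)..x - s, f.normed volume y) - ∫ y in (0 : ℝ)..x - t, f.normed volume y
      = ∫ y in x - t..x - s, f.normed volume y := fun x =>
    intervalIntegral.integral_interval_sub_left (hc.intervalIntegrable _ _)
      (hc.intervalIntegrable _ _)
  refine ⟨f.normed volume, fun x => (∫ y in (0 : ℝ)..x - s, f.normed volume y)
    - ∫ y in (0 : ℝ)..x - t, f.normed volume y, hc, f.hasCompactSupport_normed, f.nonneg_normed, h0,
    f.integral_normed, ?_, fun x => ?_, fun x hx => ?_, fun x => ?_⟩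
  · exact (hsP.comp (contDiff_id.sub contDiff_const)).sub (hsP.comp (contDiff_id.sub contDiff_const))
  · simp only [hζ]
    exact intervalIntegral.integral_nonneg (by linarith) fun y _ => f.nonneg_normed y
  · simp only [hζ]
    rw [intervalIntegral.integral_congr (g := fun _ => 0), intervalIntegral.integral_zero]
    intro y hy
    rw [uIcc_of_le (by linarith)] at hy
    refine h0 y ?_
    rcases not_and_or.1 hx with h1 | h1
    · have := neg_le_abs y
      linarith [hy.2, not_le.1 h1]
    · have := le_abs_self y
      linarith [hy.1, not_le.1 h1]
  · have h1 := (hP (x - s)).comp x ((hasDerivAt_id x).sub_const s)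
    have h2 := (hP (x - t)).comp x ((hasDerivAt_id x).sub_const t)
    have := h1.sub h2
    rw [mul_one, mul_one] at this
    exact this

/-- With η = e^(-Cx) ζ one has -η' - Cη = -e^(-Cx) ζ'. The hypothesis then says that the local
average of e^(-Cx) E around t is at most the one around s. -/
lemma exp_mul_antitoneOn_of_weak_inequality (hE : Continuous E)
    (h : ∀ (η : ℝ → ℝ) (a b : ℝ), ContDiff ℝ ∞ η → (∀ t ∉ Icc a b, η t = 0) → (∀ t, 0 ≤ η t) →
      0 < a → b < T → ∫ t, (-deriv η t - C * η t) * E t ≤ 0) :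
    AntitoneOn (fun t => Real.exp (-C * t) * E t) (Ioo 0 T) := by
  set G := fun t => Real.exp (-C * t) * E t with hG
  have hGc : Continuous G := (by fun_prop : Continuous fun t => Real.exp (-C * t)).mul hE
  intro s hs t ht hst
  by_contra! hlt
  -- If G(s) < c₁ < c₂ < G(t), a sufficiently small radius keeps the averages on the same sides of
  -- c₁ and c₂, which contradicts their order.
  obtain ⟨c₁, h1, h2⟩ := exists_between hlt
  obtain ⟨c₂, h2, h3⟩ := exists_between h2
  obtain ⟨ε₁, hε₁, k1⟩ := Metric.eventually_nhds_iff.1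
    ((hGc.tendsto s).eventually (gt_mem_nhds h1))
  obtain ⟨ε₂, hε₂, k2⟩ := Metric.eventually_nhds_iff.1
    ((hGc.tendsto t).eventually (lt_mem_nhds h3))
  obtain ⟨r, hr0, hr⟩ : ∃ r, 0 < r ∧ r ≤ ε₁ ∧ r ≤ ε₂ ∧ r < s ∧ r < T - t := by
    refine ⟨min (min ε₁ ε₂) (min (s / 2) ((T - t) / 2)), ?_, ?_, ?_, ?_, ?_⟩
    · have := hs.1
      have := ht.2
      have : 0 < T - t := by linarith
      positivity
    · exact (min_le_left _ _).trans (min_le_left _ _)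
    · exact (min_le_left _ _).trans (min_le_right _ _)
    · exact ((min_le_right _ _).trans (min_le_left _ _)).trans_lt (by linarith [hs.1])
    · exact ((min_le_right _ _).trans (min_le_right _ _)).trans_lt (by linarith [ht.2])
  obtain ⟨φ, ζ, hφ, hφs, hφ0, hφr, hφ1, hζ, hζ0, hζs, hζd⟩ :=
    exists_contDiff_primitive_bump r s t hr0 hst
  have key := h (fun x => Real.exp (-C * x) * ζ x) (s - r) (t + r) (by fun_prop)
    (fun x hx => by rw [hζs x hx, mul_zero])
    (fun x => mul_nonneg (Real.exp_pos _).le (hζ0 x)) (by linarith [hr.2.2.1])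
    (by linarith [hr.2.2.2])
  have hint : ∀ y, Integrable fun x => φ (x - y) * G x := fun y =>
    ((hφ.comp (continuous_id.sub continuous_const)).mul hGc).integrable_of_hasCompactSupport
      ((hφs.comp_homeomorph (Homeomorph.subRight y)).mul_right)
  have hint' : ∀ y c, Integrable fun x => φ (x - y) * c := fun y c =>
    ((hφ.integrable_of_hasCompactSupport hφs).comp_sub_right y).mul_const c
  have hone : ∀ y c, ∫ x, φ (x - y) * c = c := fun y c => by
    rw [integral_mul_const, integral_sub_right_eq_self φ y, hφ1, one_mul]
  have e : ∀ x, (-deriv (fun x => Real.exp (-C * x) * ζ x) x - C * (Real.exp (-C * x) * ζ x)) * E x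
      = φ (x - t) * G x - φ (x - s) * G x := by
    intro x
    have h1 : HasDerivAt (fun x => Real.exp (-C * x)) (Real.exp (-C * x) * -C) x := by
      simpa using ((hasDerivAt_id x).const_mul (-C)).exp
    rw [(h1.fun_mul (hζd x)).deriv]
    simp only [hG]
    ring
  simp only [e] at key
  rw [integral_sub (hint t) (hint s)] at key
  have l1 : c₂ ≤ ∫ x, φ (x - t) * G x := by
    rw [← hone t c₂]
    refine integral_mono (hint' t c₂) (hint t) fun x => ?_
    by_cases hx : r ≤ |x - t|
    · simp [hφr _ hx]
    · exact mul_le_mul_of_nonneg_left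
        (k2 ((Real.dist_eq x t).trans_lt ((not_le.1 hx).trans_le hr.2.1))).le (hφ0 _)
  have l2 : ∫ x, φ (x - s) * G x ≤ c₁ := by
    rw [← hone s c₁]
    refine integral_mono (hint s) (hint' s c₁) fun x => ?_
    by_cases hx : r ≤ |x - s|
    · simp [hφr _ hx]
    · exact mul_le_mul_of_nonneg_left
        (k1 ((Real.dist_eq x s).trans_lt ((not_le.1 hx).trans_le hr.1))).le (hφ0 _)
  linarith

/-- Gronwall's inequality for a differential inequality in the sense of distributions. -/
lemma le_exp_mul_of_weak_inequality (hT : 0 < T) (hE : ContinuousOn E (Icc 0 T))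
    (h : ∀ (η : ℝ → ℝ) (a b : ℝ), ContDiff ℝ ∞ η → (∀ t ∉ Icc a b, η t = 0) → (∀ t, 0 ≤ η t) →
      0 < a → b < T → ∫ t, (-deriv η t - C * η t) * E t ≤ 0) :
    ∀ t ∈ Icc 0 T, E t ≤ Real.exp (C * t) * E 0 := by
  -- A continuous extension to the whole line changes nothing in the hypothesis, because the test
  -- functions are supported in (0,T).
  set E' := IccExtend hT.le ((Icc 0 T).domRestrict E) with hE'
  have hc : Continuous E' := hE.domRestrict.Icc_extend'
  have heq : ∀ t ∈ Icc 0 T, E' t = E t := fun t ht => IccExtend_of_mem hT.le _ ht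
  have hanti := exp_mul_antitoneOn_of_weak_inequality (C := C) (T := T) hc
    fun η a b hη hs h0 ha hb => by
      refine le_of_eq_of_le (integral_congr_ae (ae_of_all _ fun t => ?_)) (h η a b hη hs h0 ha hb)
      by_cases ht : t ∈ Icc a b
      · simp only [heq t ⟨ha.le.trans ht.1, ht.2.trans hb.le⟩]
      · simp only [hs t ht, deriv_eq_zero_of_notMem hs t ht, neg_zero, mul_zero, sub_zero, zero_mul]
  set G := fun t => Real.exp (-C * t) * E' t with hG
  have hGc : Continuous G := (by fun_prop : Continuous fun t => Real.exp (-C * t)).mul hc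
  -- Monotonicity is known on the open interval only; continuity adds the initial time here and the
  -- final time next.
  have h1 : ∀ t ∈ Ioo 0 T, G t ≤ G 0 := fun t ht => by
    refine ge_of_tendsto (hGc.tendsto 0 |>.mono_left nhdsWithin_le_nhds : Tendsto G (𝓝[>] 0) _) ?_
    filter_upwards [Ioo_mem_nhdsGT ht.1] with s hs
    exact hanti ⟨hs.1, hs.2.trans ht.2⟩ ht hs.2.le
  have h2 : ∀ t ∈ Icc 0 T, G t ≤ G 0 := by
    intro t ht
    rw [← closure_Ioo hT.ne] at ht
    exact closure_minimal h1 (isClosed_le hGc continuous_const) ht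
  intro t ht
  have h3 := h2 t ht
  simp only [hG, heq t ht, heq 0 ⟨le_rfl, hT.le⟩, mul_zero, Real.exp_zero, one_mul] at h3
  have h4 := mul_le_mul_of_nonneg_left h3 (Real.exp_pos (C * t)).le
  rwa [← mul_assoc, ← Real.exp_add, neg_mul, add_neg_cancel, Real.exp_zero, one_mul] at h4

end Gronwall

/-! ### The stability estimate. -/

section Stability

variable {d : ℕ} {T M : ℝ} {h : ℝ → ℝ} {γ k A : ℝ} {ρ : ℝ → Sp d → ℝ} {q : ℝ → Sp d → Sp d}
  {l : ℝ → Sp d → ℝ} {m : ℝ → Sp d → Sp d} {ρb : ℝ → Sp d → ℝ} {ub : ℝ → Sp d → Sp d}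
  {D : StrongDerivs d}

lemma relEnergy_ae_eq_expanded (S : IsDissipativeWeakSolution h ρ q l m)
    (B : IsStrongSolution h T ρb ub D) {t : ℝ} (ht : t ∈ Icc 0 T) :
    (fun x => relEnergy h (ρ t x) (q t x) (m t x) (ρb t x) (D.ρx t x) (ρb t x • ub t x))
      =ᵐ[volume.restrict (cell d)] fun x =>
        expandedRelEnergy h (energy h (ρ t x) (q t x) (m t x)) (ρ t x) (m t x) (q t x) (ρb t x)
          (ub t x) fun i => (ρb t x)⁻¹ * D.ρx t x i := by
  filter_upwards [S.vacuum_m t ht.1, S.vacuum_q t ht.1] with x h1 h2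
    using relEnergy_eq_expanded (B.pos t ht x).ne' h1 h2

/-- The coefficients of the expanded relative energy are continuous. -/
lemma IsStrongSolution.continuousOn_coefficients (B : IsStrongSolution h T ρb ub D)
    (H : InternalEnergy h γ k A) :
    (∀ i, ContinuousOn (fun z : Pt d => ub z.1 z.2 i) (Icc 0 T ×ˢ univ)) ∧
    (∀ i, ContinuousOn (fun z : Pt d => (ρb z.1 z.2)⁻¹ * D.ρx z.1 z.2 i) (Icc 0 T ×ˢ univ)) ∧
    ContinuousOn (fun z : Pt d => 1 / 2 * ∑ i, ub z.1 z.2 i ^ 2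
      + 1 / 2 * ∑ i, ((ρb z.1 z.2)⁻¹ * D.ρx z.1 z.2 i) ^ 2 - deriv h (ρb z.1 z.2))
      (Icc 0 T ×ˢ univ) ∧
    ContinuousOn (fun z : Pt d => pressure h (ρb z.1 z.2)) (Icc 0 T ×ˢ univ) := by
  have hmaps : MapsTo (fun z : Pt d => ρb z.1 z.2) (Icc 0 T ×ˢ univ) (Ioi 0) := fun z hz =>
    B.pos z.1 hz.1 z.2
  have c_u : ∀ i, ContinuousOn (fun z : Pt d => ub z.1 z.2 i) (Icc 0 T ×ˢ univ) := fun i =>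
    (EuclideanSpace.proj (𝕜 := ℝ) i).continuous.comp_continuousOn B.cont_u
  have c_w : ∀ i, ContinuousOn (fun z : Pt d => (ρb z.1 z.2)⁻¹ * D.ρx z.1 z.2 i)
      (Icc 0 T ×ˢ univ) := fun i =>
    (B.cont_ρ.inv₀ fun z hz => (hmaps hz).ne').mul
      ((EuclideanSpace.proj (𝕜 := ℝ) i).continuous.comp_continuousOn B.cont_ρx)
  refine ⟨c_u, c_w, ?_, H.contDiffOn_pressure.continuousOn.comp B.cont_ρ hmaps⟩
  exact ((continuousOn_const.mul (continuousOn_finsetSum _ fun i _ => (c_u i).pow 2)).add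
    (continuousOn_const.mul (continuousOn_finsetSum _ fun i _ => (c_w i).pow 2))).sub
    (H.contDiffOn_deriv.continuousOn.comp B.cont_ρ hmaps)

/-- Affinity in the weak quantities, with coefficients continuous on the compact box, makes each
summand integrable. The split form is what lets continuity in time be proved term by term. -/
lemma relTotal_eq_and_integrable (S : IsDissipativeWeakSolution h ρ q l m)
    (H : InternalEnergy h γ k A) (B : IsStrongSolution h T ρb ub D) {t : ℝ} (ht : t ∈ Icc 0 T) :
    IntegrableOn (fun x => relEnergy h (ρ t x) (q t x) (m t x) (ρb t x) (D.ρx t x)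
      (ρb t x • ub t x)) (cell d) ∧
    relTotal h ρ q m ρb D.ρx (fun t x => ρb t x • ub t x) t
      = (∫ x in cell d, energy h (ρ t x) (q t x) (m t x) * 1)
        - (∑ i, ∫ x in cell d, m t x i * ub t x i)
        - (∑ i, ∫ x in cell d, q t x i * ((ρb t x)⁻¹ * D.ρx t x i))
        + (∫ x in cell d, ρ t x * (1 / 2 * ∑ i, ub t x i ^ 2
            + 1 / 2 * ∑ i, ((ρb t x)⁻¹ * D.ρx t x i) ^ 2 - deriv h (ρb t x)))
        + ∫ x in cell d, pressure h (ρb t x) := by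
  obtain ⟨c_u, c_w, c_B, c_p⟩ := B.continuousOn_coefficients H
  have i1 : IntegrableOn (fun x => energy h (ρ t x) (q t x) (m t x) * 1) (cell d) :=
    (S.cont_energy.2.1 t ht.1).mul_const 1
  have im : ∀ i, IntegrableOn (fun x => m t x i) (cell d) := fun i =>
    (S.cont_m.component i).2.1 t ht.1
  have i2 := fun i => IntegrableOn.mul_continuous (im i)
    (continuous_slice (φ := fun t x => ub t x i) (c_u i) ht)
  have iq : ∀ i, IntegrableOn (fun x => q t x i) (cell d) := fun i =>
    (EuclideanSpace.proj (𝕜 := ℝ) i).integrable_comp (S.int_q t ht.1)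
  have i3 := fun i => IntegrableOn.mul_continuous (iq i)
    (continuous_slice (φ := fun t x => (ρb t x)⁻¹ * D.ρx t x i) (c_w i) ht)
  have i4 := IntegrableOn.mul_continuous (S.cont_ρ.2.1 t ht.1)
    (continuous_slice (φ := fun t x => 1 / 2 * ∑ i, ub t x i ^ 2
      + 1 / 2 * ∑ i, ((ρb t x)⁻¹ * D.ρx t x i) ^ 2 - deriv h (ρb t x)) c_B ht)
  have i5 := integrableOn_cell_of_continuous
    (continuous_slice (φ := fun t x => pressure h (ρb t x)) c_p ht)
  have s2 := integrable_finsetSum Finset.univ fun i _ => i2 i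
  have s3 := integrable_finsetSum Finset.univ fun i _ => i3 i
  have hae := relEnergy_ae_eq_expanded S B ht
  have hint := (((i1.sub s2).sub s3).add i4).add i5
  have heq := hae.trans (ae_of_all _ fun x => show _ = energy h (ρ t x) (q t x) (m t x) * 1
      - (∑ i, m t x i * ub t x i) - (∑ i, q t x i * ((ρb t x)⁻¹ * D.ρx t x i))
      + ρ t x * (1 / 2 * ∑ i, ub t x i ^ 2 + 1 / 2 * ∑ i, ((ρb t x)⁻¹ * D.ρx t x i) ^ 2
        - deriv h (ρb t x)) + pressure h (ρb t x) by simp only [expandedRelEnergy, mul_one])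
  refine ⟨Integrable.congr hint heq.symm, ?_⟩
  have r1 := integral_add (((i1.sub s2).sub s3).add i4) i5
  have r2 := integral_add ((i1.sub s2).sub s3) i4
  have r3 := integral_sub (i1.sub s2) s3
  have r4 := integral_sub i1 s2
  rw [integral_finsetSum _ fun i _ => i2 i] at r4
  rw [integral_finsetSum _ fun i _ => i3 i] at r3
  simp only [Pi.add_apply, Pi.sub_apply] at r1 r2 r3 r4
  rw [relTotal, integral_congr_ae heq, r1, r2, r3, r4]

lemma continuousOn_relTotal (S : IsDissipativeWeakSolution h ρ q l m)
    (H : InternalEnergy h γ k A) (B : IsStrongSolution h T ρb ub D) :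
    ContinuousOn (relTotal h ρ q m ρb D.ρx fun t x => ρb t x • ub t x) (Icc 0 T) := by
  obtain ⟨c_u, c_w, c_B, c_p⟩ := B.continuousOn_coefficients H
  refine ContinuousOn.congr ?_ fun t ht => (relTotal_eq_and_integrable S H B ht).2
  have k1 := S.cont_energy.continuousOn_integral_mul (T := T) (φ := fun _ _ => 1) continuousOn_const
  have k2 := fun i =>
    (S.cont_m.component i).continuousOn_integral_mul (φ := fun t x => ub t x i) (c_u i)
  have k3 := fun i => S.continuousOn_integral_q_mul H i
    (w := fun t x => (ρb t x)⁻¹ * D.ρx t x i) (fun t j x => by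
      simp only [B.periodic_ρ t j x, B.periodic_ρx t j x]) (c_w i)
  have k4 := S.cont_ρ.continuousOn_integral_mul (φ := fun t x => 1 / 2 * ∑ i, ub t x i ^ 2
      + 1 / 2 * ∑ i, ((ρb t x)⁻¹ * D.ρx t x i) ^ 2 - deriv h (ρb t x)) c_B
  have k5 := continuousOn_integral_of_continuousOn (φ := fun t x => pressure h (ρb t x)) c_p
  exact (((k1.sub (continuousOn_finsetSum _ fun i _ => k2 i)).sub
    (continuousOn_finsetSum _ fun i _ => k3 i)).add k4).add k5

/-- Fubini applied to the space-time inequality, whose factor η' and η depend on time only. -/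
lemma integral_relTotal_le (S : IsDissipativeWeakSolution h ρ q l m)
    (H : InternalEnergy h γ k A) (B : IsStrongSolution h T ρb ub D) (V : VelocityBound T M ub D)
    {η : ℝ → ℝ} {a b : ℝ} (hη : ContDiff ℝ ∞ η) (hs : ∀ t ∉ Icc a b, η t = 0)
    (hη0 : ∀ t, 0 ≤ η t) (ha : 0 < a) (hb : b < T) :
    ∫ t, (-deriv η t - d * |M| * (2 + A) * η t)
      * relTotal h ρ q m ρb D.ρx (fun t x => ρb t x • ub t x) t ≤ 0 := by
  obtain ⟨R, U, P⟩ := B.exists_approximation H V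
  obtain ⟨hint, hle⟩ := P.integral_relEnergy_le S H hη hs hη0 ha hb
  rw [volume_restrict_prod] at hle
  rw [IntegrableOn, volume_restrict_prod] at hint
  rw [integral_prod _ hint] at hle
  simp only [integral_const_mul] at hle
  have hz : ∀ t ∉ Icc a b, -deriv η t - d * |M| * (2 + A) * η t = 0 := fun t ht => by
    rw [hs t ht, deriv_eq_zero_of_notMem hs t ht]; ring
  refine le_of_eq_of_le ?_ hle
  rw [setIntegral_eq_integral_of_forall_compl_eq_zero]
  · refine integral_congr_ae (ae_of_all _ fun t => ?_)
    by_cases ht : t ∈ Icc a b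
    · simp only [relTotal]
      rw [integral_congr_ae (relEnergy_ae_eq_expanded S B ⟨ha.le.trans ht.1, ht.2.trans hb.le⟩)]
    · simp only [hz t ht, zero_mul]
  · intro t ht
    rw [hz t fun h1 => ht (ha.le.trans h1.1), zero_mul]

/-- The stability estimate for the relative energy. -/
lemma relTotal_le_exp_mul (S : IsDissipativeWeakSolution h ρ q l m)
    (H : InternalEnergy h γ k A) (B : IsStrongSolution h T ρb ub D) (V : VelocityBound T M ub D)
    (hT : 0 < T) {t : ℝ} (ht : t ∈ Icc 0 T) :
    relTotal h ρ q m ρb D.ρx (fun t x => ρb t x • ub t x) t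
      ≤ Real.exp (d * |M| * (2 + A) * t)
        * relTotal h ρ q m ρb D.ρx (fun t x => ρb t x • ub t x) 0 :=
  le_exp_mul_of_weak_inequality hT (continuousOn_relTotal S H B)
    (fun _ _ _ hη hs h0 ha hb => integral_relTotal_le S H B V hη hs h0 ha hb) t ht

end Stability

/-! ### Uniqueness of weak gradients and their existence at every time. -/

section WeakGradients

variable {d : ℕ}

/-- The open unit cube. -/
def openCell (d : ℕ) : Set (Sp d) := {x | ∀ i, x i ∈ Ioo (0 : ℝ) 1}

lemma isOpen_openCell : IsOpen (openCell d) := by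
  have : openCell d = ⋂ i, (fun x : Sp d => x i) ⁻¹' Ioo 0 1 := by ext x; simp [openCell]
  rw [this]
  exact isOpen_iInter_of_finite fun i => isOpen_Ioo.preimage (by fun_prop)

lemma openCell_subset_cell : openCell d ⊆ cell d := fun _ hx i => ⟨(hx i).1.le, (hx i).2⟩

/-- The missing faces lie in coordinate hyperplanes, which are proper subspaces and hence null. -/
lemma ae_mem_openCell : ∀ᵐ x ∂volume.restrict (cell d), x ∈ openCell d := by
  rw [ae_restrict_iff' measurableSet_cell]
  have h1 : ∀ i : Fin d, ∀ᵐ x : Sp d, x i ≠ 0 := by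
    intro i
    have h2 : volume ((LinearMap.ker (EuclideanSpace.proj (𝕜 := ℝ) i).toLinearMap :
        Submodule ℝ (Sp d)) : Set (Sp d)) = 0 := by
      refine Measure.addHaar_submodule _ _ fun htop => ?_
      have : EuclideanSpace.single i (1 : ℝ) ∈
          LinearMap.ker (EuclideanSpace.proj (𝕜 := ℝ) i).toLinearMap := by rw [htop]; trivial
      simp at this
    refine measure_mono_null (fun x hx => ?_) h2
    simpa using hx
  filter_upwards [ae_all_iff.2 h1] with x hx hxc i
  exact ⟨lt_of_le_of_ne (hxc i).1 (hx i).symm, (hxc i).2⟩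

/-- Compactly supported smooth functions in the open unit cube extend to smooth periodic ones. -/
lemma exists_periodic_extension {g : Sp d → ℝ} (hg : ContDiff ℝ ∞ g) (hc : HasCompactSupport g)
    (hs : tsupport g ⊆ openCell d) : ∃ ψ, ContDiff ℝ ∞ ψ ∧ Periodic ψ ∧ ∀ x ∈ cell d, ψ x = g x := by
  -- A time bump equal to 1 at time 0 turns g into a compactly supported function on space-time, so
  -- the periodization above can be evaluated at time 0.
  let f : ContDiffBump (0 : ℝ) := ⟨1, 2, one_pos, by norm_num⟩
  set φ : Pt d → ℝ := fun z => f z.1 * g z.2 with hφ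
  have hφs : ContDiff ℝ ∞ φ := (f.contDiff.comp contDiff_fst).mul (hg.comp contDiff_snd)
  have hφc : HasCompactSupport φ := by
    refine HasCompactSupport.intro (f.hasCompactSupport.isCompact.prod hc.isCompact) fun z hz => ?_
    rcases not_and_or.1 hz with h | h
    · simp [hφ, image_eq_zero_of_notMem_tsupport h]
    · simp [hφ, image_eq_zero_of_notMem_tsupport h]
  refine ⟨fun x => periodize φ (0, x),
    (contDiff_periodize hφc hφs).comp (contDiff_const.prodMk contDiff_id),
    spacePeriodic_periodize φ 0, fun x hx => ?_⟩
  have hf0 : f 0 = 1 := f.one_of_mem_closedBall (by simp [f.rIn_pos.le])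
  show periodize φ (0, x) = g x
  rw [periodize_eq_sum (S := {0})]
  · have : latticeVec (0 : Fin d → ℤ) = 0 := by ext; simp
    simp [hφ, hf0, this]
  · intro k hk
    have hk0 : k ≠ 0 := by simpa using hk
    -- For x in the cell only the term k = 0 survives, because the support of g stays inside one
    -- tile.
    have : x + latticeVec k ∉ tsupport g := fun h => by
      have h1 := (sub_latticeVec_mem_cell (x + latticeVec k) k).1 (by simpa using hx)
      have h2 := (sub_latticeVec_mem_cell (x + latticeVec k) 0).1 (by
        have : latticeVec (0 : Fin d → ℤ) = 0 := by ext; simp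
        simpa [this] using openCell_subset_cell (hs h))
      exact hk0 (h1.trans h2.symm)
    simp [hφ, image_eq_zero_of_notMem_tsupport this]

lemma ae_eq_zero_of_integral_mul_periodic {f : Sp d → ℝ} (hf : IntegrableOn f (cell d))
    (h : ∀ ψ, ContDiff ℝ ∞ ψ → Periodic ψ → ∫ x in cell d, f x * ψ x = 0) :
    ∀ᵐ x ∂volume.restrict (cell d), f x = 0 := by
  have h1 : ∀ᵐ x : Sp d, x ∈ openCell d → f x = 0 := by
    refine isOpen_openCell.ae_eq_zero_of_integral_contDiff_smul_eq_zero
      (hf.mono_set openCell_subset_cell).locallyIntegrableOn fun g hg hc hs => ?_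
    obtain ⟨ψ, hψ, hp, he⟩ := exists_periodic_extension hg hc hs
    rw [← h ψ hψ hp, ← setIntegral_eq_integral_of_forall_compl_eq_zero (s := cell d)]
    · refine setIntegral_congr_fun measurableSet_cell fun x hx => ?_
      simp only [he x hx, smul_eq_mul, mul_comm]
    · intro x hx
      rw [image_eq_zero_of_notMem_tsupport fun h => hx (openCell_subset_cell (hs h)), zero_smul]
  filter_upwards [ae_mem_openCell, ae_restrict_of_ae h1] with x h2 h3 using h3 h2

/-- Weak gradients are unique. -/
lemma HasWeakGrad.ae_eq {f : Sp d → ℝ} {g g' : Sp d → Sp d} (h : HasWeakGrad f g)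
    (h' : HasWeakGrad f g') (hg : IntegrableOn g (cell d)) (hg' : IntegrableOn g' (cell d)) :
    ∀ᵐ x ∂volume.restrict (cell d), g x = g' x := by
  have hi : ∀ i, ∀ᵐ x ∂volume.restrict (cell d), g x i - g' x i = 0 := by
    intro i
    have c : ∀ {g : Sp d → Sp d}, IntegrableOn g (cell d) → IntegrableOn (fun x => g x i) (cell d) :=
      fun hg => (EuclideanSpace.proj (𝕜 := ℝ) i).integrable_comp hg
    refine ae_eq_zero_of_integral_mul_periodic ((c hg).sub (c hg')) fun ψ hψ hp => ?_
    simp only [sub_mul]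
    rw [integral_sub (IntegrableOn.mul_continuous (c hg) hψ.continuous)
      (IntegrableOn.mul_continuous (c hg') hψ.continuous)]
    linarith [h ψ hψ hp i, h' ψ hψ hp i]
  filter_upwards [ae_all_iff.2 hi] with x hx
  ext i
  linarith [hx i]

lemma exists_Icc_of_isCompact {K : Set ℝ} {a b : ℝ} (hK : IsCompact K) (h : K ⊆ Ioo a b) :
    ∃ a' b', Icc a' b' ⊆ Ioo a b ∧ K ⊆ Icc a' b' := by
  rcases K.eq_empty_or_nonempty with rfl | hne
  · exact ⟨1, 0, by simp, by simp⟩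
  · exact ⟨sInf K, sSup K, fun x hx => ⟨(h (hK.sInf_mem hne)).1.trans_le hx.1,
      hx.2.trans_lt (h (hK.sSup_mem hne)).2⟩,
      fun x hx => ⟨csInf_le hK.bddBelow hx, le_csSup hK.bddAbove hx⟩⟩

/-- The spatial gradient of a strong solution is its weak gradient at every time. -/
lemma IsStrongSolution.hasWeakGrad {h : ℝ → ℝ} {T : ℝ} {ρ : ℝ → Sp d → ℝ} {u : ℝ → Sp d → Sp d}
    {D : StrongDerivs d} (B : IsStrongSolution h T ρ u D) (hT : 0 < T) {t : ℝ} (ht : t ∈ Icc 0 T) :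
    HasWeakGrad (ρ t) (D.ρx t) := by
  intro ψ hψ hp i
  have hdx : Continuous (dx i ψ) := (hψ.continuous_fderiv (by simp)).clm_apply continuous_const
  have c1 : ContinuousOn (fun z : Pt d => ρ z.1 z.2 * dx i ψ z.2) (Icc 0 T ×ˢ univ) :=
    B.cont_ρ.mul (hdx.comp continuous_snd).continuousOn
  have c2 : ContinuousOn (fun z : Pt d => D.ρx z.1 z.2 i * ψ z.2) (Icc 0 T ×ˢ univ) :=
    ((EuclideanSpace.proj (𝕜 := ℝ) i).continuous.comp_continuousOn B.cont_ρx).mul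
      (hψ.continuous.comp continuous_snd).continuousOn
  have g1 := continuousOn_integral_of_continuousOn (φ := fun t x => ρ t x * dx i ψ x) c1
  have g2 := continuousOn_integral_of_continuousOn (φ := fun t x => D.ρx t x i * ψ x) c2
  have hg := g1.add g2
  have hsub : Ioo 0 T ×ˢ cell d ⊆ Icc 0 T ×ˢ box d := prod_mono Ioo_subset_Icc_self cell_subset_box
  have hint : ∀ {F : Pt d → ℝ}, ContinuousOn F (Icc 0 T ×ˢ univ) → ∀ {g : ℝ → ℝ}, Continuous g →
      IntegrableOn (fun z => g z.1 * F z) (Ioo 0 T ×ˢ cell d) := by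
    intro F hF g hgc
    exact ((((hgc.comp continuous_fst).continuousOn.mul hF).mono
      (prod_mono subset_rfl (subset_univ (box d)))).integrableOn_compact
      (isCompact_Icc.prod isCompact_box)).mono_set hsub
  -- Product test functions g(t)ψ(x) localize the space-time identity to almost every time.
  have h0 : ∀ᵐ t : ℝ, t ∈ Ioo 0 T → (∫ x in cell d, ρ t x * dx i ψ x)
      + (∫ x in cell d, D.ρx t x i * ψ x) = 0 := by
    refine isOpen_Ioo.ae_eq_zero_of_integral_contDiff_smul_eq_zero
      ((hg.integrableOn_compact isCompact_Icc).mono_set Ioo_subset_Icc_self).locallyIntegrableOn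
      fun g hgs hgc hgT => ?_
    obtain ⟨a, b, hab, hgab⟩ := exists_Icc_of_isCompact hgc.isCompact hgT
    have htest : IsInteriorTest (Ioo 0 T) fun t x => g t * ψ x :=
      ⟨(hgs.comp contDiff_fst).mul (hψ.comp contDiff_snd), fun t j x => by simp only [hp j x],
        a, b, hab, fun t ht x => by
          show g t * ψ x = 0
          rw [image_eq_zero_of_notMem_tsupport fun h => ht (hgab h), zero_mul]⟩
    have key := B.weak_ρx i _ htest
    have e1 : ∀ (t : ℝ) (x : Sp d), dx i (fun x => g t * ψ x) x = g t * dx i ψ x := fun t x => by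
      simp only [dx]
      rw [fderiv_const_mul (hψ.differentiable (by simp) x)]
      rfl
    have e2 : ∀ z : Pt d, ρ z.1 z.2 * (g z.1 * dx i ψ z.2) = g z.1 * (ρ z.1 z.2 * dx i ψ z.2) :=
      fun z => by ring
    have e3 : ∀ z : Pt d, D.ρx z.1 z.2 i * (g z.1 * ψ z.2) = g z.1 * (D.ρx z.1 z.2 i * ψ z.2) :=
      fun z => by ring
    simp only [e1, e2, e3] at key
    have i1 := hint c1 hgs.continuous
    have i2 := hint c2 hgs.continuous
    rw [← add_eq_zero_iff_eq_neg, ← integral_add i1 i2] at key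
    have i3 := i1.add i2
    rw [IntegrableOn, volume_restrict_prod] at i3
    rw [volume_restrict_prod] at key
    have key2 := (integral_prod _ i3).symm.trans key
    rw [← setIntegral_eq_integral_of_forall_compl_eq_zero (s := Ioo 0 T)]
    · refine Eq.trans ?_ key2
      refine setIntegral_congr_fun measurableSet_Ioo fun t ht => ?_
      have j1 := integrableOn_cell_of_continuous
        (continuous_slice (φ := fun t x => ρ t x * dx i ψ x) c1 (Ioo_subset_Icc_self ht))
      have j2 := integrableOn_cell_of_continuous
        (continuous_slice (φ := fun t x => D.ρx t x i * ψ x) c2 (Ioo_subset_Icc_self ht))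
      simp only [Pi.add_apply, smul_eq_mul]
      rw [← integral_add j1 j2, ← integral_const_mul]
      simp only [mul_add]
    · intro t ht
      rw [image_eq_zero_of_notMem_tsupport fun h => ht (hgT h), zero_smul]
  -- Both integrals are continuous in t, so almost every time becomes every time, including the
  -- initial one needed for uniqueness.
  have h1 : EqOn _ (fun _ => (0 : ℝ)) (Icc 0 T) := Measure.eqOn_Icc_of_ae_eq volume hT.ne (by
    rw [restrict_Ioo_eq_restrict_Icc.symm]
    exact (ae_restrict_iff' measurableSet_Ioo).2 h0) hg continuousOn_const
  exact eq_neg_of_add_eq_zero_left (h1 ht)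

end WeakGradients

/-! ### Vanishing relative energy and weak–strong uniqueness. -/

section Uniqueness

variable {d : ℕ} {T : ℝ} {h : ℝ → ℝ} {γ k A : ℝ} {ρ : ℝ → Sp d → ℝ} {q : ℝ → Sp d → Sp d}
  {l : ℝ → Sp d → ℝ} {m : ℝ → Sp d → Sp d} {ρb : ℝ → Sp d → ℝ} {ub : ℝ → Sp d → Sp d}
  {D : StrongDerivs d}

lemma relEnergy_nonneg (H : InternalEnergy h γ k A) {r s : ℝ} {m q qb u : Sp d} (hr : 0 ≤ r)
    (hs : 0 < s) : 0 ≤ relEnergy h r q m s qb (s • u) := by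
  have := H.relInternal_nonneg hr hs
  rw [relEnergy]
  positivity

/-- All three parts are nonnegative and so vanish. Strict convexity gives r = s > 0, and only then
does the kinetic part, weighted by r, determine m. -/
lemma eq_of_relEnergy_eq_zero (H : InternalEnergy h γ k A) {r s : ℝ} {m q qb u : Sp d}
    (hr : 0 ≤ r) (hs : 0 < s) (h0 : relEnergy h r q m s qb (s • u) = 0) : r = s ∧ m = s • u := by
  have h1 := H.relInternal_nonneg hr hs
  rw [relEnergy] at h0
  have h2 : 0 ≤ 1 / 2 * r * ‖r⁻¹ • m - s⁻¹ • s • u‖ ^ 2 := by positivity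
  have h3 : 0 ≤ 1 / 2 * r * ‖r⁻¹ • q - s⁻¹ • qb‖ ^ 2 := by positivity
  have hrs : r = s := by
    by_contra hne
    linarith [H.relInternal_pos hr hs hne]
  refine ⟨hrs, ?_⟩
  subst hrs
  have h4 : 1 / 2 * r * ‖r⁻¹ • m - r⁻¹ • r • u‖ ^ 2 = 0 := by linarith
  have h5 : ‖r⁻¹ • m - r⁻¹ • r • u‖ ^ 2 = 0 := (mul_eq_zero.1 h4).resolve_left (by positivity)
  rw [sq_eq_zero_iff, norm_eq_zero, ← smul_sub, smul_eq_zero] at h5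
  exact sub_eq_zero.1 (h5.resolve_left (inv_pos.2 hs).ne')

lemma ae_relEnergy_nonneg (S : IsDissipativeWeakSolution h ρ q l m)
    (H : InternalEnergy h γ k A) (B : IsStrongSolution h T ρb ub D) {t : ℝ} (ht : t ∈ Icc 0 T) :
    0 ≤ᵐ[volume.restrict (cell d)] fun x =>
      relEnergy h (ρ t x) (q t x) (m t x) (ρb t x) (D.ρx t x) (ρb t x • ub t x) := by
  filter_upwards [S.nonneg t ht.1] with x hx using relEnergy_nonneg H hx (B.pos t ht x)

lemma relTotal_nonneg (S : IsDissipativeWeakSolution h ρ q l m)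
    (H : InternalEnergy h γ k A) (B : IsStrongSolution h T ρb ub D) {t : ℝ} (ht : t ∈ Icc 0 T) :
    0 ≤ relTotal h ρ q m ρb D.ρx (fun t x => ρb t x • ub t x) t :=
  integral_nonneg_of_ae (ae_relEnergy_nonneg S H B ht)

lemma ae_eq_of_relTotal_eq_zero (S : IsDissipativeWeakSolution h ρ q l m)
    (H : InternalEnergy h γ k A) (B : IsStrongSolution h T ρb ub D) {t : ℝ} (ht : t ∈ Icc 0 T)
    (h0 : relTotal h ρ q m ρb D.ρx (fun t x => ρb t x • ub t x) t = 0) :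
    ∀ᵐ x ∂volume.restrict (cell d), ρ t x = ρb t x ∧ m t x = ρb t x • ub t x := by
  have h1 := (integral_eq_zero_iff_of_nonneg_ae (ae_relEnergy_nonneg S H B ht)
    (relTotal_eq_and_integrable S H B ht).1).1 h0
  filter_upwards [h1, S.nonneg t ht.1] with x h2 h3
    using eq_of_relEnergy_eq_zero H h3 (B.pos t ht x) h2

/-- The data prescribe ρ and m only. The gradient in the capillary part is recovered because q(0)
and ∇ρ̄(0) are both weak gradients of the same density. -/
lemma relTotal_zero_of_ae_eq (S : IsDissipativeWeakSolution h ρ q l m)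
    (B : IsStrongSolution h T ρb ub D) (hT : 0 < T)
    (h0 : ∀ᵐ x ∂volume.restrict (cell d), ρ 0 x = ρb 0 x ∧ m 0 x = ρb 0 x • ub 0 x) :
    relTotal h ρ q m ρb D.ρx (fun t x => ρb t x • ub t x) 0 = 0 := by
  have ht : (0 : ℝ) ∈ Icc 0 T := ⟨le_rfl, hT.le⟩
  have hgrad : HasWeakGrad (ρ 0) (D.ρx 0) := fun φ hφ hp i => by
    rw [← B.hasWeakGrad hT ht φ hφ hp i]
    refine integral_congr_ae ?_
    filter_upwards [h0] with x hx
    rw [hx.1]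
  have hint : IntegrableOn (D.ρx 0) (cell d) :=
    ((continuous_slice B.cont_ρx ht).continuousOn.integrableOn_compact isCompact_box).mono_set
      cell_subset_box
  have hq := (S.grad 0 le_rfl).ae_eq hgrad (S.int_q 0 le_rfl) hint
  rw [relTotal, integral_congr_ae (g := fun _ => 0), integral_zero]
  filter_upwards [h0, hq] with x h1 h2
  rw [h1.1, h1.2, h2]
  simp [relEnergy, relInternal]

end Uniqueness

end QHD
-- The main theorem.
theorem mainTheorem4 (d : ℕ) (A T M : ℝ) (hT : 0 < T) :
    ∃ C : ℝ, 0 < C ∧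
      ∀ (h : ℝ → ℝ) (γ k : ℝ), QHD.InternalEnergy h γ k A →
      ∀ (ρ : ℝ → QHD.Sp d → ℝ) (q : ℝ → QHD.Sp d → QHD.Sp d) (l : ℝ → QHD.Sp d → ℝ)
        (m : ℝ → QHD.Sp d → QHD.Sp d) (K₁ K₂ : ℝ),
        QHD.IsDissipativeWeakSolution h ρ q l m → QHD.FiniteEnergy h T K₁ K₂ ρ q m →
      ∀ (ρb : ℝ → QHD.Sp d → ℝ) (ub : ℝ → QHD.Sp d → QHD.Sp d) (D : QHD.StrongDerivs d),
        QHD.IsStrongSolution h T ρb ub D → QHD.VelocityBound T M ub D →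
      ∀ mb : ℝ → QHD.Sp d → QHD.Sp d, (∀ t x, mb t x = ρb t x • ub t x) →
        -- the relative energy is finite and the stability estimate holds
        (∀ t ∈ Set.Icc 0 T,
          MeasureTheory.IntegrableOn
            (fun x => QHD.relEnergy h (ρ t x) (q t x) (m t x) (ρb t x) (D.ρx t x) (mb t x))
            (QHD.cell d) ∧
          QHD.relTotal h ρ q m ρb D.ρx mb t ≤ C * QHD.relTotal h ρ q m ρb D.ρx mb 0) ∧
        -- if it vanishes at time zero, its supremum over `[0,T]` is zero
        (QHD.relTotal h ρ q m ρb D.ρx mb 0 = 0 →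
          IsLUB (QHD.relTotal h ρ q m ρb D.ρx mb '' Set.Icc 0 T) 0) ∧
        -- weak-strong uniqueness
        ((∀ᵐ x ∂MeasureTheory.volume.restrict (QHD.cell d), ρ 0 x = ρb 0 x ∧ m 0 x = mb 0 x) →
          ∀ t ∈ Set.Icc 0 T, ∀ᵐ x ∂MeasureTheory.volume.restrict (QHD.cell d),
            ρ t x = ρb t x ∧ m t x = mb t x) := by
  -- This is the Gronwall factor at the final time. The absolute values appear because the constant
  -- is fixed before `InternalEnergy` provides A > 0 and no sign of M is given.
  refine ⟨Real.exp (d * |M| * (2 + |A|) * T), Real.exp_pos _, ?_⟩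
  intro h γ k H ρ q l m K₁ K₂ S _ ρb ub D B V mb hmb
  obtain rfl : mb = fun t x => ρb t x • ub t x := funext₂ hmb
  have hA := H.A_pos
  have hzero : (0 : ℝ) ∈ Icc 0 T := ⟨le_rfl, hT.le⟩
  have hbound : ∀ t ∈ Icc 0 T, QHD.relTotal h ρ q m ρb D.ρx (fun t x => ρb t x • ub t x) t
      ≤ Real.exp (d * |M| * (2 + |A|) * T)
        * QHD.relTotal h ρ q m ρb D.ρx (fun t x => ρb t x • ub t x) 0 := by
    intro t ht
    refine (QHD.relTotal_le_exp_mul S H B V hT ht).trans ?_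
    rw [abs_of_pos hA]
    refine mul_le_mul_of_nonneg_right (Real.exp_le_exp.2 ?_) (QHD.relTotal_nonneg S H B hzero)
    exact mul_le_mul_of_nonneg_left ht.2 (by positivity)
  have hvanish : QHD.relTotal h ρ q m ρb D.ρx (fun t x => ρb t x • ub t x) 0 = 0 →
      ∀ t ∈ Icc 0 T, QHD.relTotal h ρ q m ρb D.ρx (fun t x => ρb t x • ub t x) t = 0 :=
    fun h0 t ht => le_antisymm ((hbound t ht).trans_eq (by rw [h0, mul_zero]))
      (QHD.relTotal_nonneg S H B ht)
  refine ⟨fun t ht => ⟨(QHD.relTotal_eq_and_integrable S H B ht).1, hbound t ht⟩, fun h0 => ?_,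
    fun h0 t ht => ?_⟩
  · have himage : QHD.relTotal h ρ q m ρb D.ρx (fun t x => ρb t x • ub t x) '' Icc 0 T = {0} := by
      refine Subset.antisymm ?_ (singleton_subset_iff.2 ⟨0, hzero, h0⟩)
      rintro _ ⟨t, ht, rfl⟩
      exact hvanish h0 t ht
    rw [himage]
    exact isLUB_singleton
  · exact QHD.ae_eq_of_relTotal_eq_zero S H B ht
      (hvanish (QHD.relTotal_zero_of_ae_eq S B hT h0) t ht)
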